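/- Let $(M,g)$ be a connected smooth Riemannian manifold with Levi-Civita connection $\nabla^g$, and let $\tau$ be a smooth $3$-form on $M$. Define $\tau_XY$ by $g(\tau_XY,Z)=\tau(X,Y,Z)$ and suppose that $(M,g,\tau)$ is a geometry with parallel skew torsion, i.e. $\nabla^\tau\tau=0$ for the connection $\nabla^\tau_XY:=\nabla^g_XY+\tau_XY$. For $x\in M$ let $\mathfrak{stab}(\tau)_x\subseteq\mathfrak{so}(T_xM)$ be the Lie algebra of all skew-symmetric endomorphisms $A$ of $T_xM$ with $A_*\tau=0$. Decompose $T_xM$ orthogonally into irreducible $\mathfrak{stab}(\tau)_x$-modules; let $\mathcal H_x$ be the sum of those summands $W$ with $\mathfrak{so}(W)\cap\mathfrak{stab}(\tau)_x\neq0$, and $\mathcal V_x$ the sum of the others (the canonical $\mathfrak{stab}(\tau)$-splitting $TM=\mathcal H\oplus\mathcal V$). Assume that 1. $\mathfrak{stab}(\tau)$ acts almost irreducibly on the tangent spaces: for every $x$, $\dim\mathcal V_x=1$ and $\mathcal H_x$ is an irreducible $\mathfrak{stab}(\tau)_x$-module; 2. $(M,g,\tau)$ has no local one-dimensional factor: there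 is no decomposition $TM=T_1\oplus T_2$ into nontrivial, orthogonal, smooth, $\nabla^\tau$-parallel distributions with $\operatorname{rank}T_1=1$ and $\tau=\tau_1+\tau_2$, $\tau_i\in\Lambda^3T_i$. Then there is a constant $c>0$ such that the rescaled geometry $(M,g',\tau')$ with $g'=c^2g$, $\tau'=c^2\tau$ (which has the same connection $\nabla^{\tau}$) is locally Sasakian with $\tau'=\xi\wedge\Phi$. That is, every point of $M$ has an open neighbourhood $U$ carrying a smooth vector field $\xi$ and a smooth endomorphism field $\Phi$ such that, on $U$ and with respect to $g'$, $\xi$ is a Killing field of unit length, $\Phi$ is skew-symmetric, $$d\xi=2\Phi,\qquad \Phi^2=-\mathrm{Id}+\xi\otimes\xi,\qquad \nabla^{g'}_X\Phi=-X\wedge\xi\quad\text{for all }X,$$ and $\tau'=\xi\wedge\Phi$. Here vectors are identified with $1$-forms by $g'$, $\Phi$ is identified with the $2$-form $\Phi(X,Y)=g'(\Phi X,Y)$, and $(X\wedge Y)Z=g'(X,Z)Y-g'(Y,Z)X$. If moreover the line bundle $\mathcal V$ is trivial (spanned by a continuous nowhere vanishing vector field), such a pair $(\xi,\Phi)$ exists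 globally on $M$, with $U=M$. -/

import Mathlib

open scoped Manifold ContDiff Bundle Topology

noncomputable section

namespace SkewTorsion

/-! ## Invariant subspaces and the canonical splitting of a Lie algebra of endomorphisms -/

section Algebra

variable {V : Type*} [AddCommGroup V] [Module ℝ V]

/-- `W` is invariant under every element of `𝔤`. -/
def IsInvariant (𝔤 : Submodule ℝ (Module.End ℝ V)) (W : Submodule ℝ V) : Prop :=
  ∀ A ∈ 𝔤, ∀ w ∈ W, A w ∈ W

/-- `W` is an irreducible `𝔤`-submodule (in particular, nonzero). -/
def IsIrreducibleSub (𝔤 : Submodule ℝ (Module.End ℝ V)) (W : Submodule ℝ V) : Prop :=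
  IsInvariant 𝔤 W ∧ W ≠ ⊥ ∧ ∀ W' : Submodule ℝ V, W' ≤ W → IsInvariant 𝔤 W' → W' = ⊥ ∨ W' = W

/-- `𝔰𝔬(W) ∩ 𝔤 ≠ 0` for `𝔤 ⊆ 𝔰𝔬(V, b)`: some nonzero element of `𝔤` maps into `W` and vanishes
on the `b`-orthogonal complement of `W`. -/
def MeetsSo (b : V → V → ℝ) (𝔤 : Submodule ℝ (Module.End ℝ V)) (W : Submodule ℝ V) : Prop :=
  ∃ A ∈ 𝔤, A ≠ 0 ∧ (∀ v, A v ∈ W) ∧ ∀ v, (∀ w ∈ W, b v w = 0) → A v = 0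

/-- `V = Hor ⊕ Ver` is the canonical `𝔤`-splitting of the Euclidean space `(V, b)`: for an
orthogonal decomposition of `V` into irreducible `𝔤`-modules, `Hor` is the sum of the
summands `W` with `𝔰𝔬(W) ∩ 𝔤 ≠ 0`, and `Ver` is the sum of the others. -/
def IsCanonicalSplitting (b : V → V → ℝ) (𝔤 : Submodule ℝ (Module.End ℝ V))
    (Hor Ver : Submodule ℝ V) : Prop :=
  ∃ (k : ℕ) (W : Fin k → Submodule ℝ V),
    (∀ i, IsIrreducibleSub 𝔤 (W i)) ∧
    (∀ i j, i ≠ j → ∀ v ∈ W i, ∀ w ∈ W j, b v w = 0) ∧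
    (⨆ i, W i) = ⊤ ∧
    Hor = (⨆ i, ⨆ (_ : MeetsSo b 𝔤 (W i)), W i) ∧
    Ver = ⨆ i, ⨆ (_ : ¬ MeetsSo b 𝔤 (W i)), W i

/-- `𝔤` acts almost irreducibly: in the canonical `𝔤`-splitting, the vertical part is
one-dimensional and the horizontal part is irreducible. -/
def IsAlmostIrreducible (b : V → V → ℝ) (𝔤 : Submodule ℝ (Module.End ℝ V)) : Prop :=
  ∃ Hor Ver : Submodule ℝ V, IsCanonicalSplitting b 𝔤 Hor Ver ∧
    Module.finrank ℝ Ver = 1 ∧ IsIrreducibleSub 𝔤 Hor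

end Algebra

/-! ## Riemannian metrics, vector fields and the Levi-Civita connection -/

variable {n : ℕ} {M : Type*} [TopologicalSpace M] [ChartedSpace (EuclideanSpace ℝ (Fin n)) M]

variable (n M) in
/-- Vector fields without any regularity. -/
abbrev VField := ∀ x : M, TangentSpace (𝓡 n) x

variable (n M) in
/-- Fields of trilinear forms on the tangent spaces. -/
abbrev TriForm := ∀ x : M, TangentSpace (𝓡 n) x →ₗ[ℝ] TangentSpace (𝓡 n) x →ₗ[ℝ]
  TangentSpace (𝓡 n) x →ₗ[ℝ] ℝ

variable (n M) in
/-- Fields of endomorphisms of the tangent spaces. -/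
abbrev EndField := ∀ x : M, TangentSpace (𝓡 n) x →ₗ[ℝ] TangentSpace (𝓡 n) x

variable (n M) in
/-- Fields of subspaces of the tangent spaces. -/
abbrev Distribution := ∀ x : M, Submodule ℝ (TangentSpace (𝓡 n) x)

/-- Derivative of the function `f` at `x` in direction `v`. -/
def dirDeriv (f : M → ℝ) (x : M) (v : TangentSpace (𝓡 n) x) : ℝ :=
  mvfderiv (𝓡 n) f x v

variable [IsManifold (𝓡 n) ∞ M]

variable (n M) in
/-- Smooth Riemannian metrics on `M`. -/
abbrev Metric := Bundle.ContMDiffRiemannianMetric (𝓡 n) ∞ (EuclideanSpace ℝ (Fin n))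
  (fun x : M => TangentSpace (𝓡 n) x)

set_option synthInstance.maxHeartbeats 400000 in
/-- The metric `c² g`, for `c ≠ 0`. -/
def rescale (g : Metric n M) (c : ℝ) (hc : c ≠ 0) : Metric n M where
  inner x := c ^ 2 • g.inner x
  symm x v w := by simp [g.symm x v w]
  pos x v hv := by
    have := g.pos x v hv
    have hc2 : 0 < c ^ 2 := by positivity
    simpa using mul_pos hc2 this
  isVonNBounded x := by
    have h := (g.isVonNBounded x).image
      (c⁻¹ • ContinuousLinearMap.id ℝ (TangentSpace (𝓡 n) x))
    refine h.subset ?_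
    intro v hv
    refine ⟨c • v, ?_, ?_⟩
    · have hv' : c ^ 2 * g.inner x v v < 1 := hv
      change g.inner x (c • v) (c • v) < 1
      rw [map_smul, map_smul]
      change c * (c * g.inner x v v) < 1
      linarith [show c * (c * g.inner x v v) = c ^ 2 * g.inner x v v by ring]
    · change c⁻¹ • (c • v) = v
      rw [smul_smul, inv_mul_cancel₀ hc, one_smul]
  contMDiff := ContMDiff.const_smul_section g.contMDiff

/-- `X` is a smooth vector field on the open set `U`. -/
def SmoothOn (X : VField n M) (U : Set M) : Prop :=
  ContMDiffOn (𝓡 n) (𝓡 n).tangent ∞ (fun x => (⟨x, X x⟩ : TangentBundle (𝓡 n) M)) U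

/-- The tangent vector `w` with `g(w, z) = α(z)` for all `z`, for a linear form `α`. -/
def sharp (g : Metric n M) (x : M) (α : TangentSpace (𝓡 n) x → ℝ) : TangentSpace (𝓡 n) x :=
  Classical.epsilon fun w => ∀ z, g.inner x w z = α z

/-- The right-hand side of the Koszul formula for `2 g(∇_X Y, Z)`. -/
def koszul (g : Metric n M) (X Y Z : VField n M) (x : M) : ℝ :=
  dirDeriv (fun y => g.inner y (Y y) (Z y)) x (X x)
    + dirDeriv (fun y => g.inner y (X y) (Z y)) x (Y x)
    - dirDeriv (fun y => g.inner y (X y) (Y y)) x (Z x)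
    + g.inner x (VectorField.mlieBracket (𝓡 n) X Y x) (Z x)
    - g.inner x (VectorField.mlieBracket (𝓡 n) X Z x) (Y x)
    - g.inner x (VectorField.mlieBracket (𝓡 n) Y Z x) (X x)

/-- A vector field which extends the tangent vector `v` and is smooth near its base point. -/
abbrev ext {x : M} (v : TangentSpace (𝓡 n) x) : VField n M :=
  FiberBundle.extend (EuclideanSpace ℝ (Fin n)) v

/-- The Levi-Civita connection: `leviCivita g Y x v` is `(∇^g_v Y)(x)`, for `Y` differentiable
at `x`, as given by the Koszul formula. The right-hand side of that formula is tensorial in `X`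
and `Z`, so the choice of the extensions of `v` and `z` does not matter. -/
def leviCivita (g : Metric n M) (Y : VField n M) (x : M) (v : TangentSpace (𝓡 n) x) :
    TangentSpace (𝓡 n) x :=
  sharp g x fun z => koszul g (ext v) Y (ext z) x / 2

/-! ## Geometries with parallel skew torsion -/

/-- `τ` is a smooth `3`-form. -/
structure IsThreeForm (τ : TriForm n M) : Prop where
  alt_left : ∀ x u w, τ x u u w = 0
  alt_right : ∀ x u w, τ x u w w = 0
  smooth : ∀ (U : Set M) (X Y Z : VField n M), IsOpen U → SmoothOn X U → SmoothOn Y U →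
    SmoothOn Z U → ContMDiffOn (𝓡 n) 𝓘(ℝ, ℝ) ∞ (fun x => τ x (X x) (Y x) (Z x)) U

/-- The connection `∇^τ = ∇^g + τ`, that is `∇^τ_v Y = ∇^g_v Y + τ_v Y` with
`g(τ_v w, z) = τ(v, w, z)`. -/
def connection (g : Metric n M) (τ : TriForm n M) (Y : VField n M) (x : M)
    (v : TangentSpace (𝓡 n) x) : TangentSpace (𝓡 n) x :=
  leviCivita g Y x v + sharp g x (τ x v (Y x))

/-- `(M, g, τ)` is a geometry with parallel skew torsion: `τ` is a `3`-form and `∇^τ τ = 0`. -/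
structure IsParallelSkewTorsion (g : Metric n M) (τ : TriForm n M) : Prop where
  threeForm : IsThreeForm τ
  parallel : ∀ (U : Set M) (X Y Z : VField n M), IsOpen U → SmoothOn X U → SmoothOn Y U →
    SmoothOn Z U → ∀ x ∈ U, ∀ v : TangentSpace (𝓡 n) x,
      dirDeriv (fun y => τ y (X y) (Y y) (Z y)) x v
        - τ x (connection g τ X x v) (Y x) (Z x)
        - τ x (X x) (connection g τ Y x v) (Z x)
        - τ x (X x) (Y x) (connection g τ Z x v) = 0

/-- The stabilizer algebra of `τ` at `x`: the skew-symmetric endomorphisms `A` of the tangent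
space with `A_* τ = 0`. -/
def stab (g : Metric n M) (τ : TriForm n M) (x : M) :
    Submodule ℝ (Module.End ℝ (TangentSpace (𝓡 n) x)) where
  carrier := {A | (∀ v w, g.inner x (A v) w + g.inner x v (A w) = 0) ∧
    ∀ u v w, τ x (A u) v w + τ x u (A v) w + τ x u v (A w) = 0}
  add_mem' := by
    rintro A B ⟨hA, hA'⟩ ⟨hB, hB'⟩
    refine ⟨fun v w => ?_, fun u v w => ?_⟩
    · simp only [LinearMap.add_apply, map_add, add_apply]
      linarith [hA v w, hB v w]
    · simp only [LinearMap.add_apply, map_add]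
      linarith [hA' u v w, hB' u v w]
  zero_mem' := by simp
  smul_mem' := by
    rintro c A ⟨hA, hA'⟩
    refine ⟨fun v w => ?_, fun u v w => ?_⟩
    · simp only [LinearMap.smul_apply, map_smul, smul_apply, smul_eq_mul]
      linear_combination c * hA v w
    · simp only [LinearMap.smul_apply, map_smul, smul_eq_mul]
      linear_combination c * hA' u v w

/-! ## Decompositions -/

/-- `T` is a smooth distribution: it is locally spanned by a smooth frame. -/
def IsSmoothDistribution (T : Distribution n M) : Prop :=
  ∀ p : M, ∃ U : Set M, IsOpen U ∧ p ∈ U ∧ ∃ (k : ℕ) (e : Fin k → VField n M),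
    (∀ i, SmoothOn (e i) U) ∧ ∀ x ∈ U, LinearIndependent ℝ (fun i => e i x) ∧
      T x = Submodule.span ℝ (Set.range fun i => e i x)

/-- `T` is `∇^τ`-parallel. -/
def IsParallelDistribution (g : Metric n M) (τ : TriForm n M) (T : Distribution n M) : Prop :=
  ∀ (U : Set M) (Y : VField n M), IsOpen U → SmoothOn Y U → (∀ x ∈ U, Y x ∈ T x) →
    ∀ x ∈ U, ∀ v : TangentSpace (𝓡 n) x, connection g τ Y x v ∈ T x

/-- `TM = T₁ ⊕ T₂` is a decomposition of `(M, g, τ)`: `T₁`, `T₂` are nontrivial, orthogonal,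
`∇^τ`-parallel distributions and `τ = τ₁ + τ₂` with `τᵢ ∈ Λ³Tᵢ`, that is, all mixed components
of `τ` vanish. -/
structure IsDecomposition (g : Metric n M) (τ : TriForm n M) (T₁ T₂ : Distribution n M) :
    Prop where
  smooth₁ : IsSmoothDistribution T₁
  smooth₂ : IsSmoothDistribution T₂
  nontrivial₁ : ∀ x, T₁ x ≠ ⊥
  nontrivial₂ : ∀ x, T₂ x ≠ ⊥
  sup_eq : ∀ x, T₁ x ⊔ T₂ x = ⊤
  orthogonal : ∀ x, ∀ v ∈ T₁ x, ∀ w ∈ T₂ x, g.inner x v w = 0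
  parallel₁ : IsParallelDistribution g τ T₁
  parallel₂ : IsParallelDistribution g τ T₂
  torsion : ∀ x, ∀ v ∈ T₁ x, ∀ w ∈ T₂ x, ∀ z, τ x v w z = 0

/-- `(M, g, τ)` locally splits off a one-dimensional factor: it is decomposable with a
one-dimensional summand. -/
def HasLocalOneDimFactor (g : Metric n M) (τ : TriForm n M) : Prop :=
  ∃ T₁ T₂ : Distribution n M, IsDecomposition g τ T₁ T₂ ∧
    ∀ x, Module.finrank ℝ (T₁ x) = 1

/-! ## Sasaki structures -/

/-- `(g, ξ, Φ)` is a Sasaki structure on the open set `U`. -/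
structure IsSasakiOn (g : Metric n M) (U : Set M) (ξ : VField n M) (Φ : EndField n M) :
    Prop where
  smooth_xi : SmoothOn ξ U
  smooth_phi : ∀ (W : Set M) (Y : VField n M), IsOpen W → W ⊆ U → SmoothOn Y W →
    SmoothOn (fun x => Φ x (Y x)) W
  unit : ∀ x ∈ U, g.inner x (ξ x) (ξ x) = 1
  /-- `ξ` is a Killing field: `(L_ξ g)(X, Y) = 0`. -/
  killing : ∀ (W : Set M) (X Y : VField n M), IsOpen W → W ⊆ U → SmoothOn X W → SmoothOn Y W →
    ∀ x ∈ W, dirDeriv (fun y => g.inner y (X y) (Y y)) x (ξ x)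
      - g.inner x (VectorField.mlieBracket (𝓡 n) ξ X x) (Y x)
      - g.inner x (X x) (VectorField.mlieBracket (𝓡 n) ξ Y x) = 0
  /-- `Φ` is skew-symmetric. -/
  skew : ∀ x ∈ U, ∀ v w, g.inner x (Φ x v) w = - g.inner x v (Φ x w)
  /-- `dξ = 2Φ`, where `ξ` is regarded as a `1`-form and `Φ` as the `2`-form `g(Φ X, Y)`. -/
  d_xi : ∀ (W : Set M) (X Y : VField n M), IsOpen W → W ⊆ U → SmoothOn X W → SmoothOn Y W →
    ∀ x ∈ W, dirDeriv (fun y => g.inner y (ξ y) (Y y)) x (X x)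
      - dirDeriv (fun y => g.inner y (ξ y) (X y)) x (Y x)
      - g.inner x (ξ x) (VectorField.mlieBracket (𝓡 n) X Y x)
      = 2 * g.inner x (Φ x (X x)) (Y x)
  /-- `Φ² = - Id + ξ ⊗ ξ`. -/
  phi_sq : ∀ x ∈ U, ∀ v, Φ x (Φ x v) = - v + g.inner x (ξ x) v • ξ x
  /-- `∇^g_v Φ = - v ∧ ξ`, where `(v ∧ ξ) Y = g(v, Y) ξ - g(ξ, Y) v`. -/
  nabla_phi : ∀ (W : Set M) (Y : VField n M), IsOpen W → W ⊆ U → SmoothOn Y W →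
    ∀ x ∈ W, ∀ v : TangentSpace (𝓡 n) x,
      leviCivita g (fun y => Φ y (Y y)) x v - Φ x (leviCivita g Y x v)
        = - (g.inner x v (Y x) • ξ x - g.inner x (ξ x) (Y x) • v)

/-- The value of the `3`-form `ξ ∧ Φ` at `x`, where `ξ` and `Φ` are regarded as a `1`-form and a
`2`-form by means of `g`. -/
def xiWedgePhi (g : Metric n M) (ξ : VField n M) (Φ : EndField n M) (x : M)
    (u v w : TangentSpace (𝓡 n) x) : ℝ :=
  g.inner x (ξ x) u * g.inner x (Φ x v) w + g.inner x (ξ x) v * g.inner x (Φ x w) u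
    + g.inner x (ξ x) w * g.inner x (Φ x u) v

/-- On the open set `U`, the geometry `(g, τ)` is Sasakian: there is a Sasaki structure
`(g, ξ, Φ)` on `U` with `τ = ξ ∧ Φ`. -/
def IsSasakianOn (g : Metric n M) (τ : TriForm n M) (U : Set M) : Prop :=
  ∃ (ξ : VField n M) (Φ : EndField n M), IsSasakiOn g U ξ Φ ∧
    ∀ x ∈ U, ∀ u v w : TangentSpace (𝓡 n) x, τ x u v w = xiWedgePhi g ξ Φ x u v w

/-- The vertical line bundle of the canonical `𝔰𝔱𝔞𝔟(τ)`-splitting is globally trivial: it is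
spanned by a continuous, nowhere vanishing vector field. -/
def VerticalIsTrivial (g : Metric n M) (τ : TriForm n M) : Prop :=
  ∃ Z : VField n M, Continuous (fun x => (⟨x, Z x⟩ : TangentBundle (𝓡 n) M)) ∧
    ∀ x, Z x ≠ 0 ∧ ∃ Hor : Submodule ℝ (TangentSpace (𝓡 n) x),
      IsCanonicalSplitting (fun v w => g.inner x v w) (stab g τ x) Hor
        (Submodule.span ℝ {Z x})

end SkewTorsion

end

/-!
Since `∇^τ` is metric with parallel torsion, its curvature operators stabilize `τ`, and the Bianchi
identity, whose right-hand side is quadratic in `τ`, makes the curvature pair symmetric. As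
`𝔰𝔱𝔞𝔟(τ)` kills the unit vertical vector `ξ`, this gives `R(ξ, ·) = 0`, and the Bianchi identity
then says that `τ_ξ` itself lies in `𝔰𝔱𝔞𝔟(τ)`. By Schur's lemma either `τ_ξ = 0`, or `τ_ξ` is a
multiple of a complex structure on `ξ^⊥`; in the latter case invariance of `τ` under `τ_ξ` kills the
horizontal part of `τ`, so that `τ = ξ ∧ τ_ξ`.

The Casimir endomorphism `S` of `τ`, with `g(S u, v) = -tr (τ_u τ_v)`, is parallel and has the
vertical line as an eigenspace. The traces of its powers are locally constant, hence constant, and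
they decide which of the two cases occurs. If `τ_ξ = 0`, the eigenspaces of `S` split off a
one-dimensional factor. Otherwise a local smooth unit eigenfield `ξ` of `S` is parallel, so it is
Killing with `dξ = 2 τ_ξ`, and `(ξ, τ_ξ)` becomes a Sasaki structure once the metric is rescaled so
that `τ_ξ ^ 2 = -1` on `ξ^⊥`.
-/

noncomputable section

namespace SkewTorsion

section Instances

variable {E F G H : Type*} [NormedAddCommGroup E] [NormedSpace ℝ E] [NormedAddCommGroup F]
  [NormedSpace ℝ F] [NormedAddCommGroup G] [NormedSpace ℝ G] [NormedAddCommGroup H]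
  [NormedSpace ℝ H]

-- Without these shortcuts, instance search on nested spaces of continuous linear maps times out.
instance : NormedAddCommGroup (E →L[ℝ] F →L[ℝ] G) := ContinuousLinearMap.toNormedAddCommGroup

instance : NormedSpace ℝ (E →L[ℝ] F →L[ℝ] G) := ContinuousLinearMap.toNormedSpace

instance : NormedAddCommGroup ((E →L[ℝ] F) →L[ℝ] G) := ContinuousLinearMap.toNormedAddCommGroup

instance : NormedSpace ℝ ((E →L[ℝ] F) →L[ℝ] G) := ContinuousLinearMap.toNormedSpace

instance : NormedAddCommGroup (E →L[ℝ] F →L[ℝ] G →L[ℝ] H) :=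
  ContinuousLinearMap.toNormedAddCommGroup

instance : NormedSpace ℝ (E →L[ℝ] F →L[ℝ] G →L[ℝ] H) := ContinuousLinearMap.toNormedSpace

end Instances

/-! ## Connections on open subsets of a vector space -/

section TrivialBundle

variable {E F G H : Type*} [NormedAddCommGroup E] [NormedSpace ℝ E] [NormedAddCommGroup F]
  [NormedSpace ℝ F] [NormedAddCommGroup G] [NormedSpace ℝ G] [NormedAddCommGroup H]
  [NormedSpace ℝ H] {z : E}

lemma fderiv_clm_apply_const {A : E → F →L[ℝ] G} (hA : DifferentiableAt ℝ A z) (a : F) (u : E) :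
    fderiv ℝ (fun y => A y a) z u = fderiv ℝ A z u a := by
  simp [fderiv_clm_apply hA (differentiableAt_const a)]

lemma fderiv_clm_apply₂_const {B : E → F →L[ℝ] G →L[ℝ] H} (hB : DifferentiableAt ℝ B z)
    (a : F) (b : G) (u : E) : fderiv ℝ (fun y => B y a b) z u = fderiv ℝ B z u a b := by
  rw [fderiv_clm_apply_const (hB.clm_apply (differentiableAt_const a)), fderiv_clm_apply_const hB]

lemma fderiv_clm_apply₂ {B : E → F →L[ℝ] G →L[ℝ] H} {a : E → F} {b : E → G}
    (hB : DifferentiableAt ℝ B z) (ha : DifferentiableAt ℝ a z) (hb : DifferentiableAt ℝ b z)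
    (u : E) :
    fderiv ℝ (fun y => B y (a y) (b y)) z u = fderiv ℝ B z u (a z) (b z)
      + B z (fderiv ℝ a z u) (b z) + B z (a z) (fderiv ℝ b z u) := by
  rw [fderiv_clm_apply (hB.clm_apply ha) hb, fderiv_clm_apply hB ha]
  simp only [add_apply, ContinuousLinearMap.comp_apply, ContinuousLinearMap.flip_apply]
  abel

lemma fderiv_pow_of_commutator {𝔸 : Type*} [NormedRing 𝔸] [NormedAlgebra ℝ 𝔸] {S : E → 𝔸}
    {A : 𝔸} {u : E} (hS : DifferentiableAt ℝ S z) (h : fderiv ℝ S z u = S z * A - A * S z)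
    (k : ℕ) : fderiv ℝ (fun y => S y ^ k) z u = S z ^ k * A - A * S z ^ k := by
  induction k with
  | zero => simp
  | succ k ih =>
    simp_rw [pow_succ]
    rw [fderiv_fun_mul' (hS.fun_pow k) hS]
    simp only [add_apply, smul_apply, MulOpposite.smul_eq_mul_unop, MulOpposite.unop_op,
      smul_eq_mul, ih, h, mul_sub, sub_mul, mul_assoc]
    abel

/-- The curvature `dθ + θ ∧ θ` of the connection `d + θ` on the trivial bundle with fibre `F`. -/
def curvature (θ : E → E →L[ℝ] F →L[ℝ] F) (z u v : E) : F →L[ℝ] F :=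
  fderiv ℝ θ z u v - fderiv ℝ θ z v u + θ z u ∘L θ z v - θ z v ∘L θ z u

lemma curvature_apply (θ : E → E →L[ℝ] F →L[ℝ] F) (z u v : E) (a : F) :
    curvature θ z u v a = fderiv ℝ θ z u v a - fderiv ℝ θ z v u a + θ z u (θ z v a)
      - θ z v (θ z u a) := rfl

lemma curvature_swap (θ : E → E →L[ℝ] F →L[ℝ] F) (z u v : E) :
    curvature θ z u v = -curvature θ z v u := by
  simp only [curvature]; abel

lemma curvature_zero (z u v : E) : curvature (0 : E → E →L[ℝ] F →L[ℝ] F) z u v = 0 := by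
  simp [curvature]

/-- The field `B` of bilinear maps between trivial bundles is parallel on `s` with respect to the
connections `d + θ` on its arguments and `d + η` on its values. -/
def IsParallelOn (θ : E → E →L[ℝ] F →L[ℝ] F) (η : E → E →L[ℝ] G →L[ℝ] G)
    (B : E → F →L[ℝ] F →L[ℝ] G) (s : Set E) : Prop :=
  ∀ z ∈ s, ∀ u a b,
    fderiv ℝ B z u a b = B z (θ z u a) b + B z a (θ z u b) - η z u (B z a b)

section RicciIdentity

variable {θ : E → E →L[ℝ] F →L[ℝ] F} {η : E → E →L[ℝ] G →L[ℝ] G} {B : E → F →L[ℝ] F →L[ℝ] G}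
  {s : Set E}

lemma IsParallelOn.fderiv_fderiv (h : IsParallelOn θ η B s) (hs : IsOpen s) (hz : z ∈ s)
    (hB : ContDiffAt ℝ 2 B z) (hθ : DifferentiableAt ℝ θ z) (hη : DifferentiableAt ℝ η z)
    (u v : E) (a b : F) :
    fderiv ℝ (fderiv ℝ B) z u v a b =
      fderiv ℝ B z u (θ z v a) b + B z (fderiv ℝ θ z u v a) b
      + (fderiv ℝ B z u a (θ z v b) + B z a (fderiv ℝ θ z u v b))
      - (fderiv ℝ η z u v (B z a b) + η z v (fderiv ℝ B z u a b)) := by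
  have hB₁ : DifferentiableAt ℝ B z := hB.differentiableAt (by simp)
  have hB₂ : DifferentiableAt ℝ (fderiv ℝ B) z :=
    (hB.fderiv_right (m := 1) (by norm_num)).differentiableAt (by simp)
  have hθa (a : F) : DifferentiableAt ℝ (fun y => θ y v a) z :=
    (hθ.clm_apply (differentiableAt_const v)).clm_apply (differentiableAt_const a)
  have hηv : DifferentiableAt ℝ (fun y => η y v) z := hη.clm_apply (differentiableAt_const v)
  have hBab : DifferentiableAt ℝ (fun y => B y a b) z :=
    (hB₁.clm_apply (differentiableAt_const a)).clm_apply (differentiableAt_const b)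
  have hleft := (hB₁.clm_apply (hθa a)).clm_apply (differentiableAt_const b)
  have hright := (hB₁.clm_apply (differentiableAt_const a)).clm_apply (hθa b)
  have hpar : (fun y => fderiv ℝ B y v a b) =ᶠ[𝓝 z]
      fun y => B y (θ y v a) b + B y a (θ y v b) - η y v (B y a b) := by
    filter_upwards [hs.mem_nhds hz] with y hy using h y hy v a b
  calc fderiv ℝ (fderiv ℝ B) z u v a b
      = fderiv ℝ (fun y => fderiv ℝ B y v a b) z u := by
        rw [fderiv_clm_apply₂_const (hB₂.clm_apply (differentiableAt_const v)),
          fderiv_clm_apply_const hB₂]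
    _ = _ := by
        rw [hpar.fderiv_eq, fderiv_fun_sub (hleft.fun_add hright) (hηv.clm_apply hBab),
          fderiv_fun_add hleft hright, sub_apply, add_apply,
          fderiv_clm_apply₂ hB₁ (hθa a) (differentiableAt_const b),
          fderiv_clm_apply₂ hB₁ (differentiableAt_const a) (hθa b), fderiv_clm_apply hηv hBab,
          fderiv_clm_apply₂_const hθ, fderiv_clm_apply₂_const hθ, add_apply,
          ContinuousLinearMap.comp_apply, ContinuousLinearMap.flip_apply,
          fderiv_clm_apply₂_const hB₁, fderiv_clm_apply_const hη]
        simp only [fderiv_const_apply, zero_apply, map_zero, add_zero]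
        abel

theorem IsParallelOn.curvature_map₂ (h : IsParallelOn θ η B s) (hs : IsOpen s) (hz : z ∈ s)
    (hB : ContDiffAt ℝ 2 B z) (hθ : DifferentiableAt ℝ θ z) (hη : DifferentiableAt ℝ η z)
    (u v : E) (a b : F) :
    curvature η z u v (B z a b) = B z (curvature θ z u v a) b + B z a (curvature θ z u v b) := by
  have hsymm : fderiv ℝ (fderiv ℝ B) z u v = fderiv ℝ (fderiv ℝ B) z v u :=
    hB.isSymmSndFDerivAt (by rw [minSmoothness_of_isRCLikeNormedField]) u v
  have hsymm_ab := congrArg (fun A => A a b) hsymm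
  rw [h.fderiv_fderiv hs hz hB hθ hη, h.fderiv_fderiv hs hz hB hθ hη] at hsymm_ab
  simp only [h z hz, map_sub, map_add] at hsymm_ab
  simp only [curvature_apply, map_sub, map_add, sub_apply, add_apply]
  rw [← sub_eq_zero] at hsymm_ab ⊢
  rw [← neg_eq_zero, ← hsymm_ab]
  abel

end RicciIdentity

end TrivialBundle

section Trace

variable (E : Type*) [NormedAddCommGroup E] [NormedSpace ℝ E] [FiniteDimensional ℝ E]

/-- The trace, as a continuous linear form on the continuous endomorphisms. -/
def traceL : (E →L[ℝ] E) →L[ℝ] ℝ :=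
  LinearMap.toContinuousLinearMap (LinearMap.trace ℝ E ∘ₗ ContinuousLinearMap.coeLM ℝ)

/-- The trace form `tr (A B)` on the continuous endomorphisms. -/
def traceForm : (E →L[ℝ] E) →L[ℝ] (E →L[ℝ] E) →L[ℝ] ℝ :=
  (ContinuousLinearMap.compL ℝ (E →L[ℝ] E) (E →L[ℝ] E) ℝ (traceL E)) ∘L
    ContinuousLinearMap.compL ℝ E E E

variable {E}

lemma traceL_apply (A : E →L[ℝ] E) : traceL E A = LinearMap.trace ℝ E A := rfl

lemma traceL_comp_comm (A B : E →L[ℝ] E) : traceL E (A ∘L B) = traceL E (B ∘L A) :=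
  LinearMap.trace_mul_comm ℝ (A : E →ₗ[ℝ] E) (B : E →ₗ[ℝ] E)

lemma traceForm_apply (A B : E →L[ℝ] E) : traceForm E A B = traceL E (A ∘L B) := rfl

lemma traceForm_commutator (A B C : E →L[ℝ] E) :
    traceForm E (A ∘L C - C ∘L A) B + traceForm E A (B ∘L C - C ∘L B) = 0 := by
  rw [map_sub (traceForm E), sub_apply, map_sub]
  simp only [traceForm_apply, ContinuousLinearMap.comp_assoc]
  rw [traceL_comp_comm C, ContinuousLinearMap.comp_assoc]
  ring

end Trace

/-! ## Metrics and three-forms on an open subset of a vector space -/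

/-- A Riemannian metric and a `3`-form on an open subset of a vector space: a geometry with skew
torsion read in a chart. -/
structure LocalGeometry (E : Type*) [NormedAddCommGroup E] [NormedSpace ℝ E] where
  domain : Set E
  isOpen_domain : IsOpen domain
  metric : E → E →L[ℝ] E →L[ℝ] ℝ
  form : E → E →L[ℝ] E →L[ℝ] E →L[ℝ] ℝ
  contDiffOn_metric : ContDiffOn ℝ ∞ metric domain
  contDiffOn_form : ContDiffOn ℝ ∞ form domain
  metric_symm : ∀ z ∈ domain, ∀ a b, metric z a b = metric z b a
  metric_pos : ∀ z ∈ domain, ∀ a, a ≠ 0 → 0 < metric z a a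
  form_alt_left : ∀ z ∈ domain, ∀ a b, form z a a b = 0
  form_alt_right : ∀ z ∈ domain, ∀ a b, form z a b b = 0

namespace LocalGeometry

variable {E F : Type*} [NormedAddCommGroup E] [NormedSpace ℝ E] [NormedAddCommGroup F]
  [NormedSpace ℝ F] (L : LocalGeometry E) {z : E}

section Domain

variable {f h : E → F}

lemma contDiffAt_of_domain (hf : ContDiffOn ℝ ∞ f L.domain) (hz : z ∈ L.domain) :
    ContDiffAt ℝ ∞ f z :=
  hf.contDiffAt (L.isOpen_domain.mem_nhds hz)

lemma differentiableAt_of_domain (hf : ContDiffOn ℝ ∞ f L.domain) (hz : z ∈ L.domain) :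
    DifferentiableAt ℝ f z :=
  (L.contDiffAt_of_domain hf hz).differentiableAt (by simp)

lemma fderiv_congr_of_domain (hfh : Set.EqOn f h L.domain) (hz : z ∈ L.domain) :
    fderiv ℝ f z = fderiv ℝ h z :=
  (hfh.eventuallyEq_of_mem (L.isOpen_domain.mem_nhds hz)).fderiv_eq

end Domain

lemma form_swap_left (hz : z ∈ L.domain) (a b c : E) : L.form z a b c = -L.form z b a c := by
  have h := L.form_alt_left z hz (a + b) c
  simp only [map_add, add_apply, L.form_alt_left z hz] at h
  linarith

lemma form_swap_right (hz : z ∈ L.domain) (a b c : E) : L.form z a b c = -L.form z a c b := by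
  have h := L.form_alt_right z hz a (b + c)
  simp only [map_add, add_apply, L.form_alt_right z hz] at h
  linarith

lemma metric_ext (hz : z ∈ L.domain) {a b : E} (h : ∀ c, L.metric z a c = L.metric z b c) :
    a = b := by
  by_contra hab
  have hpos := L.metric_pos z hz (a - b) (sub_ne_zero.mpr hab)
  rw [map_sub (L.metric z), sub_apply, h, sub_self] at hpos
  exact lt_irrefl _ hpos

lemma fderiv_metric_symm (hz : z ∈ L.domain) (u a b : E) :
    fderiv ℝ L.metric z u a b = fderiv ℝ L.metric z u b a := by
  have hd := L.differentiableAt_of_domain L.contDiffOn_metric hz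
  rw [← fderiv_clm_apply₂_const hd, ← fderiv_clm_apply₂_const hd,
    L.fderiv_congr_of_domain (fun y hy => L.metric_symm y hy a b) hz]

/-- The vector dual to a linear form. -/
def raise (z : E) : (E →L[ℝ] ℝ) →L[ℝ] E := (L.metric z).inverse

/-- The torsion `τ` as a field of bilinear maps, `g(τ(a, b), c) = τ(a, b, c)`. -/
def tor (z : E) : E →L[ℝ] E →L[ℝ] E :=
  (ContinuousLinearMap.compL ℝ E (E →L[ℝ] ℝ) E (L.raise z)) ∘L L.form z

set_option synthInstance.maxHeartbeats 100000 in
-- The instances on trilinear forms take long to find.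
/-- The Christoffel symbols of the first kind of the Levi-Civita connection. -/
def koszulForm (z : E) : E →L[ℝ] E →L[ℝ] E →L[ℝ] ℝ :=
  (1 / 2 : ℝ) • (fderiv ℝ L.metric z + (fderiv ℝ L.metric z).flip
    - ((ContinuousLinearMap.flipₗᵢ ℝ E E ℝ).toContinuousLinearEquiv :
        (E →L[ℝ] E →L[ℝ] ℝ) →L[ℝ] (E →L[ℝ] E →L[ℝ] ℝ)) ∘L (fderiv ℝ L.metric z).flip)

lemma koszulForm_apply (a b c : E) :
    L.koszulForm z a b c = (1 / 2 : ℝ) * (fderiv ℝ L.metric z a b c + fderiv ℝ L.metric z b a c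
      - fderiv ℝ L.metric z c a b) := rfl

/-- The Christoffel symbols of the connection `∇^g + τ`. -/
def chris (z : E) : E →L[ℝ] E →L[ℝ] E :=
  (ContinuousLinearMap.compL ℝ E (E →L[ℝ] ℝ) E (L.raise z)) ∘L (L.koszulForm z + L.form z)

/-- The `3`-form is parallel with respect to `∇^g + τ`. -/
def IsParallel : Prop := ∀ z ∈ L.domain, ∀ u a b c, fderiv ℝ L.form z u a b c =
  L.form z (L.chris z u a) b c + L.form z a (L.chris z u b) c + L.form z a b (L.chris z u c)

variable [FiniteDimensional ℝ E]

lemma isInvertible_metric (hz : z ∈ L.domain) : (L.metric z).IsInvertible := by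
  have hinj : Function.Injective (L.metric z : E →ₗ[ℝ] (E →L[ℝ] ℝ)) := fun a b hab =>
    L.metric_ext hz fun c => congrArg (fun α : E →L[ℝ] ℝ => α c) hab
  have hfin : Module.finrank ℝ E = Module.finrank ℝ (E →L[ℝ] ℝ) := by
    rw [← Subspace.dual_finrank_eq (K := ℝ) (V := E)]
    exact (LinearMap.toContinuousLinearMap (𝕜 := ℝ) (E := E) (F' := ℝ)).finrank_eq
  exact ⟨(LinearEquiv.ofInjectiveOfFinrankEq _ hinj hfin).toContinuousLinearEquiv, rfl⟩

lemma metric_raise (hz : z ∈ L.domain) (α : E →L[ℝ] ℝ) (c : E) :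
    L.metric z (L.raise z α) c = α c := by
  rw [raise, (L.isInvertible_metric hz).self_apply_inverse]

lemma metric_tor (hz : z ∈ L.domain) (a b c : E) :
    L.metric z (L.tor z a b) c = L.form z a b c :=
  L.metric_raise hz _ c

lemma metric_chris (hz : z ∈ L.domain) (a b c : E) :
    L.metric z (L.chris z a b) c = L.koszulForm z a b c + L.form z a b c :=
  L.metric_raise hz _ c

lemma contDiffOn_raise : ContDiffOn ℝ ∞ L.raise L.domain := by
  intro z hz
  obtain ⟨e, he⟩ := L.isInvertible_metric hz
  have hinv : ContDiffAt ℝ ∞ ContinuousLinearMap.inverse (L.metric z) := by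
    rw [← he]
    exact contDiffAt_map_inverse e
  exact (hinv.comp z (L.contDiffAt_of_domain L.contDiffOn_metric hz)).contDiffWithinAt

lemma contDiffOn_tor : ContDiffOn ℝ ∞ L.tor L.domain := by
  simp_rw [contDiffOn_clm_apply]
  exact fun a b => L.contDiffOn_raise.clm_apply
    ((L.contDiffOn_form.clm_apply contDiffOn_const).clm_apply contDiffOn_const)

lemma contDiffOn_koszulForm : ContDiffOn ℝ ∞ L.koszulForm L.domain := by
  have hfderiv (u v w : E) : ContDiffOn ℝ ∞ (fun z => fderiv ℝ L.metric z u v w) L.domain :=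
    (((L.contDiffOn_metric.fderiv_of_isOpen L.isOpen_domain (by simp)).clm_apply
      contDiffOn_const).clm_apply contDiffOn_const).clm_apply contDiffOn_const
  simp_rw [contDiffOn_clm_apply, koszulForm_apply]
  exact fun a b c => contDiffOn_const.mul
    (((hfderiv a b c).add (hfderiv b a c)).sub (hfderiv c a b))

lemma contDiffOn_chris : ContDiffOn ℝ ∞ L.chris L.domain := by
  simp_rw [contDiffOn_clm_apply]
  exact fun a b => L.contDiffOn_raise.clm_apply
    (((L.contDiffOn_koszulForm.clm_apply contDiffOn_const).clm_apply contDiffOn_const).add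
      ((L.contDiffOn_form.clm_apply contDiffOn_const).clm_apply contDiffOn_const))

lemma differentiableAt_tor (hz : z ∈ L.domain) : DifferentiableAt ℝ L.tor z :=
  L.differentiableAt_of_domain L.contDiffOn_tor hz

lemma differentiableAt_tor_apply (hz : z ∈ L.domain) (a : E) :
    DifferentiableAt ℝ (fun y => L.tor y a) z :=
  (L.differentiableAt_tor hz).clm_apply (differentiableAt_const a)

lemma differentiableAt_chris (hz : z ∈ L.domain) : DifferentiableAt ℝ L.chris z :=
  L.differentiableAt_of_domain L.contDiffOn_chris hz

lemma tor_swap (hz : z ∈ L.domain) (a b : E) : L.tor z a b = -L.tor z b a := by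
  refine L.metric_ext hz fun c => ?_
  rw [map_neg, neg_apply, L.metric_tor hz, L.metric_tor hz, L.form_swap_left hz]

lemma chris_sub_chris (hz : z ∈ L.domain) (a b : E) :
    L.chris z a b - L.chris z b a = (2 : ℝ) • L.tor z a b := by
  refine L.metric_ext hz fun c => ?_
  simp only [map_sub, sub_apply, map_smul, smul_apply,
    L.metric_chris hz, L.metric_tor hz, koszulForm_apply, smul_eq_mul,
    L.form_swap_left hz b a c, L.fderiv_metric_symm hz c b a]
  ring

lemma fderiv_metric (hz : z ∈ L.domain) (u a b : E) :
    fderiv ℝ L.metric z u a b = L.metric z (L.chris z u a) b + L.metric z a (L.chris z u b) := by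
  rw [L.metric_symm z hz a, L.metric_chris hz, L.metric_chris hz, koszulForm_apply,
    koszulForm_apply, L.form_swap_right hz u b a, L.fderiv_metric_symm hz u b a]
  ring

lemma fderiv_metric_apply (hz : z ∈ L.domain) {Y : E → E} (hY : DifferentiableAt ℝ Y z)
    (u c : E) :
    fderiv ℝ (fun y => L.metric y (Y y) c) z u
      = L.metric z (fderiv ℝ Y z u + L.chris z u (Y z)) c + L.metric z (Y z) (L.chris z u c) := by
  rw [fderiv_clm_apply₂ (L.differentiableAt_of_domain L.contDiffOn_metric hz) hY
    (differentiableAt_const c), L.fderiv_metric hz]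
  simp only [fderiv_const_apply, zero_apply, map_zero, map_add, add_apply]
  ring

lemma metric_curvature_skew (hz : z ∈ L.domain) (u v a b : E) :
    L.metric z (curvature L.chris z u v a) b + L.metric z a (curvature L.chris z u v b) = 0 := by
  have hpar : IsParallelOn L.chris 0 L.metric L.domain := fun z hz u a b => by
    simpa using L.fderiv_metric hz u a b
  have h := hpar.curvature_map₂ L.isOpen_domain hz
    ((L.contDiffAt_of_domain L.contDiffOn_metric hz).of_le (WithTop.coe_le_coe.mpr le_top))
    (L.differentiableAt_chris hz) (differentiableAt_const 0) u v a b
  rw [← h, curvature_zero, zero_apply]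

variable {L}

lemma IsParallel.isParallelOn_tor (hL : L.IsParallel) :
    IsParallelOn L.chris L.chris L.tor L.domain := by
  intro z hz u a b
  have htor : DifferentiableAt ℝ (fun y => L.tor y a b) z :=
    (L.differentiableAt_tor_apply hz a).clm_apply (differentiableAt_const b)
  have hform := L.differentiableAt_of_domain L.contDiffOn_form hz
  refine L.metric_ext hz fun c => ?_
  have h : L.metric z (fderiv ℝ L.tor z u a b + L.chris z u (L.tor z a b)) c
      + L.metric z (L.tor z a b) (L.chris z u c) = fderiv ℝ L.form z u a b c := by
    rw [← fderiv_clm_apply₂_const (L.differentiableAt_tor hz), ← L.fderiv_metric_apply hz htor,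
      L.fderiv_congr_of_domain (fun y hy => L.metric_tor hy a b c) hz,
      fderiv_clm_apply₂_const (hform.clm_apply (differentiableAt_const a)),
      fderiv_clm_apply_const hform]
  simp only [hL z hz, map_sub, map_add, sub_apply, add_apply, L.metric_tor hz] at h ⊢
  linarith

lemma IsParallel.curvature_tor (hL : L.IsParallel) (hz : z ∈ L.domain) (u v a b : E) :
    curvature L.chris z u v (L.tor z a b)
      = L.tor z (curvature L.chris z u v a) b + L.tor z a (curvature L.chris z u v b) :=
  hL.isParallelOn_tor.curvature_map₂ L.isOpen_domain hz
    ((L.contDiffAt_of_domain L.contDiffOn_tor hz).of_le (WithTop.coe_le_coe.mpr le_top))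
    (L.differentiableAt_chris hz) (L.differentiableAt_chris hz) u v a b

variable (L) in
lemma fderiv_chris_sub (hz : z ∈ L.domain) (u a b : E) :
    fderiv ℝ L.chris z u a b - fderiv ℝ L.chris z u b a = (2 : ℝ) • fderiv ℝ L.tor z u a b := by
  have hchris (a b : E) : DifferentiableAt ℝ (fun y => L.chris y a b) z :=
    ((L.differentiableAt_chris hz).clm_apply (differentiableAt_const a)).clm_apply
      (differentiableAt_const b)
  have htor : DifferentiableAt ℝ (fun y => L.tor y a b) z :=
    (L.differentiableAt_tor_apply hz a).clm_apply (differentiableAt_const b)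
  rw [← fderiv_clm_apply₂_const (L.differentiableAt_chris hz),
    ← fderiv_clm_apply₂_const (L.differentiableAt_chris hz), ← sub_apply,
    ← fderiv_fun_sub (hchris a b) (hchris b a),
    L.fderiv_congr_of_domain (fun y hy => L.chris_sub_chris hy a b) hz,
    fderiv_fun_const_smul htor, smul_apply, fderiv_clm_apply₂_const (L.differentiableAt_tor hz)]

/-- The constant `4` appears because the torsion of the connection is `2 τ`. -/
theorem IsParallel.bianchi (hL : L.IsParallel) (hz : z ∈ L.domain) (a b c : E) :
    curvature L.chris z a b c + curvature L.chris z b c a + curvature L.chris z c a b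
      = (4 : ℝ) • (L.tor z (L.tor z a b) c + L.tor z (L.tor z b c) a
        + L.tor z (L.tor z c a) b) := by
  have hswap (a b : E) : L.chris z b a = L.chris z a b - (2 : ℝ) • L.tor z a b := by
    rw [← L.chris_sub_chris hz]; abel
  have hfderiv (a b c : E) : fderiv ℝ L.chris z a b c = fderiv ℝ L.chris z a c b
      + (2 : ℝ) • (L.tor z (L.chris z a b) c + L.tor z b (L.chris z a c)
        - L.chris z a (L.tor z b c)) := by
    rw [← hL.isParallelOn_tor z hz, ← L.fderiv_chris_sub hz]; abel
  have hchris_chris (a b c : E) : L.chris z a (L.chris z b c) = L.chris z a (L.chris z c b)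
      + (2 : ℝ) • L.chris z a (L.tor z b c) := by
    rw [hswap b c, map_sub, map_smul]; abel
  have htor_chris (a b c : E) : L.tor z (L.chris z a b) c = L.tor z (L.chris z b a) c
      + (2 : ℝ) • L.tor z (L.tor z a b) c := by
    rw [hswap a b, map_sub, map_smul, sub_apply, smul_apply]; abel
  simp only [curvature_apply]
  rw [hfderiv a b c, hfderiv b c a, hfderiv c a b, hchris_chris a b c, hchris_chris b c a,
    hchris_chris c a b, L.tor_swap hz b (L.chris z a c), L.tor_swap hz c (L.chris z b a),
    L.tor_swap hz a (L.chris z c b), htor_chris a b c, htor_chris b c a, htor_chris c a b]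
  module

/-! ### The Casimir operator of the torsion -/

variable (L)

/-- The symmetric bilinear form `-tr (τ_u τ_v)`. -/
def casimirForm (z : E) : E →L[ℝ] E →L[ℝ] ℝ :=
  -((traceForm E).bilinearComp (L.tor z) (L.tor z))

lemma casimirForm_apply (u v : E) :
    L.casimirForm z u v = -traceForm E (L.tor z u) (L.tor z v) := rfl

/-- The Casimir operator `S` of the torsion, with `g(S u, v) = -tr (τ_u τ_v)`. -/
def casimir (z : E) : E →L[ℝ] E := L.raise z ∘L L.casimirForm z

lemma metric_casimir (hz : z ∈ L.domain) (u v : E) :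
    L.metric z (L.casimir z u) v = L.casimirForm z u v :=
  L.metric_raise hz _ v

lemma contDiffOn_casimir : ContDiffOn ℝ ∞ L.casimir L.domain := by
  refine L.contDiffOn_raise.clm_comp ?_
  simp_rw [contDiffOn_clm_apply]
  exact fun a b => (((contDiffOn_const (c := traceForm E)).clm_apply
    (L.contDiffOn_tor.clm_apply contDiffOn_const)).clm_apply
    (L.contDiffOn_tor.clm_apply contDiffOn_const)).neg

lemma differentiableAt_casimir (hz : z ∈ L.domain) : DifferentiableAt ℝ L.casimir z :=
  L.differentiableAt_of_domain L.contDiffOn_casimir hz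

variable {L}

lemma IsParallel.fderiv_casimirForm (hL : L.IsParallel) (hz : z ∈ L.domain) (w u v : E) :
    fderiv ℝ (fun y => L.casimirForm y u v) z w
      = L.casimirForm z (L.chris z w u) v + L.casimirForm z u (L.chris z w v) := by
  have htor (u : E) : fderiv ℝ L.tor z w u = L.tor z (L.chris z w u)
      + (L.tor z u ∘L L.chris z w - L.chris z w ∘L L.tor z u) := by
    ext b
    rw [hL.isParallelOn_tor z hz, add_sub_assoc]
    rfl
  simp_rw [casimirForm_apply]
  rw [fderiv_fun_neg, neg_apply, fderiv_clm_apply₂ (differentiableAt_const (traceForm E))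
    (L.differentiableAt_tor_apply hz u) (L.differentiableAt_tor_apply hz v),
    fderiv_clm_apply_const (L.differentiableAt_tor hz),
    fderiv_clm_apply_const (L.differentiableAt_tor hz), htor, htor]
  simp only [fderiv_const_apply, zero_apply, map_add, add_apply]
  linear_combination -traceForm_commutator (L.tor z u) (L.tor z v) (L.chris z w)

lemma IsParallel.fderiv_casimir (hL : L.IsParallel) (hz : z ∈ L.domain) (w : E) :
    fderiv ℝ L.casimir z w = L.casimir z * L.chris z w - L.chris z w * L.casimir z := by
  ext u
  have hSu : DifferentiableAt ℝ (fun y => L.casimir y u) z :=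
    (L.differentiableAt_casimir hz).clm_apply (differentiableAt_const u)
  refine L.metric_ext hz fun c => ?_
  have h := L.fderiv_metric_apply hz hSu w c
  rw [L.fderiv_congr_of_domain (fun y hy => L.metric_casimir hy u c) hz,
    hL.fderiv_casimirForm hz, fderiv_clm_apply_const (L.differentiableAt_casimir hz)] at h
  simp only [sub_apply, mul_apply_eq_comp, map_sub, map_add, add_apply,
    ← L.metric_casimir hz] at h ⊢
  linarith

lemma IsParallel.fderiv_trace_casimir_pow (hL : L.IsParallel) (hz : z ∈ L.domain) (k : ℕ) :
    fderiv ℝ (fun y => traceL E (L.casimir y ^ k)) z = 0 := by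
  ext w
  have hS := L.differentiableAt_casimir hz
  have hcomp := ((traceL E).hasFDerivAt.comp z (hS.fun_pow k).hasFDerivAt).fderiv
  rw [Function.comp_def] at hcomp
  rw [hcomp, ContinuousLinearMap.comp_apply,
    fderiv_pow_of_commutator hS (hL.fderiv_casimir hz w), map_sub, zero_apply, sub_eq_zero]
  exact traceL_comp_comm _ _

end LocalGeometry

section LinearAlgebra

/-! ## Euclidean vector spaces with a three-form -/

section Splitting

variable {V : Type*} [AddCommGroup V] [Module ℝ V] {𝔤 : Submodule ℝ (Module.End ℝ V)}

lemma isInvariant_iSup {ι : Sort*} {W : ι → Submodule ℝ V} (h : ∀ i, IsInvariant 𝔤 (W i)) :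
    IsInvariant 𝔤 (⨆ i, W i) := fun A hA =>
  show (⨆ i, W i) ≤ (⨆ i, W i).comap A from
    iSup_le fun i v hv => le_iSup W i (h i A hA v hv)

namespace IsCanonicalSplitting

variable {Hor Ver : Submodule ℝ V}

lemma isInvariant_right {b : V → V → ℝ} (h : IsCanonicalSplitting b 𝔤 Hor Ver) :
    IsInvariant 𝔤 Ver := by
  obtain ⟨k, W, hW, -, -, -, rfl⟩ := h
  exact isInvariant_iSup fun i => isInvariant_iSup fun _ => (hW i).1

lemma sup_eq_top {b : V → V → ℝ} (h : IsCanonicalSplitting b 𝔤 Hor Ver) : Hor ⊔ Ver = ⊤ := by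
  obtain ⟨k, W, -, -, htop, rfl, rfl⟩ := h
  rw [← htop, iSup_split W fun i => MeetsSo b 𝔤 (W i)]

lemma exists_ne_zero {b : V → V → ℝ} (h : IsCanonicalSplitting b 𝔤 Hor Ver) (hHor : Hor ≠ ⊥) :
    ∃ A ∈ 𝔤, A ≠ 0 := by
  obtain ⟨k, W, -, -, -, rfl, -⟩ := h
  contrapose! hHor
  refine eq_bot_iff.mpr (iSup_le fun i => iSup_le ?_)
  rintro ⟨A, hA, hA0, -⟩
  exact absurd (hHor A hA) hA0

lemma orthogonal {b : V →ₗ[ℝ] V →ₗ[ℝ] ℝ}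
    (h : IsCanonicalSplitting (fun v w => b v w) 𝔤 Hor Ver) {v w : V} (hv : v ∈ Hor)
    (hw : w ∈ Ver) : b v w = 0 := by
  obtain ⟨k, W, -, hort, -, rfl, rfl⟩ := h
  have hle : (⨆ i, ⨆ (_ : MeetsSo (fun v w => b v w) 𝔤 (W i)), W i) ≤ LinearMap.ker (b.flip w) :=
    iSup_le fun i => iSup_le fun hi x hx => by
      suffices h : (⨆ j, ⨆ (_ : ¬ MeetsSo (fun v w => b v w) 𝔤 (W j)), W j) ≤
          LinearMap.ker (b x) from h hw
      exact iSup_le fun j => iSup_le fun hj y hy =>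
        hort i j (fun hij => hj (hij ▸ hi)) x hx y hy
  exact hle hv

end IsCanonicalSplitting

end Splitting

/-- A Euclidean vector space `(V, b)` together with a `3`-form, given by the tensor `t` with
`b(t u v, w) = τ(u, v, w)`. -/
structure TorsionSpace (V : Type*) [AddCommGroup V] [Module ℝ V] where
  b : V →ₗ[ℝ] V →ₗ[ℝ] ℝ
  t : V →ₗ[ℝ] V →ₗ[ℝ] V
  symm : ∀ v w, b v w = b w v
  pos : ∀ v, v ≠ 0 → 0 < b v v
  alt : ∀ u, t u u = 0
  skew : ∀ u v w, b (t u v) w = -b v (t u w)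

namespace TorsionSpace

variable {V : Type*} [AddCommGroup V] [Module ℝ V] (P : TorsionSpace V)

lemma nonneg (v : V) : 0 ≤ P.b v v := by
  by_cases h : v = 0
  · simp [h]
  · exact (P.pos v h).le

lemma eq_zero_of_self {v : V} (h : P.b v v = 0) : v = 0 := by
  by_contra hv
  exact (P.pos v hv).ne' h

lemma ext_b {v w : V} (h : ∀ u, P.b v u = P.b w u) : v = w := by
  rw [← sub_eq_zero]
  apply P.eq_zero_of_self
  simp only [map_sub, LinearMap.sub_apply, h, sub_self]

lemma t_swap (u v : V) : P.t u v = -P.t v u := by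
  have h := P.alt (u + v)
  simp only [map_add, LinearMap.add_apply, P.alt, zero_add, add_zero] at h
  exact eq_neg_of_add_eq_zero_left ((add_comm _ _).trans h)

lemma b_t_cyclic (u v w : V) : P.b (P.t u v) w = P.b (P.t v w) u := by
  rw [P.t_swap u v, map_neg, LinearMap.neg_apply, P.skew v u w, neg_neg, P.symm]

lemma b_t_left (u v : V) : P.b u (P.t u v) = 0 := by
  have h := P.skew u u v
  rw [P.alt, map_zero, LinearMap.zero_apply] at h
  linarith

/-- `A` belongs to the stabilizer algebra of the `3`-form: it is skew-symmetric and a derivation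
of `t`, which for skew-symmetric `A` amounts to `A_* τ = 0`. -/
def IsStab (A : Module.End ℝ V) : Prop :=
  (∀ v w, P.b (A v) w = -P.b v (A w)) ∧ ∀ u v, A (P.t u v) = P.t (A u) v + P.t u (A v)

/-- The linear algebra of an almost irreducible action: the nonzero algebra `𝔤` annihilates the
unit vector `ξ` and acts irreducibly on the orthogonal complement of `ξ`, which is nonzero. -/
structure IsVertical (𝔤 : Submodule ℝ (Module.End ℝ V)) (ξ : V) : Prop where
  unit : P.b ξ ξ = 1
  annihilates : ∀ A ∈ 𝔤, A ξ = 0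
  nonzero : ∃ A ∈ 𝔤, A ≠ 0
  ne_bot : ∃ v, v ≠ 0 ∧ P.b ξ v = 0
  irreducible : ∀ W : Submodule ℝ V, (∀ w ∈ W, P.b ξ w = 0) → IsInvariant 𝔤 W →
    W = ⊥ ∨ ∀ w, P.b ξ w = 0 → w ∈ W

variable {P} {𝔤 : Submodule ℝ (Module.End ℝ V)} {ξ : V}

lemma apply_eq_zero_of_isInvariant_span (hskew : ∀ A ∈ 𝔤, ∀ v w, P.b (A v) w = -P.b v (A w))
    (h : IsInvariant 𝔤 (Submodule.span ℝ {ξ})) (A : Module.End ℝ V) (hA : A ∈ 𝔤) : A ξ = 0 := by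
  obtain ⟨c, hc⟩ := Submodule.mem_span_singleton.mp
    (h A hA ξ (Submodule.mem_span_singleton_self ξ))
  have hself := hskew A hA ξ ξ
  rw [← hc, map_smul, map_smul, LinearMap.smul_apply, smul_eq_mul] at hself
  have hmul : c * P.b ξ ξ = 0 := by linarith
  rcases mul_eq_zero.mp hmul with hzero | hzero
  · rw [← hc, hzero, zero_smul]
  · rw [P.eq_zero_of_self hzero, map_zero]

variable (P) in
lemma exists_unit_eq_span_singleton {W : Submodule ℝ V} (hW : Module.finrank ℝ W = 1) :
    ∃ ξ, P.b ξ ξ = 1 ∧ W = Submodule.span ℝ {ξ} := by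
  obtain ⟨⟨ζ, hζW⟩, hne, hspan⟩ := finrank_eq_one_iff'.mp hW
  have hpos := P.pos ζ fun h => hne (Subtype.ext h)
  have hs := Real.sqrt_pos.mpr hpos
  refine ⟨(√(P.b ζ ζ))⁻¹ • ζ, ?_, le_antisymm (fun v hv => ?_) ?_⟩
  · rw [map_smul, map_smul, LinearMap.smul_apply, smul_eq_mul, smul_eq_mul, ← mul_assoc,
      ← mul_inv, Real.mul_self_sqrt hpos.le, inv_mul_cancel₀ hpos.ne']
  · obtain ⟨c, hc⟩ := hspan ⟨v, hv⟩
    rw [Submodule.span_singleton_smul_eq (IsUnit.mk0 _ (inv_ne_zero hs.ne'))]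
    exact Submodule.mem_span_singleton.mpr ⟨c, congrArg Subtype.val hc⟩
  · exact (Submodule.span_singleton_le_iff_mem _ _).mpr (W.smul_mem _ hζW)

lemma mem_horizontal_iff {Hor : Submodule ℝ V} (hξ : P.b ξ ξ = 1)
    (hs : IsCanonicalSplitting (fun v w => P.b v w) 𝔤 Hor (Submodule.span ℝ {ξ})) {v : V} :
    v ∈ Hor ↔ P.b ξ v = 0 := by
  have hort : ∀ w ∈ Hor, P.b ξ w = 0 := fun w hw => by
    rw [P.symm, hs.orthogonal hw (Submodule.mem_span_singleton_self ξ)]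
  refine ⟨hort v, fun hv => ?_⟩
  obtain ⟨w, hw, x, hx, rfl⟩ := Submodule.mem_sup.mp (hs.sup_eq_top ▸ Submodule.mem_top (x := v))
  obtain ⟨c, rfl⟩ := Submodule.mem_span_singleton.mp hx
  rw [map_add, hort w hw, map_smul, hξ, smul_eq_mul, zero_add, mul_one] at hv
  rwa [hv, zero_smul, add_zero]

lemma exists_isVertical (hskew : ∀ A ∈ 𝔤, ∀ v w, P.b (A v) w = -P.b v (A w))
    (h : IsAlmostIrreducible (fun v w => P.b v w) 𝔤) : ∃ ξ, P.IsVertical 𝔤 ξ := by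
  obtain ⟨Hor, Ver, hs, hdim, -, hne, hirr⟩ := h
  obtain ⟨ξ, hξ, rfl⟩ := P.exists_unit_eq_span_singleton hdim
  obtain ⟨v, hv, hv0⟩ := Submodule.exists_mem_ne_zero_of_ne_bot hne
  refine ⟨ξ, hξ, apply_eq_zero_of_isInvariant_span hskew hs.isInvariant_right,
    hs.exists_ne_zero hne, ⟨v, hv0, (mem_horizontal_iff hξ hs).mp hv⟩, fun W hW hinv => ?_⟩
  refine (hirr W (fun w hw => (mem_horizontal_iff hξ hs).mpr (hW w hw)) hinv).imp_right ?_
  rintro rfl w hw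
  exact (mem_horizontal_iff hξ hs).mpr hw

lemma b_sub_smul (hξ : P.b ξ ξ = 1) (v : V) : P.b ξ (v - P.b ξ v • ξ) = 0 := by
  rw [map_sub, map_smul, hξ, smul_eq_mul, mul_one, sub_self]

namespace IsVertical

lemma ne_zero (h : P.IsVertical 𝔤 ξ) : ξ ≠ 0 := by
  rintro rfl
  simpa using h.unit

lemma eq_smul_of_annihilated (h : P.IsVertical 𝔤 ξ) {v : V} (hv : ∀ A ∈ 𝔤, A v = 0) :
    v = P.b ξ v • ξ := by
  let W : Submodule ℝ V := LinearMap.ker (P.b ξ) ⊓ ⨅ A ∈ 𝔤, LinearMap.ker A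
  have hWmem (w : V) : w ∈ W ↔ P.b ξ w = 0 ∧ ∀ A ∈ 𝔤, A w = 0 := by
    simp [W, Submodule.mem_iInf]
  have hsub {A : Module.End ℝ V} (hA : A ∈ 𝔤) (w : V) : A (w - P.b ξ w • ξ) = A w := by
    rw [map_sub, map_smul, h.annihilates A hA, smul_zero, sub_zero]
  rcases h.irreducible W (fun w hw => ((hWmem w).mp hw).1)
    (fun A hA w hw => by rw [((hWmem w).mp hw).2 A hA]; exact W.zero_mem) with hbot | htop
  · have hmem : v - P.b ξ v • ξ ∈ W :=
      (hWmem _).mpr ⟨b_sub_smul h.unit v, fun A hA => by rw [hsub hA, hv A hA]⟩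
    rwa [hbot, Submodule.mem_bot, sub_eq_zero] at hmem
  · obtain ⟨A, hA, hA0⟩ := h.nonzero
    refine absurd (LinearMap.ext fun w => ?_) hA0
    rw [← hsub hA, ((hWmem _).mp (htop _ (b_sub_smul h.unit w))).2 A hA, LinearMap.zero_apply]

end IsVertical

/-! ### The curvature condition -/

lemma curvature_pair_symm {R : V → V → Module.End ℝ V} (hR : ∀ u v, R u v = -R v u)
    (hst : ∀ u v, P.IsStab (R u v))
    (hB : ∀ u v w, R u v w + R v w u + R w u v
      = (4 : ℝ) • (P.t (P.t u v) w + P.t (P.t v w) u + P.t (P.t w u) v)) (a b c d : V) :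
    P.b (R a b c) d = P.b (R c d a) b := by
  have curv_swap (a b c d : V) : P.b (R a b c) d = -P.b (R b a c) d := by
    rw [hR a b, LinearMap.neg_apply, map_neg, LinearMap.neg_apply]
  have curv_skew (a b c d : V) : P.b (R a b c) d = -P.b (R a b d) c := by
    rw [(hst a b).1, P.symm]
  have b_t_t (a b c d : V) : P.b (P.t (P.t a b) c) d = P.b (P.t a b) (P.t c d) := by
    rw [P.b_t_cyclic, P.symm]
  have bianchi (a b c d : V) : P.b (R a b c) d + P.b (R b c a) d + P.b (R c a b) d
      = 4 * (P.b (P.t a b) (P.t c d) + P.b (P.t b c) (P.t a d) + P.b (P.t c a) (P.t b d)) := by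
    have h := congrArg (fun x => P.b x d) (hB a b c)
    simpa only [map_add, map_smul, LinearMap.add_apply, LinearMap.smul_apply, smul_eq_mul,
      b_t_t] using h
  have tt_symm (a b c d : V) : P.b (P.t a b) (P.t c d) = P.b (P.t c d) (P.t a b) := P.symm _ _
  have tt_left (a b c d : V) : P.b (P.t a b) (P.t c d) = -P.b (P.t b a) (P.t c d) := by
    rw [P.t_swap a b, map_neg, LinearMap.neg_apply]
  have tt_right (a b c d : V) : P.b (P.t a b) (P.t c d) = -P.b (P.t a b) (P.t d c) := by
    rw [P.t_swap c d, map_neg]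
  -- The octahedron argument: in the sum of the four Bianchi identities the torsion terms cancel.
  linarith [bianchi a b c d, bianchi b c d a, bianchi c d a b, bianchi d a b c,
    curv_skew b c d a, curv_skew c d b a, curv_swap d b c a, curv_skew b d c a, curv_swap d a c b,
    curv_skew a d c b, curv_swap a c d b, curv_skew c a d b, curv_swap d a b c, curv_skew a b d c,
    tt_right b c d a, tt_symm c d b a, tt_left b a c d, tt_left d b c a, tt_symm b d c a,
    tt_symm c d a b, tt_left d a c b, tt_right a d c b, tt_symm a d b c, tt_left a c d b,
    tt_right c a d b, tt_left d a b c, tt_right a b d c, tt_right b d a c]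

lemma isStab_t_of_curvature {R : V → V → Module.End ℝ V} (hR : ∀ u v, R u v = -R v u)
    (hst : ∀ u v, P.IsStab (R u v))
    (hB : ∀ u v w, R u v w + R v w u + R w u v
      = (4 : ℝ) • (P.t (P.t u v) w + P.t (P.t v w) u + P.t (P.t w u) v))
    (hξ : ∀ u v, R u v ξ = 0) : P.IsStab (P.t ξ) := by
  refine ⟨P.skew ξ, fun u v => ?_⟩
  have hRξ (u v : V) : R ξ u v = 0 := P.ext_b fun w => by
    rw [curvature_pair_symm hR hst hB, hξ, map_zero, LinearMap.zero_apply, LinearMap.zero_apply]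
  have h := hB ξ u v
  rw [hRξ, hξ, hR v ξ, LinearMap.neg_apply, hRξ, neg_zero, add_zero, add_zero, eq_comm,
    smul_eq_zero_iff_right (by norm_num), P.t_swap (P.t u v) ξ, P.t_swap v ξ, map_neg,
    LinearMap.neg_apply, P.t_swap (P.t ξ v) u, neg_neg] at h
  rw [← sub_eq_zero, ← neg_eq_zero, ← h]
  abel

/-! ### Contact torsion -/

variable (P) in
/-- The skew-symmetric endomorphism `ξ ∧ h`. -/
def wedge (ξ h : V) : Module.End ℝ V := (P.b ξ).smulRight h - (P.b h).smulRight ξ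

lemma wedge_apply (ξ h v : V) : P.wedge ξ h v = P.b ξ v • h - P.b h v • ξ := rfl

lemma wedge_skew (ξ h v w : V) : P.b (P.wedge ξ h v) w = -P.b v (P.wedge ξ h w) := by
  rw [P.symm v]
  simp only [wedge_apply, map_sub, map_smul, LinearMap.sub_apply, LinearMap.smul_apply,
    smul_eq_mul]
  ring

lemma IsVertical.wedge_notMem (h : P.IsVertical 𝔤 ξ) {v : V} (hv : v ≠ 0) (hξv : P.b ξ v = 0) :
    P.wedge ξ v ∉ 𝔤 := fun hmem => by
  have hzero := h.annihilates _ hmem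
  rw [wedge_apply, h.unit, P.symm, hξv, one_smul, zero_smul, sub_zero] at hzero
  exact hv hzero

/-- The torsion is `ξ ∧ J`, where `J = t ξ` is `√μ` times a complex structure on the complement
of `ξ`. -/
structure IsContact (P : TorsionSpace V) (ξ : V) (μ : ℝ) : Prop where
  unit : P.b ξ ξ = 1
  pos : 0 < μ
  sq : ∀ v, P.t ξ (P.t ξ v) = -μ • v + (μ * P.b ξ v) • ξ
  t_eq : ∀ u v, P.t u v = P.b ξ u • P.t ξ v - P.b ξ v • P.t ξ u + P.b (P.t ξ u) v • ξ

/-- As `J = t ξ` is a derivation of the `3`-form `τ` with `J² = -μ`, expanding `J_* τ = 0` at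
`(u, v, w)` with one or two entries replaced by their images gives `τ(Ju, Jv, Jw) = 0`. -/
lemma b_t_eq_zero_of_horizontal {μ : ℝ} (hμ : μ ≠ 0) (hJ : P.IsStab (P.t ξ))
    (hsq : ∀ v, P.b ξ v = 0 → P.t ξ (P.t ξ v) = -μ • v) {u v w : V} (hu : P.b ξ u = 0)
    (hv : P.b ξ v = 0) (hw : P.b ξ w = 0) : P.b (P.t u v) w = 0 := by
  have deriv (u v w : V) : P.b (P.t (P.t ξ u) v) w + P.b (P.t u (P.t ξ v)) w
      + P.b (P.t u v) (P.t ξ w) = 0 := by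
    have h := congrArg (fun x => P.b x w) (hJ.2 u v)
    simp only [map_add, LinearMap.add_apply, P.skew ξ (P.t u v) w] at h
    linarith
  have image {u v w : V} (hu : P.b ξ u = 0) (hv : P.b ξ v = 0) (hw : P.b ξ w = 0) :
      P.b (P.t (P.t ξ u) (P.t ξ v)) (P.t ξ w) = 0 := by
    have h₁ := deriv (P.t ξ u) (P.t ξ v) w
    have h₂ := deriv (P.t ξ u) v (P.t ξ w)
    have h₃ := deriv u (P.t ξ v) (P.t ξ w)
    simp only [hsq u hu, hsq v hv, hsq w hw, map_smul, LinearMap.smul_apply, smul_eq_mul]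
      at h₁ h₂ h₃
    linear_combination (h₁ + h₂ + h₃ + 2 * μ * deriv u v w) / 3
  have h := image (P.b_t_left ξ u) (P.b_t_left ξ v) (P.b_t_left ξ w)
  simp only [hsq u hu, hsq v hv, hsq w hw, map_smul, LinearMap.smul_apply, smul_eq_mul] at h
  simpa [hμ] using h

lemma t_eq_of_horizontal_eq_zero (hξ : P.b ξ ξ = 1)
    (h : ∀ u v w, P.b ξ u = 0 → P.b ξ v = 0 → P.b ξ w = 0 → P.b (P.t u v) w = 0) (u v : V) :
    P.t u v = P.b ξ u • P.t ξ v - P.b ξ v • P.t ξ u + P.b (P.t ξ u) v • ξ := by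
  refine P.ext_b fun w => ?_
  have hsub := h _ _ _ (b_sub_smul hξ u) (b_sub_smul hξ v) (b_sub_smul hξ w)
  have hξξ (v : V) : P.b (P.t ξ v) ξ = 0 := by rw [P.symm, P.b_t_left]
  simp only [map_sub, map_smul, LinearMap.sub_apply, LinearMap.smul_apply, smul_eq_mul, P.alt,
    map_zero, LinearMap.zero_apply, (P.b_t_cyclic ξ u v).symm, hξξ, P.t_swap u ξ, map_neg,
    LinearMap.neg_apply] at hsub
  simp only [map_sub, map_add, map_smul, LinearMap.sub_apply, LinearMap.add_apply,
    LinearMap.smul_apply, smul_eq_mul]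
  linear_combination hsub

variable (P) in
lemma eq_sum_of_isOrthoᵢ {ι : Type*} [Fintype ι] [Nonempty ι] {v : ι → V} (hv : P.b.IsOrthoᵢ v)
    (hne : ∀ i, v i ≠ 0) (hcard : Fintype.card ι = Module.finrank ℝ V) (x : V) :
    x = ∑ i, (P.b (v i) x / P.b (v i) (v i)) • v i := by
  classical
  have hpos (i : ι) : P.b (v i) (v i) ≠ 0 := (P.pos _ (hne i)).ne'
  have hli : LinearIndependent ℝ v := LinearMap.linearIndependent_of_isOrthoᵢ hv hpos
  let e := basisOfLinearIndependentOfCardEqFinrank hli hcard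
  have hsum : ∑ i, e.repr x i • v i = x := by
    simpa [e] using e.sum_repr x
  have hcoeff (i : ι) : P.b (v i) x = e.repr x i * P.b (v i) (v i) := by
    conv_lhs => rw [← hsum]
    rw [map_sum, Finset.sum_eq_single i (fun j _ hj => ?_) (by simp), map_smul, smul_eq_mul]
    rw [map_smul, hv hj.symm, smul_zero]
  conv_lhs => rw [← hsum]
  exact Finset.sum_congr rfl fun i _ => by rw [hcoeff, mul_div_cancel_right₀ _ (hpos i)]

namespace IsContact

variable {μ : ℝ} (hc : P.IsContact ξ μ) {h : V}
include hc

lemma b_t_t_self (hξh : P.b ξ h = 0) : P.b (P.t ξ h) (P.t ξ h) = μ * P.b h h := by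
  rw [P.skew, hc.sq, hξh]
  simp

lemma area_form_eq (hdim : Module.finrank ℝ V = 3) (hh : h ≠ 0) (hξh : P.b ξ h = 0) (v w : V) :
    P.b (P.t ξ v) w * P.b h h = P.b h v * P.b (P.t ξ h) w - P.b (P.t ξ h) v * P.b h w := by
  have hhk : P.b h (P.t ξ h) = 0 := by
    have hskew := P.skew ξ h h
    rw [P.symm] at hskew
    linarith
  have hpos := P.pos h hh
  have hkk := hc.b_t_t_self hξh
  have hkpos : 0 < P.b (P.t ξ h) (P.t ξ h) := hkk ▸ mul_pos hc.pos hpos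
  have hv := P.eq_sum_of_isOrthoᵢ (v := ![ξ, h, P.t ξ h]) ?_ ?_ (by simp [hdim]) v
  · have htk : P.t ξ (P.t ξ h) = -μ • h := by
      rw [hc.sq, hξh, mul_zero, zero_smul, add_zero]
    have htv := congrArg (P.t ξ) hv
    simp only [Fin.sum_univ_three, Matrix.cons_val, map_add, map_smul, P.alt, htk, smul_zero,
      zero_add, hkk] at htv
    rw [htv]
    simp only [map_add, map_smul, LinearMap.add_apply, LinearMap.smul_apply, smul_eq_mul]
    have := hc.pos.ne'
    field_simp
    ring
  · intro i j hij
    fin_cases i <;> fin_cases j <;>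
      simp_all [Function.onFun, P.b_t_left, P.symm h ξ, P.symm (P.t ξ h)]
  · intro i
    fin_cases i
    · exact fun h0 => by simpa [show ξ = 0 from h0] using hc.unit
    · exact hh
    · exact fun h0 => by simp [show P.t ξ h = 0 from h0] at hkpos

lemma isStab_wedge (hdim : Module.finrank ℝ V = 3) (hh : h ≠ 0) (hξh : P.b ξ h = 0) :
    P.IsStab (P.wedge ξ h) := by
  refine ⟨P.wedge_skew ξ h, fun u v => P.ext_b fun w => ?_⟩
  have hJh (v : V) : P.b (P.t ξ v) h = -P.b (P.t ξ h) v := by rw [P.skew, P.symm]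
  have hJξ (v : V) : P.b (P.t ξ v) ξ = 0 := by rw [P.symm, P.b_t_left]
  have area := hc.area_form_eq hdim hh hξh
  have cyclic : P.b h h * (P.b h u * P.b (P.t ξ v) w - P.b h v * P.b (P.t ξ u) w
      + P.b h w * P.b (P.t ξ u) v) = 0 := by
    linear_combination P.b h u * area v w - P.b h v * area u w + P.b h w * area u v
  rw [P.wedge_skew ξ h _ w, hc.t_eq u v, hc.t_eq (P.wedge ξ h u) v, hc.t_eq u (P.wedge ξ h v)]
  simp only [wedge_apply, map_add, map_sub, map_smul, LinearMap.add_apply, LinearMap.sub_apply,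
    LinearMap.smul_apply, smul_eq_mul, P.alt, smul_zero, sub_zero, hξh, hc.unit, hJh, hJξ]
  linear_combination (mul_eq_zero.mp cyclic).resolve_left (P.pos h hh).ne'

end IsContact

/-! ### The Casimir operator -/

variable (P) in
/-- `S` is the Casimir operator of the torsion, `b(S u, v) = -tr(t_u t_v)`. Its eigenvalues tell
the algebraic types of torsion apart. -/
def IsCasimir (S : Module.End ℝ V) : Prop :=
  ∀ u v, P.b (S u) v = -LinearMap.trace ℝ V (P.t u ∘ₗ P.t v)

variable {S : Module.End ℝ V}

lemma IsCasimir.symm (hS : P.IsCasimir S) (u v : V) : P.b (S u) v = P.b u (S v) := by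
  rw [P.symm u, hS, hS]
  exact congrArg Neg.neg (LinearMap.trace_mul_comm ℝ (P.t u) (P.t v))

lemma IsCasimir.commute (hS : P.IsCasimir S) {A : Module.End ℝ V} (hA : P.IsStab A) (u : V) :
    A (S u) = S (A u) := by
  refine P.ext_b fun v => ?_
  have hcomm (u : V) : P.t (A u) = A * P.t u - P.t u * A := by
    ext v
    rw [LinearMap.sub_apply, Module.End.mul_apply, Module.End.mul_apply, hA.2 u v]; abel
  rw [hA.1, hS, hS]
  change - -LinearMap.trace ℝ V (P.t u * P.t (A v)) = -LinearMap.trace ℝ V (P.t (A u) * P.t v)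
  rw [hcomm, hcomm, mul_sub, sub_mul, map_sub, map_sub, mul_assoc A, ← mul_assoc, ← mul_assoc,
    LinearMap.trace_mul_comm ℝ (P.t u * P.t v) A, ← mul_assoc]
  ring

variable [FiniteDimensional ℝ V]

variable (P) in
/-- The form `b` as an inner product, which makes Mathlib's theory of orthonormal bases and
symmetric operators available. -/
@[reducible]
def innerCore : InnerProductSpace.Core ℝ V where
  inner v w := P.b v w
  conj_inner_symm v w := by simp [P.symm]
  re_inner_nonneg v := by simpa using P.nonneg v
  add_left u v w := by simp
  smul_left v w r := by simp
  definite v hv := P.eq_zero_of_self hv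

variable (P) in
lemma exists_basis_trace_eq : ∃ e : Module.Basis (Fin (Module.finrank ℝ V)) ℝ V,
    ∀ A : Module.End ℝ V, LinearMap.trace ℝ V A = ∑ i, P.b (e i) (A (e i)) := by
  let : NormedAddCommGroup V := P.innerCore.toNormedAddCommGroup
  let : InnerProductSpace ℝ V := InnerProductSpace.ofCore P.innerCore.toCore
  let e := stdOrthonormalBasis ℝ V
  refine ⟨e.toBasis, fun A => ?_⟩
  rw [LinearMap.trace_eq_sum_inner A e]
  simp only [OrthonormalBasis.coe_toBasis]
  rfl

variable (P) in
lemma exists_eigenvector {Q : Module.End ℝ V} (hQ : ∀ v w, P.b (Q v) w = P.b v (Q w))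
    {W : Submodule ℝ V} (hW : W ≠ ⊥) (hinv : ∀ w ∈ W, Q w ∈ W) :
    ∃ (μ : ℝ) (v : V), v ∈ W ∧ v ≠ 0 ∧ Q v = μ • v := by
  let : NormedAddCommGroup V := P.innerCore.toNormedAddCommGroup
  let : InnerProductSpace ℝ V := InnerProductSpace.ofCore P.innerCore.toCore
  have hsymm : (Q.restrict hinv).IsSymmetric := fun v w => hQ v w
  have : Nontrivial W := Submodule.nontrivial_iff_ne_bot.mpr hW
  obtain ⟨v, hv⟩ := hsymm.hasEigenvalue_iSup_of_finiteDimensional.exists_hasEigenvector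
  exact ⟨_, v, v.2, fun h => hv.2 (Subtype.ext h), congrArg Subtype.val hv.apply_eq_smul⟩

/-- Schur's lemma: `Q` has an eigenvector orthogonal to `ξ`, and by irreducibility its eigenspace
there is all of the complement of `ξ`. -/
lemma IsVertical.exists_eq_smul_of_commute (h : P.IsVertical 𝔤 ξ) {Q : Module.End ℝ V}
    (hQ : ∀ v w, P.b (Q v) w = P.b v (Q w)) (hcomm : ∀ A ∈ 𝔤, ∀ v, A (Q v) = Q (A v))
    (hskew : ∀ A ∈ 𝔤, ∀ v w, P.b (A v) w = -P.b v (A w))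
    (hξ : ∃ a : ℝ, Q ξ = a • ξ) : ∃ μ : ℝ, ∀ v, P.b ξ v = 0 → Q v = μ • v := by
  obtain ⟨a, ha⟩ := hξ
  have hne : LinearMap.ker (P.b ξ) ≠ ⊥ := by
    obtain ⟨v, hv, hξv⟩ := h.ne_bot
    exact (Submodule.ne_bot_iff _).mpr ⟨v, hξv, hv⟩
  have hinv : ∀ w ∈ LinearMap.ker (P.b ξ), Q w ∈ LinearMap.ker (P.b ξ) := by
    intro w hw
    rw [LinearMap.mem_ker] at hw ⊢
    rw [← hQ, ha, map_smul, LinearMap.smul_apply, hw, smul_zero]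
  obtain ⟨μ, v, hv, hv0, hμ⟩ := P.exists_eigenvector hQ hne hinv
  let W : Submodule ℝ V := LinearMap.ker (P.b ξ) ⊓ LinearMap.ker (Q - μ • 1)
  have hWmem (w : V) : w ∈ W ↔ P.b ξ w = 0 ∧ Q w = μ • w := by
    simp [W, sub_eq_zero]
  have hWinv : IsInvariant 𝔤 W := by
    intro A hA w hw
    rw [hWmem] at hw ⊢
    refine ⟨?_, by rw [← hcomm A hA, hw.2, map_smul]⟩
    have hξw := hskew A hA ξ w
    rw [h.annihilates A hA, map_zero, LinearMap.zero_apply] at hξw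
    linarith
  rcases h.irreducible W (fun w hw => ((hWmem w).mp hw).1) hWinv with hbot | htop
  · exact absurd ((Submodule.mem_bot ℝ).mp (hbot ▸ (hWmem v).mpr ⟨hv, hμ⟩)) hv0
  · exact ⟨μ, fun w hw => ((hWmem w).mp (htop w hw)).2⟩

lemma trace_comp_self_eq_neg_sum {A : Module.End ℝ V} (hA : ∀ v w, P.b (A v) w = -P.b v (A w)) :
    ∃ e : Module.Basis (Fin (Module.finrank ℝ V)) ℝ V,
      LinearMap.trace ℝ V (A ∘ₗ A) = -∑ i, P.b (A (e i)) (A (e i)) := by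
  obtain ⟨e, he⟩ := P.exists_basis_trace_eq
  refine ⟨e, ?_⟩
  rw [he, ← Finset.sum_neg_distrib]
  exact Finset.sum_congr rfl fun i _ => by rw [hA, neg_neg, LinearMap.comp_apply]

lemma trace_comp_self_nonpos {A : Module.End ℝ V} (hA : ∀ v w, P.b (A v) w = -P.b v (A w)) :
    LinearMap.trace ℝ V (A ∘ₗ A) ≤ 0 := by
  obtain ⟨e, he⟩ := trace_comp_self_eq_neg_sum hA
  rw [he]
  exact neg_nonpos.mpr (Finset.sum_nonneg fun i _ => P.nonneg _)

lemma eq_zero_of_trace_comp_self {A : Module.End ℝ V} (hA : ∀ v w, P.b (A v) w = -P.b v (A w))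
    (h : LinearMap.trace ℝ V (A ∘ₗ A) = 0) : A = 0 := by
  obtain ⟨e, he⟩ := trace_comp_self_eq_neg_sum hA
  rw [he, neg_eq_zero, Finset.sum_eq_zero_iff_of_nonneg fun i _ => P.nonneg _] at h
  exact e.ext fun i => P.eq_zero_of_self (h i (Finset.mem_univ i))

lemma IsVertical.exists_t_sq_eq (h : P.IsVertical 𝔤 ξ) (h𝔤 : ∀ A, A ∈ 𝔤 ↔ P.IsStab A) :
    ∃ μ : ℝ, 0 ≤ μ ∧ ∀ v, P.t ξ (P.t ξ v) = -μ • v + (μ * P.b ξ v) • ξ := by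
  have hcomm {A : Module.End ℝ V} (hA : A ∈ 𝔤) (v : V) : A (P.t ξ v) = P.t ξ (A v) := by
    rw [((h𝔤 A).mp hA).2, h.annihilates A hA, map_zero, LinearMap.zero_apply, zero_add]
  obtain ⟨μ, hμ⟩ := h.exists_eq_smul_of_commute (Q := P.t ξ ∘ₗ P.t ξ)
    (fun v w => by simp only [LinearMap.comp_apply, P.skew ξ, neg_neg])
    (fun A hA v => by simp only [LinearMap.comp_apply, hcomm hA])
    (fun A hA => ((h𝔤 A).mp hA).1) ⟨0, by simp [P.alt]⟩
  simp only [LinearMap.comp_apply] at hμ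
  refine ⟨-μ, ?_, fun v => ?_⟩
  · obtain ⟨v, hv, hξv⟩ := h.ne_bot
    have hskew := P.skew ξ v (P.t ξ v)
    rw [hμ v hξv, map_smul, smul_eq_mul] at hskew
    by_contra! hcon
    linarith [P.nonneg (P.t ξ v), mul_pos (neg_neg_iff_pos.mp hcon) (P.pos v hv)]
  · have hsub := hμ _ (b_sub_smul h.unit v)
    rw [map_sub, map_smul, P.alt, smul_zero, sub_zero] at hsub
    rw [hsub]
    module

lemma IsVertical.t_eq_zero_or_isContact (h : P.IsVertical 𝔤 ξ) (h𝔤 : ∀ A, A ∈ 𝔤 ↔ P.IsStab A)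
    (hJ : P.IsStab (P.t ξ)) : P.t ξ = 0 ∨ ∃ μ, P.IsContact ξ μ := by
  obtain ⟨μ, hμ, hsq⟩ := h.exists_t_sq_eq h𝔤
  rcases hμ.eq_or_lt with rfl | hpos
  · left
    ext v
    apply P.eq_zero_of_self
    rw [P.skew, hsq]
    simp
  · right
    refine ⟨μ, h.unit, hpos, hsq, t_eq_of_horizontal_eq_zero h.unit fun u v w hu hv hw => ?_⟩
    refine b_t_eq_zero_of_horizontal hpos.ne' hJ (fun v hv => ?_) hu hv hw
    rw [hsq, hv, mul_zero, zero_smul, add_zero]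

namespace IsCasimir

variable (hS : P.IsCasimir S)
include hS

lemma eigenvalue_pos {β : ℝ} (hξ : P.t ξ = 0) (hunit : P.b ξ ξ = 1) (ht : P.t ≠ 0)
    (hβ : ∀ v, P.b ξ v = 0 → S v = β • v) : 0 < β := by
  obtain ⟨u, hu⟩ : ∃ u, P.t u ≠ 0 := by
    contrapose! ht
    exact LinearMap.ext ht
  have htu : P.t (u - P.b ξ u • ξ) = P.t u := by rw [map_sub, map_smul, hξ, smul_zero, sub_zero]
  have htrace := hS (u - P.b ξ u • ξ) (u - P.b ξ u • ξ)
  rw [hβ _ (b_sub_smul hunit u), map_smul, LinearMap.smul_apply, smul_eq_mul, htu] at htrace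
  have hneg : LinearMap.trace ℝ V (P.t u ∘ₗ P.t u) < 0 :=
    (trace_comp_self_nonpos (P.skew u)).lt_of_ne fun h => hu (eq_zero_of_trace_comp_self
      (P.skew u) h)
  exact pos_of_mul_pos_left (by linarith) (P.nonneg (u - P.b ξ u • ξ))

lemma b_apply_self_of_isContact {μ : ℝ} (hc : P.IsContact ξ μ) :
    P.b (S ξ) ξ = (Module.finrank ℝ V - 1 : ℝ) * μ := by
  have hsq : P.t ξ ∘ₗ P.t ξ = -μ • LinearMap.id + μ • (P.b ξ).smulRight ξ := by
    ext v
    simp [hc.sq, smul_smul]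
  rw [hS, hsq, map_add, map_smul, map_smul, LinearMap.trace_id, LinearMap.trace_smulRight,
    hc.unit, smul_eq_mul, smul_eq_mul]
  ring

lemma b_apply_self_of_horizontal {μ : ℝ} (hc : P.IsContact ξ μ) {h : V} (hξh : P.b ξ h = 0) :
    P.b (S h) h = 2 * μ * P.b h h := by
  set k := P.t ξ h
  have ht (v : V) : P.t h v = -P.b ξ v • k + P.b k v • ξ := by
    rw [hc.t_eq, hξh, zero_smul, zero_sub, neg_smul]
  have hξk : P.b ξ k = 0 := P.b_t_left ξ h
  have hsq : P.t h ∘ₗ P.t h = -(P.b k).smulRight k - P.b k k • (P.b ξ).smulRight ξ := by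
    ext v
    simp only [LinearMap.comp_apply, ht, map_add, map_smul, LinearMap.sub_apply,
      LinearMap.neg_apply, LinearMap.smulRight_apply, LinearMap.smul_apply, hξk, hc.unit,
      P.symm k ξ, smul_eq_mul]
    module
  rw [hS, hsq, map_sub, map_neg, map_smul, LinearMap.trace_smulRight, LinearMap.trace_smulRight,
    hc.unit, hc.b_t_t_self hξh, smul_eq_mul]
  ring

end IsCasimir

/-- In the contact case `dim V ≠ 3`: there `ξ ∧ h` would stabilize the torsion, although it does
not annihilate `ξ`. -/
theorem IsVertical.casimir_dichotomy (h : P.IsVertical 𝔤 ξ) (h𝔤 : ∀ A, A ∈ 𝔤 ↔ P.IsStab A)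
    (hJ : P.IsStab (P.t ξ)) (hS : P.IsCasimir S) :
    (P.t ξ = 0 ∧ S ξ = 0 ∧ ∃ β : ℝ, 0 < β ∧ ∀ v, P.b ξ v = 0 → S v = β • v) ∨
    ∃ μ, P.IsContact ξ μ ∧ Module.finrank ℝ V ≠ 3 ∧
      S ξ = ((Module.finrank ℝ V - 1 : ℝ) * μ) • ξ ∧ ∀ v, P.b ξ v = 0 → S v = (2 * μ) • v := by
  have hcomm : ∀ A ∈ 𝔤, ∀ v, A (S v) = S (A v) := fun A hA => hS.commute ((h𝔤 A).mp hA)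
  have hSξ : S ξ = P.b ξ (S ξ) • ξ := h.eq_smul_of_annihilated fun A hA => by
    rw [hcomm A hA, h.annihilates A hA, map_zero]
  obtain ⟨β, hβ⟩ := h.exists_eq_smul_of_commute hS.symm hcomm (fun A hA => ((h𝔤 A).mp hA).1)
    ⟨_, hSξ⟩
  obtain ⟨v, hv, hξv⟩ := h.ne_bot
  have hwedge : ¬P.IsStab (P.wedge ξ v) := fun hst => h.wedge_notMem hv hξv ((h𝔤 _).mpr hst)
  rcases h.t_eq_zero_or_isContact h𝔤 hJ with ht | ⟨μ, hc⟩
  · refine .inl ⟨ht, P.ext_b fun w => ?_, β, hS.eigenvalue_pos ht h.unit (fun h0 => ?_) hβ, hβ⟩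
    · rw [hS, ht, LinearMap.zero_comp, map_zero, neg_zero, map_zero, LinearMap.zero_apply]
    · exact hwedge ⟨P.wedge_skew ξ v, fun u w => by simp [h0]⟩
  · have hβμ : β = 2 * μ := by
      have hself := hS.b_apply_self_of_horizontal hc hξv
      rw [hβ v hξv, map_smul, LinearMap.smul_apply, smul_eq_mul] at hself
      exact mul_right_cancel₀ (P.pos v hv).ne' hself
    refine .inr ⟨μ, hc, fun hdim => hwedge (hc.isStab_wedge hdim hv hξv), ?_, hβμ ▸ hβ⟩
    rw [hSξ, P.symm, hS.b_apply_self_of_isContact hc]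

lemma trace_pow_of_eigen {a β : ℝ} (hunit : P.b ξ ξ = 1) (ha : S ξ = a • ξ)
    (hβ : ∀ v, P.b ξ v = 0 → S v = β • v) (k : ℕ) :
    LinearMap.trace ℝ V (S ^ k) = a ^ k + (Module.finrank ℝ V - 1 : ℝ) * β ^ k := by
  have hpow {c : ℝ} {v : V} (hv : S v = c • v) : (S ^ k) v = c ^ k • v := by
    induction k with
    | zero => simp
    | succ k ih => rw [pow_succ', Module.End.mul_apply, ih, map_smul, hv, smul_smul, pow_succ]
  have hSk : S ^ k = β ^ k • LinearMap.id + (a ^ k - β ^ k) • (P.b ξ).smulRight ξ := by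
    ext v
    have hsub := hpow (hβ (v - P.b ξ v • ξ) (b_sub_smul hunit v))
    rw [map_sub, map_smul, hpow ha, sub_eq_iff_eq_add] at hsub
    rw [hsub]
    simp only [LinearMap.add_apply, LinearMap.smul_apply, LinearMap.id_apply,
      LinearMap.smulRight_apply]
    module
  rw [hSk, map_add, map_smul, map_smul, LinearMap.trace_id, LinearMap.trace_smulRight, hunit,
    smul_eq_mul, smul_eq_mul]
  ring

end TorsionSpace

end LinearAlgebra

section Coordinates

/-! ## Coordinates -/

variable {n : ℕ} {M : Type*} [TopologicalSpace M] [ChartedSpace (EuclideanSpace ℝ (Fin n)) M]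

variable (n) in
/-- The model space, in which the charts of `M` take their values. -/
abbrev Coord := EuclideanSpace ℝ (Fin n)

/-- The inverse of the chart at `p`. -/
def chartInv (p : M) : Coord n → M := (extChartAt (𝓡 n) p).symm

variable (n) in
/-- The domain of the chart at `p`, as an open subset of `M`. -/
def chartDomain (p : M) : Set M := (chartAt (Coord n) p).source

variable (n) in
/-- The image of the chart at `p`. -/
def chartRange (p : M) : Set (Coord n) := (extChartAt (𝓡 n) p).target

variable (n) in
lemma isOpen_chartDomain (p : M) : IsOpen (chartDomain n p) := (chartAt (Coord n) p).open_source

variable (n) in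
lemma mem_chartDomain (p : M) : p ∈ chartDomain n p := mem_chart_source _ p

variable (n) in
lemma isOpen_chartRange (p : M) : IsOpen (chartRange n p) := isOpen_extChartAt_target p

variable (n) in
lemma chartDomain_eq (p : M) : chartDomain n p = (extChartAt (𝓡 n) p).source := by
  rw [extChartAt_source]; rfl

lemma chartInv_mem {p : M} {z : Coord n} (hz : z ∈ chartRange n p) :
    chartInv p z ∈ chartDomain n p := by
  rw [chartDomain_eq]
  exact (extChartAt (𝓡 n) p).map_target hz

lemma exists_chartInv_eq {p x : M} (hx : x ∈ chartDomain n p) :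
    ∃ z ∈ chartRange n p, chartInv p z = x := by
  rw [chartDomain_eq] at hx
  exact ⟨extChartAt (𝓡 n) p x, (extChartAt (𝓡 n) p).map_source hx,
    (extChartAt (𝓡 n) p).left_inv hx⟩

lemma exists_chartInv (x : M) :
    ∃ (p : M) (z : Coord n), z ∈ chartRange n p ∧ chartInv p z = x :=
  ⟨x, exists_chartInv_eq (mem_chartDomain n x)⟩

variable [IsManifold (𝓡 n) ∞ M]

/-- The coordinate frame at `x` of the chart at `p`. -/
def frame (p x : M) : Coord n →L[ℝ] TangentSpace (𝓡 n) x :=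
  (trivializationAt (Coord n) (TangentSpace (𝓡 n)) p).symmL ℝ x

/-- The coordinates of tangent vectors at `x` in the chart at `p`. -/
def coframe (p x : M) : TangentSpace (𝓡 n) x →L[ℝ] Coord n :=
  (trivializationAt (Coord n) (TangentSpace (𝓡 n)) p).continuousLinearMapAt ℝ x

/-- The vector field `Y` in the coordinates of the chart at `p`. -/
def rep (p : M) (Y : VField n M) (z : Coord n) : Coord n :=
  coframe p (chartInv p z) (Y (chartInv p z))

/-- The vector field with constant coordinates `a` in the chart at `p`. -/
def coordField (p : M) (a : Coord n) : VField n M := fun x => frame p x a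

lemma coframe_frame {p x : M} (hx : x ∈ chartDomain n p) (a : Coord n) :
    coframe p x (frame p x a) = a :=
  (trivializationAt (Coord n) (TangentSpace (𝓡 n)) p).continuousLinearMapAt_symmL hx a

lemma frame_coframe {p x : M} (hx : x ∈ chartDomain n p) (v : TangentSpace (𝓡 n) x) :
    frame p x (coframe p x v) = v :=
  (trivializationAt (Coord n) (TangentSpace (𝓡 n)) p).symmL_continuousLinearMapAt hx v

lemma contMDiffAt_chartInv {p : M} {z : Coord n} (hz : z ∈ chartRange n p) :
    ContMDiffAt 𝓘(ℝ, Coord n) (𝓡 n) ∞ (chartInv p) z :=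
  (contMDiffOn_extChartAt_symm p).contMDiffAt ((isOpen_chartRange n p).mem_nhds hz)

lemma continuousAt_chartInv {p : M} {z : Coord n} (hz : z ∈ chartRange n p) :
    ContinuousAt (chartInv p) z := (contMDiffAt_chartInv hz).continuousAt

lemma mfderiv_chartInv {p : M} {z : Coord n} (hz : z ∈ chartRange n p) :
    mfderiv 𝓘(ℝ, Coord n) (𝓡 n) (chartInv p) z = frame p (chartInv p z) := by
  have hright : extChartAt (𝓡 n) p (chartInv p z) = z := (extChartAt (𝓡 n) p).right_inv hz
  rw [frame, TangentBundle.symmL_trivializationAt (I := 𝓡 n) (chartInv_mem hz), hright]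
  simp only [chartInv, extChartAt, OpenPartialHomeomorph.extend,
    modelWithCornersSelf_partialEquiv, PartialEquiv.coe_trans_symm,
    PartialHomeomorph.coe_toPartialEquiv_symm, OpenPartialHomeomorph.coe_toPartialHomeomorph_symm,
    PartialEquiv.refl_symm, PartialEquiv.refl_coe, Function.comp_apply, id_eq, Function.comp_id,
    modelWithCornersSelf_coe, Set.range_id, mfderivWithin_univ]
  rfl

lemma dirDeriv_frame {p : M} {z : Coord n} (hz : z ∈ chartRange n p) {f : M → ℝ}
    (hf : MDifferentiableAt (𝓡 n) 𝓘(ℝ, ℝ) f (chartInv p z)) (a : Coord n) :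
    dirDeriv f (chartInv p z) (frame p (chartInv p z) a)
      = fderiv ℝ (fun y => f (chartInv p y)) z a := by
  have hcomp := mfderiv_comp z hf ((contMDiffAt_chartInv hz).mdifferentiableAt (by simp))
  rw [mfderiv_chartInv hz, mfderiv_eq_fderiv] at hcomp
  exact congrArg (fun L => L a) hcomp.symm

lemma dirDeriv_eq {p : M} {z : Coord n} (hz : z ∈ chartRange n p) {f : M → ℝ}
    (hf : MDifferentiableAt (𝓡 n) 𝓘(ℝ, ℝ) f (chartInv p z))
    (v : TangentSpace (𝓡 n) (chartInv p z)) :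
    dirDeriv f (chartInv p z) v
      = fderiv ℝ (fun y => f (chartInv p y)) z (coframe p (chartInv p z) v) := by
  rw [← dirDeriv_frame hz hf, frame_coframe (chartInv_mem hz)]

lemma smoothOn_iff {p : M} {U : Set M} (hU : IsOpen U) (hUp : U ⊆ chartDomain n p)
    (Y : VField n M) : SmoothOn Y U ↔
      ContMDiffOn (𝓡 n) 𝓘(ℝ, Coord n) ∞ (fun x => coframe p x (Y x)) U := by
  refine Iff.trans ((trivializationAt (Coord n) (TangentSpace (𝓡 n)) p).contMDiffOn_section_iff
    (IB := 𝓡 n) (n := ∞) (s := Y) hU hUp) (contMDiffOn_congr fun x hx => ?_)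
  rw [coframe, Bundle.Trivialization.continuousLinearMapAt_apply,
    Bundle.Trivialization.linearMapAt_apply]
  exact (if_pos (hUp hx)).symm

lemma SmoothOn.mono {Y : VField n M} {U U' : Set M} (h : SmoothOn Y U) (hU : U' ⊆ U) :
    SmoothOn Y U' := ContMDiffOn.mono h hU

lemma smoothOn_coordField (p : M) (a : Coord n) : SmoothOn (coordField p a) (chartDomain n p) := by
  rw [smoothOn_iff (isOpen_chartDomain n p) subset_rfl]
  exact contMDiffOn_const.congr fun x hx => coframe_frame hx a

lemma contDiffAt_comp_chartInv {F : Type*} [NormedAddCommGroup F] [NormedSpace ℝ F]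
    {p : M} {z : Coord n} (hz : z ∈ chartRange n p) {f : M → F}
    (hf : ContMDiffAt (𝓡 n) 𝓘(ℝ, F) ∞ f (chartInv p z)) :
    ContDiffAt ℝ ∞ (fun y => f (chartInv p y)) z :=
  (hf.comp z (contMDiffAt_chartInv hz)).contDiffAt

lemma contMDiffAt_coframe {p x : M} {U : Set M} (hU : IsOpen U) (hxU : x ∈ U)
    (hx : x ∈ chartDomain n p) {Y : VField n M} (hY : SmoothOn Y U) :
    ContMDiffAt (𝓡 n) 𝓘(ℝ, Coord n) ∞ (fun x => coframe p x (Y x)) x := by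
  have hinter := hU.inter (isOpen_chartDomain n p)
  exact ((smoothOn_iff hinter Set.inter_subset_right Y).mp
    (hY.mono Set.inter_subset_left)).contMDiffAt (hinter.mem_nhds ⟨hxU, hx⟩)

lemma contDiffAt_rep {p : M} {z : Coord n} (hz : z ∈ chartRange n p) {U : Set M} (hU : IsOpen U)
    (hzU : chartInv p z ∈ U) {Y : VField n M} (hY : SmoothOn Y U) :
    ContDiffAt ℝ ∞ (rep p Y) z :=
  contDiffAt_comp_chartInv hz (contMDiffAt_coframe hU hzU (chartInv_mem hz) hY)

lemma differentiableAt_rep {p : M} {z : Coord n} (hz : z ∈ chartRange n p) {U : Set M}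
    (hU : IsOpen U) (hzU : chartInv p z ∈ U) {Y : VField n M} (hY : SmoothOn Y U) :
    DifferentiableAt ℝ (rep p Y) z :=
  (contDiffAt_rep hz hU hzU hY).differentiableAt (by simp)

lemma rep_coordField {p : M} {z : Coord n} (hz : z ∈ chartRange n p) (a : Coord n) :
    rep p (coordField p a) z = a := coframe_frame (chartInv_mem hz) a

lemma SmoothOn.mdifferentiableAt {Y : VField n M} {U : Set M} (hU : IsOpen U)
    (hY : SmoothOn Y U) {x : M} (hx : x ∈ U) :
    MDifferentiableAt (𝓡 n) (𝓡 n).tangent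
      (fun x => (⟨x, Y x⟩ : TangentBundle (𝓡 n) M)) x :=
  (hY.contMDiffAt (hU.mem_nhds hx)).mdifferentiableAt (by simp)

lemma mpullback_chartInv {p : M} {z : Coord n} (hz : z ∈ chartRange n p) (Y : VField n M) :
    VectorField.mpullback 𝓘(ℝ, Coord n) (𝓡 n) (chartInv p) Y z = rep p Y z := by
  let e : Coord n ≃L[ℝ] TangentSpace (𝓡 n) (chartInv p z) :=
    ContinuousLinearEquiv.equivOfInverse (frame p (chartInv p z)) (coframe p (chartInv p z))
      (coframe_frame (chartInv_mem hz)) (frame_coframe (chartInv_mem hz))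
  rw [VectorField.mpullback_apply, mfderiv_chartInv hz]
  exact congrArg (fun L => L (Y (chartInv p z))) (ContinuousLinearMap.inverse_equiv e)

lemma coframe_mlieBracket {p : M} {z : Coord n} (hz : z ∈ chartRange n p) {U : Set M}
    (hU : IsOpen U) (hzU : chartInv p z ∈ U) {X Y : VField n M} (hX : SmoothOn X U)
    (hY : SmoothOn Y U) :
    coframe p (chartInv p z) (VectorField.mlieBracket (𝓡 n) X Y (chartInv p z))
      = fderiv ℝ (rep p Y) z (rep p X z) - fderiv ℝ (rep p X) z (rep p Y z) := by
  have : IsManifold (𝓡 n) (minSmoothness ℝ 2) M := by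
    rw [minSmoothness_of_isRCLikeNormedField]
    exact IsManifold.of_le (n := ∞) (WithTop.coe_le_coe.mpr le_top)
  have h := VectorField.mpullback_mlieBracket (I := 𝓘(ℝ, Coord n)) (I' := 𝓡 n) (n := ∞)
    (hX.mdifferentiableAt hU hzU) (hY.mdifferentiableAt hU hzU) (contMDiffAt_chartInv hz)
    (by rw [minSmoothness_of_isRCLikeNormedField]; exact WithTop.coe_le_coe.mpr le_top)
  rw [mpullback_chartInv hz] at h
  refine h.trans ?_
  have hrep (Y : VField n M) : VectorField.mpullback 𝓘(ℝ, Coord n) (𝓡 n) (chartInv p) Y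
      =ᶠ[𝓝 z] rep p Y := by
    filter_upwards [(isOpen_chartRange n p).mem_nhds hz] with y hy using mpullback_chartInv hy Y
  rw [Filter.EventuallyEq.mlieBracket_vectorField_eq (hrep X) (hrep Y)]
  have hflat := VectorField.mlieBracketWithin_eq_lieBracketWithin (𝕜 := ℝ) (V := rep p X)
    (W := rep p Y) (s := Set.univ)
  rw [VectorField.lieBracketWithin_univ] at hflat
  exact (congrFun (VectorField.mlieBracketWithin_univ (I := 𝓘(ℝ, Coord n)) (V := rep p X)
    (W := rep p Y)) z).symm.trans (congrFun hflat z)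

end Coordinates

section CoordinateConnection

variable {n : ℕ} {M : Type*} [TopologicalSpace M] [ChartedSpace (EuclideanSpace ℝ (Fin n)) M]
  [IsManifold (𝓡 n) ∞ M]

/-! ## The connection in coordinates -/

instance (x : M) : FiniteDimensional ℝ (TangentSpace (𝓡 n) x) :=
  inferInstanceAs (FiniteDimensional ℝ (EuclideanSpace ℝ (Fin n)))

lemma ext_eq_coordField {x y : M} (v : TangentSpace (𝓡 n) x) (hy : y ∈ chartDomain n x) :
    ext v y = coordField x (coframe x x v) y := by
  have h : coframe x x v
      = ((trivializationAt (Coord n) (TangentSpace (𝓡 n)) x) ⟨x, v⟩).2 := by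
    rw [coframe, Bundle.Trivialization.continuousLinearMapAt_apply,
      Bundle.Trivialization.linearMapAt_apply]
    exact if_pos (mem_chartDomain n x)
  rw [h]
  exact (Bundle.Trivialization.symmL_apply (R := ℝ) _ hy _).symm

lemma SmoothOn.congr {X Y : VField n M} {U : Set M} (hY : SmoothOn Y U)
    (h : ∀ x ∈ U, X x = Y x) : SmoothOn X U :=
  ContMDiffOn.congr hY fun x hx => by rw [h x hx]

lemma smoothOn_ext {x : M} (v : TangentSpace (𝓡 n) x) : SmoothOn (ext v) (chartDomain n x) :=
  (smoothOn_coordField x _).congr fun _ hy => ext_eq_coordField v hy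

lemma ext_self {x : M} (v : TangentSpace (𝓡 n) x) : ext v x = v :=
  FiberBundle.extend_apply_self _ v

variable (g : Metric n M)

/-- The metric at `x`, as a bilinear form. -/
def metricAt (x : M) : TangentSpace (𝓡 n) x →ₗ[ℝ] TangentSpace (𝓡 n) x →ₗ[ℝ] ℝ :=
  LinearMap.mk₂ ℝ (fun v w => g.inner x v w) (by simp) (by simp) (by simp) (by simp)

lemma metricAt_apply (x : M) (v w : TangentSpace (𝓡 n) x) : metricAt g x v w = g.inner x v w := rfl

variable {g}

lemma inner_add_left {x : M} (u v w : TangentSpace (𝓡 n) x) :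
    g.inner x (u + v) w = g.inner x u w + g.inner x v w :=
  congrArg (fun f => f w) (map_add (metricAt g x) u v)

lemma inner_sub_left {x : M} (u v w : TangentSpace (𝓡 n) x) :
    g.inner x (u - v) w = g.inner x u w - g.inner x v w :=
  congrArg (fun f => f w) (map_sub (metricAt g x) u v)

lemma inner_smul_left {x : M} (c : ℝ) (v w : TangentSpace (𝓡 n) x) :
    g.inner x (c • v) w = c * g.inner x v w :=
  congrArg (fun f => f w) (map_smul (metricAt g x) c v)

lemma inner_add_right {x : M} (u v w : TangentSpace (𝓡 n) x) :
    g.inner x u (v + w) = g.inner x u v + g.inner x u w := map_add (metricAt g x u) v w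

lemma inner_sub_right {x : M} (u v w : TangentSpace (𝓡 n) x) :
    g.inner x u (v - w) = g.inner x u v - g.inner x u w := map_sub (metricAt g x u) v w

lemma inner_smul_right {x : M} (c : ℝ) (v w : TangentSpace (𝓡 n) x) :
    g.inner x v (c • w) = c * g.inner x v w := map_smul (metricAt g x v) c w

variable (g)

lemma eq_of_inner_eq {x : M} {v w : TangentSpace (𝓡 n) x}
    (h : ∀ u, g.inner x v u = g.inner x w u) : v = w := by
  by_contra hvw
  have hself : g.inner x (v - w) (v - w) = 0 := by rw [inner_sub_left, h, sub_self]
  exact (g.pos x (v - w) (sub_ne_zero.mpr hvw)).ne' hself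

lemma inner_sharp (x : M) (α : TangentSpace (𝓡 n) x →ₗ[ℝ] ℝ) (z : TangentSpace (𝓡 n) x) :
    g.inner x (sharp g x α) z = α z := by
  have hinj : Function.Injective (metricAt g x) := fun v w h =>
    eq_of_inner_eq g fun u => congrArg (fun f => f u) h
  have hsurj : Function.Surjective (metricAt g x) :=
    (LinearMap.injective_iff_surjective_of_finrank_eq_finrank
      (Subspace.dual_finrank_eq (K := ℝ) (V := TangentSpace (𝓡 n) x)).symm).mp hinj
  obtain ⟨w, hw⟩ := hsurj α
  have h : ∃ w, ∀ z, g.inner x w z = α z := ⟨w, fun z => congrArg (fun f => f z) hw⟩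
  exact Classical.epsilon_spec h z

lemma contMDiffOn_inner {k : WithTop ℕ∞} (hk : k ≤ ∞) {U : Set M} {X Y : VField n M}
    (hX : ContMDiffOn (𝓡 n) (𝓡 n).tangent k (fun x => (⟨x, X x⟩ : TangentBundle (𝓡 n) M)) U)
    (hY : ContMDiffOn (𝓡 n) (𝓡 n).tangent k (fun x => (⟨x, Y x⟩ : TangentBundle (𝓡 n) M)) U) :
    ContMDiffOn (𝓡 n) 𝓘(ℝ, ℝ) k (fun x => g.inner x (X x) (Y x)) U := by
  intro x hx
  have hbundle : ContMDiffWithinAt (𝓡 n) ((𝓡 n).prod 𝓘(ℝ)) k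
      (fun m ↦ Bundle.TotalSpace.mk' ℝ (E := Bundle.Trivial M ℝ) m
        (g.inner m (X m) (Y m))) U x := by
    apply ContMDiffWithinAt.clm_bundle_apply₂ (F₁ := Coord n) (F₂ := Coord n)
    · exact ((g.contMDiff x).of_le hk).contMDiffWithinAt
    · exact hX x hx
    · exact hY x hx
  exact (Bundle.contMDiffWithinAt_totalSpace.mp hbundle).2

/-- A trilinear map on a finite-dimensional space, as a continuous trilinear map. -/
def trilinearCLM {E : Type*} [NormedAddCommGroup E] [NormedSpace ℝ E] [FiniteDimensional ℝ E]
    (L : E →ₗ[ℝ] E →ₗ[ℝ] E →ₗ[ℝ] ℝ) : E →L[ℝ] E →L[ℝ] E →L[ℝ] ℝ :=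
  LinearMap.toContinuousLinearMap
    { toFun := fun a => LinearMap.toContinuousBilinearMap (L a)
      map_add' := fun a b => by ext; simp
      map_smul' := fun c a => by ext; simp }

variable {g} {τ : TriForm n M}

lemma contDiffOn_comp_chartInv {F : Type*} [NormedAddCommGroup F] [NormedSpace ℝ F] {p : M}
    {f : M → F} (hf : ContMDiffOn (𝓡 n) 𝓘(ℝ, F) ∞ f (chartDomain n p)) :
    ContDiffOn ℝ ∞ (fun z => f (chartInv p z)) (chartRange n p) := fun _ hz =>
  (contDiffAt_comp_chartInv hz (hf.contMDiffAt
    ((isOpen_chartDomain n p).mem_nhds (chartInv_mem hz)))).contDiffWithinAt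

variable (g) in
/-- The metric in coordinates. -/
def coordMetric (p : M) (z : Coord n) : Coord n →L[ℝ] Coord n →L[ℝ] ℝ :=
  LinearMap.toContinuousBilinearMap ((metricAt g (chartInv p z)).compl₁₂
    (frame (n := n) p (chartInv p z)).toLinearMap
    (frame (n := n) p (chartInv p z)).toLinearMap)

lemma coordMetric_apply (p : M) (z a b : Coord n) : coordMetric g p z a b
    = g.inner (chartInv p z) (frame p (chartInv p z) a) (frame p (chartInv p z) b) := rfl

lemma contDiffOn_coordMetric (p : M) : ContDiffOn ℝ ∞ (coordMetric g p) (chartRange n p) := by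
  simp_rw [contDiffOn_clm_apply]
  exact fun a b => contDiffOn_comp_chartInv
    (contMDiffOn_inner g le_rfl (smoothOn_coordField p a) (smoothOn_coordField p b))

lemma differentiableAt_coordMetric {p : M} {z : Coord n} (hz : z ∈ chartRange n p) :
    DifferentiableAt ℝ (coordMetric g p) z :=
  ((contDiffOn_coordMetric p).contDiffAt
    ((isOpen_chartRange n p).mem_nhds hz)).differentiableAt (by simp)

variable (τ) in
/-- The `3`-form in coordinates. -/
def coordForm (p : M) (z : Coord n) : Coord n →L[ℝ] Coord n →L[ℝ] Coord n →L[ℝ] ℝ :=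
  trilinearCLM
    { toFun := fun a => (τ (chartInv p z) (frame p (chartInv p z) a)).compl₁₂
        (frame (n := n) p (chartInv p z)).toLinearMap
        (frame (n := n) p (chartInv p z)).toLinearMap
      map_add' := fun a b => by ext; simp
      map_smul' := fun c a => by ext; simp }

lemma coordForm_apply (p : M) (z a b c : Coord n) : coordForm τ p z a b c
    = τ (chartInv p z) (frame p (chartInv p z) a) (frame p (chartInv p z) b)
      (frame p (chartInv p z) c) := rfl

lemma contDiffOn_coordForm (hτ : IsThreeForm τ) (p : M) :
    ContDiffOn ℝ ∞ (coordForm τ p) (chartRange n p) := by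
  simp_rw [contDiffOn_clm_apply]
  exact fun a b c => contDiffOn_comp_chartInv (hτ.smooth _ _ _ _ (isOpen_chartDomain n p)
    (smoothOn_coordField p a) (smoothOn_coordField p b) (smoothOn_coordField p c))

variable (g) in
/-- The metric and the `3`-form in the chart at `p`. -/
def localGeometry (hτ : IsThreeForm τ) (p : M) : LocalGeometry (Coord n) where
  domain := chartRange n p
  isOpen_domain := isOpen_chartRange n p
  metric := coordMetric g p
  form := coordForm τ p
  contDiffOn_metric := contDiffOn_coordMetric p
  contDiffOn_form := contDiffOn_coordForm hτ p
  metric_symm z _ a b := g.symm _ _ _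
  metric_pos z hz a ha := g.pos _ _ fun h => ha (by
    have h' : frame p (chartInv p z) a = 0 := h
    rw [← coframe_frame (chartInv_mem hz) a, h', map_zero])
  form_alt_left z _ a b := hτ.alt_left _ _ _
  form_alt_right z _ a b := hτ.alt_right _ _ _

variable (hτ : IsThreeForm τ) {p : M} {z : Coord n}

lemma localGeometry_metric : (localGeometry g hτ p).metric = coordMetric g p := rfl

lemma localGeometry_form : (localGeometry g hτ p).form = coordForm τ p := rfl

lemma coordMetric_coframe (hz : z ∈ chartRange n p) (v w : TangentSpace (𝓡 n) (chartInv p z)) :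
    coordMetric g p z (coframe p (chartInv p z) v) (coframe p (chartInv p z) w)
      = g.inner (chartInv p z) v w := by
  rw [coordMetric_apply, frame_coframe (chartInv_mem hz), frame_coframe (chartInv_mem hz)]

lemma coordForm_coframe (hz : z ∈ chartRange n p) (u v w : TangentSpace (𝓡 n) (chartInv p z)) :
    coordForm τ p z (coframe p (chartInv p z) u) (coframe p (chartInv p z) v)
      (coframe p (chartInv p z) w) = τ (chartInv p z) u v w := by
  rw [coordForm_apply, frame_coframe (chartInv_mem hz), frame_coframe (chartInv_mem hz),
    frame_coframe (chartInv_mem hz)]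

lemma dirDeriv_inner (hz : z ∈ chartRange n p) {U : Set M} (hU : IsOpen U)
    (hzU : chartInv p z ∈ U) {X Y : VField n M} (hX : SmoothOn X U) (hY : SmoothOn Y U)
    (v : TangentSpace (𝓡 n) (chartInv p z)) :
    dirDeriv (fun y => g.inner y (X y) (Y y)) (chartInv p z) v
      = fderiv ℝ (coordMetric g p) z (coframe p _ v) (rep p X z) (rep p Y z)
        + coordMetric g p z (fderiv ℝ (rep p X) z (coframe p _ v)) (rep p Y z)
        + coordMetric g p z (rep p X z) (fderiv ℝ (rep p Y) z (coframe p _ v)) := by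
  have hf := ((contMDiffOn_inner g le_rfl hX hY).contMDiffAt (hU.mem_nhds hzU)).mdifferentiableAt
    (by simp)
  rw [dirDeriv_eq hz hf]
  have heq : (fun y => g.inner (chartInv p y) (X (chartInv p y)) (Y (chartInv p y)))
      =ᶠ[𝓝 z] fun y => coordMetric g p y (rep p X y) (rep p Y y) := by
    filter_upwards [(isOpen_chartRange n p).mem_nhds hz] with y hy
    exact (coordMetric_coframe hy _ _).symm
  rw [heq.fderiv_eq]
  exact fderiv_clm_apply₂ (differentiableAt_coordMetric hz)
    (differentiableAt_rep hz hU hzU hX) (differentiableAt_rep hz hU hzU hY) _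

lemma koszul_eq (hz : z ∈ chartRange n p) {U : Set M} (hU : IsOpen U)
    (hzU : chartInv p z ∈ U) {X Y Z : VField n M} (hX : SmoothOn X U) (hY : SmoothOn Y U)
    (hZ : SmoothOn Z U) :
    koszul g X Y Z (chartInv p z) = 2 * (coordMetric g p z
      (fderiv ℝ (rep p Y) z (rep p X z)) (rep p Z z)
        + (localGeometry g hτ p).koszulForm z (rep p X z) (rep p Y z) (rep p Z z)) := by
  have hsymm (a b : Coord n) : coordMetric g p z a b = coordMetric g p z b a := g.symm _ _ _
  rw [koszul, dirDeriv_inner hz hU hzU hY hZ, dirDeriv_inner hz hU hzU hX hZ,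
    dirDeriv_inner hz hU hzU hX hY, ← coordMetric_coframe hz (VectorField.mlieBracket _ X Y _),
    ← coordMetric_coframe hz (VectorField.mlieBracket _ X Z _),
    ← coordMetric_coframe hz (VectorField.mlieBracket _ Y Z _),
    coframe_mlieBracket hz hU hzU hX hY, coframe_mlieBracket hz hU hzU hX hZ,
    coframe_mlieBracket hz hU hzU hY hZ, LocalGeometry.koszulForm_apply, localGeometry_metric]
  simp only [map_sub, sub_apply, ← rep.eq_1]
  rw [hsymm (rep p X z) (fderiv ℝ (rep p Z) z (rep p Y z)),
    hsymm (rep p X z) (fderiv ℝ (rep p Y) z (rep p Z z)),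
    hsymm (rep p Y z) (fderiv ℝ (rep p Z) z (rep p X z))]
  ring

end CoordinateConnection

section TangentAlgebra

variable {n : ℕ} {M : Type*} [TopologicalSpace M] [ChartedSpace (EuclideanSpace ℝ (Fin n)) M]
  [IsManifold (𝓡 n) ∞ M]

/-! ## The torsion and its Casimir endomorphism on tangent spaces -/

variable {g : Metric n M} {τ : TriForm n M}

lemma sharp_inner {x : M} (w : TangentSpace (𝓡 n) x) {f : TangentSpace (𝓡 n) x → ℝ}
    (hf : ∀ u, f u = g.inner x w u) : sharp g x f = w := by
  refine eq_of_inner_eq g fun u => ?_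
  rw [show f = metricAt g x w from funext hf, inner_sharp, metricAt_apply]

variable (g) in
/-- The isomorphism of cotangent and tangent space defined by the metric. -/
def raiseAt (x : M) : (TangentSpace (𝓡 n) x →ₗ[ℝ] ℝ) →ₗ[ℝ] TangentSpace (𝓡 n) x where
  toFun α := sharp g x α
  map_add' α β := eq_of_inner_eq g fun u => by
    rw [inner_sharp, inner_add_left, inner_sharp, inner_sharp, LinearMap.add_apply]
  map_smul' c α := eq_of_inner_eq g fun u => by
    rw [inner_sharp, inner_smul_left, inner_sharp, LinearMap.smul_apply, RingHom.id_apply,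
      smul_eq_mul]

lemma inner_raiseAt (x : M) (α : TangentSpace (𝓡 n) x →ₗ[ℝ] ℝ) (z : TangentSpace (𝓡 n) x) :
    g.inner x (raiseAt g x α) z = α z := inner_sharp g x α z

lemma IsThreeForm.swap_right (hτ : IsThreeForm τ) (x : M) (u v w : TangentSpace (𝓡 n) x) :
    τ x u v w = -τ x u w v := by
  have h := hτ.alt_right x u (v + w)
  simp only [map_add, LinearMap.add_apply, hτ.alt_right] at h
  linarith

variable (g τ) in
/-- The endomorphisms `τ_u` with `g(τ_u v, w) = τ(u, v, w)`. -/
def torsionAt (x : M) :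
    TangentSpace (𝓡 n) x →ₗ[ℝ] TangentSpace (𝓡 n) x →ₗ[ℝ] TangentSpace (𝓡 n) x where
  toFun u := raiseAt g x ∘ₗ τ x u
  map_add' u v := by ext w; simp
  map_smul' c u := by ext w; simp

lemma inner_torsionAt (x : M) (u v w : TangentSpace (𝓡 n) x) :
    g.inner x (torsionAt g τ x u v) w = τ x u v w := inner_sharp g x _ _

variable (g) in
/-- The tangent space at `x` with its metric and torsion. -/
def torsionSpace (hτ : IsThreeForm τ) (x : M) : TorsionSpace (TangentSpace (𝓡 n) x) where
  b := metricAt g x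
  t := torsionAt g τ x
  symm v w := g.symm x v w
  pos v hv := g.pos x v hv
  alt u := eq_of_inner_eq g fun w => by rw [inner_torsionAt, hτ.alt_left, map_zero]; rfl
  skew u v w := by
    change g.inner x (torsionAt g τ x u v) w = -g.inner x v (torsionAt g τ x u w)
    rw [g.symm x v, inner_torsionAt, inner_torsionAt, hτ.swap_right]

lemma mem_stab_iff (hτ : IsThreeForm τ) (x : M) (A : Module.End ℝ (TangentSpace (𝓡 n) x)) :
    A ∈ stab g τ x ↔ (torsionSpace g hτ x).IsStab A := by
  have hskew_iff : (∀ v w, g.inner x (A v) w + g.inner x v (A w) = 0) ↔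
      ∀ v w, g.inner x (A v) w = -g.inner x v (A w) := by
    simp only [add_eq_zero_iff_eq_neg]
  have hderiv (hA : ∀ v w, g.inner x (A v) w = -g.inner x v (A w))
      (u v w : TangentSpace (𝓡 n) x) : τ x (A u) v w + τ x u (A v) w + τ x u v (A w)
      = g.inner x (torsionAt g τ x (A u) v + torsionAt g τ x u (A v)) w
        - g.inner x (A (torsionAt g τ x u v)) w := by
    rw [inner_add_left, hA, inner_torsionAt, inner_torsionAt, inner_torsionAt, sub_neg_eq_add]
  constructor
  · rintro ⟨hskew, hτA⟩
    rw [hskew_iff] at hskew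
    refine ⟨hskew, fun u v => eq_of_inner_eq g fun w => ?_⟩
    exact (sub_eq_zero.mp ((hderiv hskew u v w).symm.trans (hτA u v w))).symm
  · rintro ⟨hskew, hA⟩
    refine ⟨hskew_iff.mpr hskew, fun u v w => ?_⟩
    rw [hderiv hskew, sub_eq_zero]
    exact congrArg (fun y => g.inner x y w) (hA u v).symm

variable (g τ) in
/-- The endomorphism `S` with `g(S u, v) = -tr (τ_u τ_v)`. -/
def casimirAt (x : M) : Module.End ℝ (TangentSpace (𝓡 n) x) :=
  raiseAt g x ∘ₗ LinearMap.mk₂ ℝ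
    (fun u v => - LinearMap.trace ℝ _ (torsionAt g τ x u ∘ₗ torsionAt g τ x v))
    (fun u v w => by rw [map_add, LinearMap.add_comp, map_add]; ring)
    (fun c u v => by rw [map_smul, LinearMap.smul_comp, map_smul, smul_neg])
    (fun u v w => by rw [map_add, LinearMap.comp_add, map_add]; ring)
    (fun c u v => by rw [map_smul, LinearMap.comp_smul, map_smul, smul_neg])

lemma inner_casimirAt (x : M) (u v : TangentSpace (𝓡 n) x) : g.inner x (casimirAt g τ x u) v
    = -LinearMap.trace ℝ _ (torsionAt g τ x u ∘ₗ torsionAt g τ x v) := inner_raiseAt x _ _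

/-- The isomorphism of the tangent space with the model space given by the chart at `p`. -/
def coframeEquiv {p x : M} (hx : x ∈ chartDomain n p) : TangentSpace (𝓡 n) x ≃ₗ[ℝ] Coord n where
  toFun := coframe p x
  invFun := frame p x
  map_add' := map_add _
  map_smul' := map_smul _
  left_inv := frame_coframe hx
  right_inv := coframe_frame hx

variable (hτ : IsThreeForm τ) {p : M} {z : Coord n}

lemma coframe_torsionAt (hz : z ∈ chartRange n p) (u v : TangentSpace (𝓡 n) (chartInv p z)) :
    coframe p _ (torsionAt g τ _ u v)
      = (localGeometry g hτ p).tor z (coframe p _ u) (coframe p _ v) := by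
  refine (localGeometry g hτ p).metric_ext hz fun c => ?_
  rw [(localGeometry g hτ p).metric_tor hz, localGeometry_metric, localGeometry_form,
    ← coframe_frame (chartInv_mem hz) c, coordMetric_coframe hz, coordForm_coframe hz,
    inner_torsionAt]

lemma trace_eq_of_coframe (hz : z ∈ chartRange n p)
    (A : Module.End ℝ (TangentSpace (𝓡 n) (chartInv p z))) (B : Coord n →L[ℝ] Coord n)
    (h : ∀ v, coframe p _ (A v) = B (coframe p _ v)) :
    LinearMap.trace ℝ _ A = traceL (Coord n) B := by
  rw [traceL_apply, ← LinearMap.trace_conj' A (coframeEquiv (chartInv_mem hz))]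
  congr 1
  ext1 a
  rw [LinearEquiv.conj_apply_apply]
  change coframe p _ (A (frame p _ a)) = B a
  rw [h, coframe_frame (chartInv_mem hz)]

lemma coframe_casimirAt (hz : z ∈ chartRange n p) (u : TangentSpace (𝓡 n) (chartInv p z)) :
    coframe p _ (casimirAt g τ _ u) = (localGeometry g hτ p).casimir z (coframe p _ u) := by
  refine (localGeometry g hτ p).metric_ext hz fun c => ?_
  rw [(localGeometry g hτ p).metric_casimir hz, localGeometry_metric,
    ← coframe_frame (chartInv_mem hz) c, coordMetric_coframe hz, inner_casimirAt]
  congr 1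
  refine trace_eq_of_coframe hz _ _ fun v => ?_
  rw [LinearMap.comp_apply, coframe_torsionAt hτ hz, coframe_torsionAt hτ hz]
  rfl

lemma trace_casimirAt_pow (hz : z ∈ chartRange n p) (k : ℕ) :
    LinearMap.trace ℝ _ (casimirAt g τ (chartInv p z) ^ k)
      = traceL (Coord n) ((localGeometry g hτ p).casimir z ^ k) := by
  refine trace_eq_of_coframe hz _ _ fun v => ?_
  induction k generalizing v with
  | zero => simp
  | succ k ih => rw [pow_succ, pow_succ, Module.End.mul_apply, ih, coframe_casimirAt hτ hz]; rfl

lemma coframe_leviCivita (hz : z ∈ chartRange n p) {U : Set M} (hU : IsOpen U)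
    (hzU : chartInv p z ∈ U) {Y : VField n M} (hY : SmoothOn Y U)
    (v : TangentSpace (𝓡 n) (chartInv p z)) :
    coframe p _ (leviCivita g Y (chartInv p z) v) = fderiv ℝ (rep p Y) z (coframe p _ v)
      + (localGeometry g hτ p).chris z (coframe p _ v) (rep p Y z)
      - (localGeometry g hτ p).tor z (coframe p _ v) (rep p Y z) := by
  set L := localGeometry g hτ p with hL
  set D := fderiv ℝ (rep p Y) z (coframe p _ v) + L.chris z (coframe p _ v) (rep p Y z)
      - L.tor z (coframe p _ v) (rep p Y z) with hD
  have hframe : leviCivita g Y (chartInv p z) v = frame p _ D := by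
    refine sharp_inner _ fun u => ?_
    have hopen := hU.inter (isOpen_chartDomain n (chartInv p z))
    have hrep (w : TangentSpace (𝓡 n) (chartInv p z)) : rep p (ext w) z = coframe p _ w := by
      rw [rep, ext_self]
    rw [koszul_eq hτ hz hopen ⟨hzU, mem_chartDomain n _⟩
      ((smoothOn_ext v).mono Set.inter_subset_right) (hY.mono Set.inter_subset_left)
      ((smoothOn_ext u).mono Set.inter_subset_right), hrep, hrep, ← coordMetric_coframe hz,
      coframe_frame (chartInv_mem hz), hD, ← localGeometry_metric hτ, ← hL]
    simp only [map_add, map_sub, add_apply, sub_apply]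
    rw [L.metric_chris hz, L.metric_tor hz]
    ring
  rw [hframe, coframe_frame (chartInv_mem hz)]

lemma connection_eq (Y : VField n M) (x : M) (v : TangentSpace (𝓡 n) x) :
    connection g τ Y x v = leviCivita g Y x v + torsionAt g τ x v (Y x) := rfl

lemma coframe_connection (hz : z ∈ chartRange n p) {U : Set M} (hU : IsOpen U)
    (hzU : chartInv p z ∈ U) {Y : VField n M} (hY : SmoothOn Y U)
    (v : TangentSpace (𝓡 n) (chartInv p z)) :
    coframe p _ (connection g τ Y (chartInv p z) v) = fderiv ℝ (rep p Y) z (coframe p _ v)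
      + (localGeometry g hτ p).chris z (coframe p _ v) (rep p Y z) := by
  rw [connection_eq, map_add, coframe_leviCivita hτ hz hU hzU hY, coframe_torsionAt hτ hz,
    ← rep.eq_1, sub_add_cancel]

end TangentAlgebra

section Connection

variable {n : ℕ} {M : Type*} [TopologicalSpace M] [ChartedSpace (EuclideanSpace ℝ (Fin n)) M]
  [IsManifold (𝓡 n) ∞ M]

/-! ## Properties of the connection -/

variable {g : Metric n M} {τ : TriForm n M} {p : M} {z : Coord n}

lemma coframe_injective (hz : z ∈ chartRange n p) {v w : TangentSpace (𝓡 n) (chartInv p z)}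
    (h : coframe p _ v = coframe p _ w) : v = w := by
  rw [← frame_coframe (chartInv_mem hz) v, h, frame_coframe (chartInv_mem hz)]

lemma rep_eventuallyEq (hz : z ∈ chartRange n p) {U : Set M} (hU : IsOpen U)
    (hzU : chartInv p z ∈ U) {X : VField n M} {f : Coord n → Coord n}
    (h : ∀ y ∈ chartRange n p, chartInv p y ∈ U → rep p X y = f y) : rep p X =ᶠ[𝓝 z] f := by
  filter_upwards [(isOpen_chartRange n p).mem_nhds hz,
    (continuousAt_chartInv hz).preimage_mem_nhds (hU.mem_nhds hzU)] with y hy hyU using h y hy hyU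

lemma fderiv_rep_coordField (hz : z ∈ chartRange n p) (a : Coord n) :
    fderiv ℝ (rep p (coordField p a)) z = 0 := by
  have h : rep p (coordField p a) =ᶠ[𝓝 z] fun _ => a :=
    rep_eventuallyEq hz (isOpen_chartDomain n p) (chartInv_mem hz)
      fun y hy _ => rep_coordField hy a
  rw [h.fderiv_eq, fderiv_fun_const]; rfl

lemma smoothOn_of_contDiffAt_rep {U : Set M} (hU : IsOpen U) {X : VField n M}
    (h : ∀ p, ∀ z ∈ chartRange n p, chartInv p z ∈ U → ContDiffAt ℝ ∞ (rep p X) z) :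
    SmoothOn X U := by
  intro x hx
  have hopen := hU.inter (isOpen_chartDomain n x)
  suffices hX : SmoothOn X (U ∩ chartDomain n x) from
    (hX.contMDiffAt (hopen.mem_nhds ⟨hx, mem_chartDomain n x⟩)).contMDiffWithinAt
  rw [smoothOn_iff hopen Set.inter_subset_right]
  rintro y ⟨hyU, hy⟩
  have hinv : ∀ y ∈ chartDomain n x, chartInv x (extChartAt (𝓡 n) x y) = y := fun y hy =>
    (extChartAt (𝓡 n) x).left_inv (by rwa [← chartDomain_eq])
  rw [chartDomain_eq] at hy
  have hrep : ContMDiffAt (𝓡 n) 𝓘(ℝ, Coord n) ∞ (fun y => rep x X (extChartAt (𝓡 n) x y)) y :=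
    (h x _ ((extChartAt (𝓡 n) x).map_source hy)
      (by rwa [hinv y (by rwa [chartDomain_eq])])).contMDiffAt.comp y
      (contMDiffAt_extChartAt' (by rwa [extChartAt_source] at hy))
  refine (hrep.congr_of_eventuallyEq ?_).contMDiffWithinAt
  filter_upwards [(isOpen_chartDomain n x).mem_nhds (by rwa [chartDomain_eq])] with w hw
  rw [rep, hinv w hw]

lemma IsThreeForm.fderiv_coordForm_apply (hτ : IsThreeForm τ) (hz : z ∈ chartRange n p)
    (u a b c : Coord n) :
    fderiv ℝ (fun y => coordForm τ p y a b c) z u = fderiv ℝ (coordForm τ p) z u a b c := by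
  have hform : DifferentiableAt ℝ (coordForm τ p) z :=
    ((contDiffOn_coordForm hτ p).contDiffAt
      ((isOpen_chartRange n p).mem_nhds hz)).differentiableAt (by simp)
  rw [fderiv_clm_apply_const ((hform.clm_apply (differentiableAt_const a)).clm_apply
      (differentiableAt_const b)),
    fderiv_clm_apply_const (hform.clm_apply (differentiableAt_const a)),
    fderiv_clm_apply_const hform]

lemma coframe_connection_coordField (hτ : IsThreeForm τ) (hz : z ∈ chartRange n p)
    (u a : Coord n) :
    coframe p _ (connection g τ (coordField p a) (chartInv p z) (frame p _ u))
      = (localGeometry g hτ p).chris z u a := by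
  rw [coframe_connection hτ hz (isOpen_chartDomain n p) (chartInv_mem hz)
    (smoothOn_coordField p a), fderiv_rep_coordField hz, rep_coordField hz,
    coframe_frame (chartInv_mem hz), zero_apply, zero_add]

lemma IsParallelSkewTorsion.isParallel (hτ : IsParallelSkewTorsion g τ) (p : M) :
    (localGeometry g hτ.threeForm p).IsParallel := by
  intro z hz u a b c
  replace hz : z ∈ chartRange n p := hz
  have hsmooth : ∀ a, SmoothOn (coordField p a) (chartDomain n p) := smoothOn_coordField p
  have hopen := isOpen_chartDomain n p
  have hdiff : MDifferentiableAt (𝓡 n) 𝓘(ℝ, ℝ)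
      (fun x => τ x (coordField p a x) (coordField p b x) (coordField p c x)) (chartInv p z) :=
    ((hτ.threeForm.smooth _ _ _ _ hopen (hsmooth a) (hsmooth b) (hsmooth c)).contMDiffAt
      (hopen.mem_nhds (chartInv_mem hz))).mdifferentiableAt (by simp)
  have hparallel := hτ.parallel _ _ _ _ hopen (hsmooth a) (hsmooth b) (hsmooth c) _
    (chartInv_mem hz) (frame p _ u)
  rw [dirDeriv_frame hz hdiff, ← coordForm_coframe hz, ← coordForm_coframe hz,
    ← coordForm_coframe hz, coframe_connection_coordField hτ.threeForm hz,
    coframe_connection_coordField hτ.threeForm hz,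
    coframe_connection_coordField hτ.threeForm hz] at hparallel
  simp only [← rep.eq_1, rep_coordField hz] at hparallel
  have hderiv := hτ.threeForm.fderiv_coordForm_apply hz u a b c
  rw [localGeometry_form]
  simp only [coordField, ← coordForm_apply] at hparallel
  linarith

section

variable {U : Set M} (hU : IsOpen U) {x : M} (hx : x ∈ U) {X Y : VField n M}

include hU hx

lemma dirDeriv_inner_eq (hτ : IsThreeForm τ) (hX : SmoothOn X U) (hY : SmoothOn Y U)
    (v : TangentSpace (𝓡 n) x) :
    dirDeriv (fun y => g.inner y (X y) (Y y)) x v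
      = g.inner x (connection g τ X x v) (Y x) + g.inner x (X x) (connection g τ Y x v) := by
  obtain ⟨p, z, hz, rfl⟩ := exists_chartInv (n := n) x
  rw [dirDeriv_inner hz hU hx hX hY, ← coordMetric_coframe hz, ← coordMetric_coframe hz,
    coframe_connection hτ hz hU hx hX, coframe_connection hτ hz hU hx hY,
    ← localGeometry_metric hτ, (localGeometry g hτ p).fderiv_metric hz]
  simp only [map_add, add_apply, ← rep.eq_1]
  ring

lemma connection_sub_connection (hτ : IsThreeForm τ) (hX : SmoothOn X U) (hY : SmoothOn Y U) :
    connection g τ Y x (X x) - connection g τ X x (Y x)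
      = VectorField.mlieBracket (𝓡 n) X Y x + (2 : ℝ) • torsionAt g τ x (X x) (Y x) := by
  obtain ⟨p, z, hz, rfl⟩ := exists_chartInv (n := n) x
  apply coframe_injective hz
  rw [map_sub, map_add, map_smul, coframe_connection hτ hz hU hx hX,
    coframe_connection hτ hz hU hx hY, coframe_mlieBracket hz hU hx hX hY,
    coframe_torsionAt hτ hz]
  simp only [← rep.eq_1]
  rw [← (localGeometry g hτ p).chris_sub_chris hz]
  abel

lemma connection_congr (hτ : IsThreeForm τ) (hY : SmoothOn Y U) (h : ∀ y ∈ U, X y = Y y)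
    (v : TangentSpace (𝓡 n) x) : connection g τ X x v = connection g τ Y x v := by
  obtain ⟨p, z, hz, rfl⟩ := exists_chartInv (n := n) x
  apply coframe_injective hz
  have hrep : rep p X =ᶠ[𝓝 z] rep p Y :=
    rep_eventuallyEq hz hU hx fun y _ hy => by rw [rep, rep, h _ hy]
  rw [coframe_connection hτ hz hU hx (hY.congr h), coframe_connection hτ hz hU hx hY,
    hrep.fderiv_eq, hrep.self_of_nhds]

lemma connection_const_smul (hτ : IsThreeForm τ) (hY : SmoothOn Y U) (c : ℝ)
    (v : TangentSpace (𝓡 n) x) :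
    connection g τ (fun y => c • Y y) x v = c • connection g τ Y x v := by
  obtain ⟨p, z, hz, rfl⟩ := exists_chartInv (n := n) x
  apply coframe_injective hz
  have hrep : rep p (fun y => c • Y y) = fun y => c • rep p Y y := by
    funext y; rw [rep, map_smul, rep]
  have hsmooth : SmoothOn (fun y => c • Y y) U := ContMDiffOn.const_smul_section hY
  rw [coframe_connection hτ hz hU hx hsmooth, map_smul, coframe_connection hτ hz hU hx hY, hrep,
    fderiv_fun_const_smul (differentiableAt_rep hz hU hx hY), map_smul, smul_add, smul_apply]

lemma connection_torsionAt (hτ : IsParallelSkewTorsion g τ) (hX : SmoothOn X U)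
    (hY : SmoothOn Y U) (v : TangentSpace (𝓡 n) x)
    (hsmooth : SmoothOn (fun y => torsionAt g τ y (X y) (Y y)) U) :
    connection g τ (fun y => torsionAt g τ y (X y) (Y y)) x v
      = torsionAt g τ x (connection g τ X x v) (Y x)
        + torsionAt g τ x (X x) (connection g τ Y x v) := by
  obtain ⟨p, z, hz, rfl⟩ := exists_chartInv (n := n) x
  apply coframe_injective hz
  have hτ' := hτ.threeForm
  set L := localGeometry g hτ' p with hL
  have hrep : rep p (fun y => torsionAt g τ y (X y) (Y y))
      =ᶠ[𝓝 z] fun y => L.tor y (rep p X y) (rep p Y y) :=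
    rep_eventuallyEq hz hU hx fun y hy _ => coframe_torsionAt hτ' hy _ _
  rw [coframe_connection hτ' hz hU hx hsmooth, map_add, coframe_torsionAt hτ' hz,
    coframe_torsionAt hτ' hz, coframe_connection hτ' hz hU hx hX,
    coframe_connection hτ' hz hU hx hY, hrep.fderiv_eq, hrep.self_of_nhds, ← hL,
    fderiv_clm_apply₂ (L.differentiableAt_tor hz)
      (differentiableAt_rep hz hU hx hX) (differentiableAt_rep hz hU hx hY),
    (hτ.isParallel p).isParallelOn_tor z hz]
  simp only [map_add, add_apply, ← rep.eq_1, ← hL]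
  abel

lemma connection_casimirAt (hτ : IsParallelSkewTorsion g τ) (hY : SmoothOn Y U)
    (v : TangentSpace (𝓡 n) x) (hsmooth : SmoothOn (fun y => casimirAt g τ y (Y y)) U) :
    connection g τ (fun y => casimirAt g τ y (Y y)) x v
      = casimirAt g τ x (connection g τ Y x v) := by
  obtain ⟨p, z, hz, rfl⟩ := exists_chartInv (n := n) x
  apply coframe_injective hz
  have hτ' := hτ.threeForm
  set L := localGeometry g hτ' p with hL
  have hrep : rep p (fun y => casimirAt g τ y (Y y)) =ᶠ[𝓝 z] fun y => L.casimir y (rep p Y y) :=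
    rep_eventuallyEq hz hU hx fun y hy _ => coframe_casimirAt hτ' hy _
  have hderiv := ((L.differentiableAt_casimir hz).hasFDerivAt.clm_apply
    (differentiableAt_rep hz hU hx hY).hasFDerivAt).fderiv
  rw [coframe_connection hτ' hz hU hx hsmooth, coframe_casimirAt hτ' hz,
    coframe_connection hτ' hz hU hx hY, hrep.fderiv_eq, hrep.self_of_nhds, ← hL, hderiv, add_apply,
    ContinuousLinearMap.comp_apply, ContinuousLinearMap.flip_apply,
    (hτ.isParallel p).fderiv_casimir hz]
  simp only [map_add, sub_apply, mul_apply_eq_comp, ← hL]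
  abel

end

lemma smoothOn_torsionAt (hτ : IsThreeForm τ) {U : Set M} (hU : IsOpen U) {X Y : VField n M}
    (hX : SmoothOn X U) (hY : SmoothOn Y U) :
    SmoothOn (fun y => torsionAt g τ y (X y) (Y y)) U := by
  refine smoothOn_of_contDiffAt_rep hU fun p z hz hzU => ?_
  set L := localGeometry g hτ p
  have hrep : rep p (fun y => torsionAt g τ y (X y) (Y y))
      =ᶠ[𝓝 z] fun y => L.tor y (rep p X y) (rep p Y y) :=
    rep_eventuallyEq hz hU hzU fun y hy _ => coframe_torsionAt hτ hy _ _
  exact (((L.contDiffAt_of_domain L.contDiffOn_tor hz).clm_apply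
    (contDiffAt_rep hz hU hzU hX)).clm_apply (contDiffAt_rep hz hU hzU hY)).congr_of_eventuallyEq
      hrep

lemma smoothOn_casimirAt (hτ : IsThreeForm τ) {U : Set M} (hU : IsOpen U) {Y : VField n M}
    (hY : SmoothOn Y U) : SmoothOn (fun y => casimirAt g τ y (Y y)) U := by
  refine smoothOn_of_contDiffAt_rep hU fun p z hz hzU => ?_
  set L := localGeometry g hτ p
  have hrep : rep p (fun y => casimirAt g τ y (Y y))
      =ᶠ[𝓝 z] fun y => L.casimir y (rep p Y y) :=
    rep_eventuallyEq hz hU hzU fun y hy _ => coframe_casimirAt hτ hy _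
  exact ((L.contDiffAt_of_domain L.contDiffOn_casimir hz).clm_apply
    (contDiffAt_rep hz hU hzU hY)).congr_of_eventuallyEq hrep

lemma casimirAt_connection_of_eigen (hτ : IsParallelSkewTorsion g τ) {U : Set M} (hU : IsOpen U)
    {x : M} (hx : x ∈ U) {Y : VField n M} (hY : SmoothOn Y U) {a : ℝ}
    (h : ∀ y ∈ U, casimirAt g τ y (Y y) = a • Y y) (v : TangentSpace (𝓡 n) x) :
    casimirAt g τ x (connection g τ Y x v) = a • connection g τ Y x v := by
  rw [← connection_casimirAt hU hx hτ hY v (smoothOn_casimirAt hτ.threeForm hU hY),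
    ← connection_const_smul hU hx hτ.threeForm hY]
  exact connection_congr hU hx hτ.threeForm (ContMDiffOn.const_smul_section hY) h v

lemma isLocallyConstant_trace_casimirAt_pow (hτ : IsParallelSkewTorsion g τ) (k : ℕ) :
    IsLocallyConstant fun x : M => LinearMap.trace ℝ _ (casimirAt g τ x ^ k) := by
  rw [IsLocallyConstant.iff_eventually_eq]
  intro x
  set L := localGeometry g hτ.threeForm x
  set f : Coord n → ℝ := fun z => traceL (Coord n) (L.casimir z ^ k)
  have hxs : x ∈ (extChartAt (𝓡 n) x).source := mem_extChartAt_source x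
  have hcenter : extChartAt (𝓡 n) x x ∈ chartRange n x := (extChartAt (𝓡 n) x).map_source hxs
  have hdiff : DifferentiableOn ℝ f (chartRange n x) := fun z hz =>
    ((traceL (Coord n)).differentiableAt.comp z
      ((L.differentiableAt_casimir hz).fun_pow k)).differentiableWithinAt
  obtain ⟨ε, hε, hball⟩ := Metric.isOpen_iff.mp (isOpen_chartRange n x) _ hcenter
  have hconst : ∀ z ∈ Metric.ball (extChartAt (𝓡 n) x x) ε, f z = f (extChartAt (𝓡 n) x x) := by
    intro z hz
    refine (convex_ball _ ε).is_const_of_fderivWithin_eq_zero (𝕜 := ℝ) (hdiff.mono hball)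
      (fun y hy => ?_) hz (Metric.mem_ball_self hε)
    rw [fderivWithin_of_isOpen Metric.isOpen_ball hy]
    exact (hτ.isParallel x).fderiv_trace_casimir_pow (hball hy) k
  have hval (y : M) (hy : y ∈ chartDomain n x) :
      LinearMap.trace ℝ _ (casimirAt g τ y ^ k) = f (extChartAt (𝓡 n) x y) := by
    rw [chartDomain_eq] at hy
    have htrace := trace_casimirAt_pow (g := g) hτ.threeForm ((extChartAt (𝓡 n) x).map_source hy) k
    rwa [show chartInv x (extChartAt (𝓡 n) x y) = y from (extChartAt (𝓡 n) x).left_inv hy]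
      at htrace
  filter_upwards [(isOpen_chartDomain n x).mem_nhds (mem_chartDomain n x),
    (continuousAt_extChartAt (I := 𝓡 n) x).preimage_mem_nhds (Metric.ball_mem_nhds _ hε)]
    with y hy hyb
  rw [hval y hy, hval x (mem_chartDomain n x), hconst _ hyb]

lemma exists_curvature (hτ : IsParallelSkewTorsion g τ) (x : M) :
    ∃ R : TangentSpace (𝓡 n) x → TangentSpace (𝓡 n) x → Module.End ℝ (TangentSpace (𝓡 n) x),
      (∀ u v, R u v = -R v u) ∧ (∀ u v, (torsionSpace g hτ.threeForm x).IsStab (R u v)) ∧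
      ∀ u v w, R u v w + R v w u + R w u v
        = (4 : ℝ) • (torsionAt g τ x (torsionAt g τ x u v) w
          + torsionAt g τ x (torsionAt g τ x v w) u + torsionAt g τ x (torsionAt g τ x w u) v) := by
  obtain ⟨p, z, hz, rfl⟩ := exists_chartInv (n := n) x
  have hτ' := hτ.threeForm
  set L := localGeometry g hτ' p
  let R (u v : TangentSpace (𝓡 n) (chartInv p z)) :
      Module.End ℝ (TangentSpace (𝓡 n) (chartInv p z)) :=
    (coframeEquiv (chartInv_mem hz)).symm.conj
      (curvature L.chris z (coframe p _ u) (coframe p _ v)).toLinearMap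
  have hR (u v w : TangentSpace (𝓡 n) (chartInv p z)) : coframe p _ (R u v w)
      = curvature L.chris z (coframe p _ u) (coframe p _ v) (coframe p _ w) :=
    coframe_frame (chartInv_mem hz) _
  refine ⟨R, fun u v => ?_, fun u v => ⟨fun w y => ?_, fun a b => ?_⟩, fun u v w => ?_⟩
  · ext w
    apply coframe_injective hz
    rw [hR, LinearMap.neg_apply, map_neg, hR, curvature_swap, neg_apply]
  · change g.inner _ _ _ = -g.inner _ _ _
    rw [← coordMetric_coframe hz, ← coordMetric_coframe hz, hR, hR]
    exact eq_neg_of_add_eq_zero_left (L.metric_curvature_skew hz _ _ _ _)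
  · change R u v (torsionAt g τ _ a b) = torsionAt g τ _ _ _ + torsionAt g τ _ _ _
    apply coframe_injective hz
    rw [hR, map_add, coframe_torsionAt hτ' hz, coframe_torsionAt hτ' hz, coframe_torsionAt hτ' hz,
      hR, hR, (hτ.isParallel p).curvature_tor hz]
  · apply coframe_injective hz
    simp only [map_add, map_smul, hR, coframe_torsionAt hτ' hz]
    exact (hτ.isParallel p).bianchi hz _ _ _

end Connection

section Alternative

variable {n : ℕ} {M : Type*} [TopologicalSpace M] [ChartedSpace (EuclideanSpace ℝ (Fin n)) M]

/-! ## The global alternative -/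

variable (M) in
lemma finrank_tangentSpace (x : M) : Module.finrank ℝ (TangentSpace (𝓡 n) x) = n :=
  finrank_euclideanSpace_fin (𝕜 := ℝ) (n := n)

variable [IsManifold (𝓡 n) ∞ M] {g : Metric n M} {τ : TriForm n M}

/-- `ξ` is a unit vector spanning the vertical space, and the Casimir endomorphism is `a` on `ξ`
and `β` on its complement. -/
structure IsVerticalAt (g : Metric n M) (hτ : IsThreeForm τ) (x : M) (a β : ℝ)
    (ξ : TangentSpace (𝓡 n) x) : Prop where
  isVertical : (torsionSpace g hτ x).IsVertical (stab g τ x) ξ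
  casimir_self : casimirAt g τ x ξ = a • ξ
  casimir_of_orthogonal : ∀ v, g.inner x ξ v = 0 → casimirAt g τ x v = β • v

lemma exists_isVerticalAt (hτ : IsParallelSkewTorsion g τ) (x : M)
    (hirr : IsAlmostIrreducible (fun v w => g.inner x v w) (stab g τ x)) :
    (∃ (ξ : TangentSpace (𝓡 n) x) (β : ℝ), 0 < β ∧ torsionAt g τ x ξ = 0 ∧
      IsVerticalAt g hτ.threeForm x 0 β ξ) ∨
    ∃ (ξ : TangentSpace (𝓡 n) x) (μ : ℝ), n ≠ 3 ∧ (torsionSpace g hτ.threeForm x).IsContact ξ μ ∧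
      IsVerticalAt g hτ.threeForm x ((n - 1 : ℝ) * μ) (2 * μ) ξ := by
  have hstab := mem_stab_iff (g := g) hτ.threeForm x
  obtain ⟨ξ, hξ⟩ := TorsionSpace.exists_isVertical (P := torsionSpace g hτ.threeForm x)
    (𝔤 := stab g τ x) (fun A hA => ((hstab A).mp hA).1) hirr
  obtain ⟨R, hR, hRstab, hbianchi⟩ := exists_curvature hτ x
  have hξstab := TorsionSpace.isStab_t_of_curvature hR hRstab hbianchi
    fun u v => hξ.annihilates _ ((hstab _).mpr (hRstab u v))
  rcases hξ.casimir_dichotomy hstab hξstab (inner_casimirAt x) with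
    ⟨hτξ, hSξ, β, hβ, hS⟩ | ⟨μ, hcontact, hn, hSξ, hS⟩
  · exact Or.inl ⟨ξ, β, hβ, hτξ, hξ, by rw [hSξ, zero_smul], hS⟩
  · rw [finrank_tangentSpace] at hn hSξ
    exact Or.inr ⟨ξ, μ, hn, hcontact, hξ, hSξ, hS⟩

/-- The first trace forces `β = 3 * μ`, whereupon the third would make `19` a square. -/
lemma mul_pow_three_ne_of_mul_eq {N : ℕ} (hN : 0 < N) {β μ : ℝ} (hμ : 0 < μ)
    (h : N * β = N * μ + N * (2 * μ)) : N * β ^ 3 ≠ (N * μ) ^ 3 + N * (2 * μ) ^ 3 := by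
  intro hcube
  have hN' : (0 : ℝ) < N := by exact_mod_cast hN
  obtain rfl : β = 3 * μ := mul_left_cancel₀ hN'.ne' (by linarith)
  have hsq : (N : ℝ) ^ 2 = 19 :=
    mul_left_cancel₀ (by positivity : (N : ℝ) * μ ^ 3 ≠ 0) (by linear_combination -hcube)
  have hsq' : N ^ 2 = 19 := by exact_mod_cast hsq
  rcases le_or_gt N 4 with hle | hlt <;> nlinarith

namespace IsVerticalAt

variable {hτ : IsThreeForm τ} {a β : ℝ}

section Point

variable {x : M} {ξ : TangentSpace (𝓡 n) x} (h : IsVerticalAt g hτ x a β ξ)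

include h

lemma unit : g.inner x ξ ξ = 1 := h.isVertical.unit

lemma inner_sub_smul (v : TangentSpace (𝓡 n) x) : g.inner x ξ (v - g.inner x ξ v • ξ) = 0 :=
  (torsionSpace g hτ x).b_sub_smul h.unit v

lemma one_lt : 1 < n := by
  obtain ⟨v, hv, hξv⟩ := h.isVertical.ne_bot
  replace hξv : g.inner x ξ v = 0 := hξv
  have hindep : LinearIndependent ℝ ![ξ, v] := by
    refine LinearIndependent.pair_iff.mpr fun c d hcd => ?_
    have hc : c = 0 := by
      have hinner : g.inner x ξ (c • ξ + d • v) = 0 := by rw [hcd, map_zero]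
      rwa [inner_add_right, inner_smul_right, inner_smul_right, h.unit, hξv, mul_one, mul_zero,
        add_zero] at hinner
    rw [hc, zero_smul, zero_add] at hcd
    exact ⟨hc, (smul_eq_zero.mp hcd).resolve_right hv⟩
  have hcard := hindep.fintype_card_le_finrank
  rw [finrank_tangentSpace, Fintype.card_fin] at hcard
  omega

lemma trace_pow (k : ℕ) :
    LinearMap.trace ℝ _ (casimirAt g τ x ^ k) = a ^ k + (n - 1 : ℝ) * β ^ k := by
  have htrace := TorsionSpace.trace_pow_of_eigen (P := torsionSpace g hτ x)
    (S := casimirAt g τ x) h.unit h.casimir_self h.casimir_of_orthogonal k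
  rwa [finrank_tangentSpace] at htrace

lemma casimirAt_apply (v : TangentSpace (𝓡 n) x) :
    casimirAt g τ x v = β • v + ((a - β) * g.inner x ξ v) • ξ := by
  have hv := h.casimir_of_orthogonal _ (h.inner_sub_smul v)
  rw [map_sub, map_smul, h.casimir_self, sub_eq_iff_eq_add] at hv
  rw [hv]
  module

lemma eq_smul_of_eigen (hab : a ≠ β) {v : TangentSpace (𝓡 n) x}
    (hv : casimirAt g τ x v = a • v) : v = g.inner x ξ v • ξ := by
  rw [h.casimirAt_apply] at hv
  refine smul_right_injective _ (sub_ne_zero.mpr hab) ?_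
  change (a - β) • v = (a - β) • (g.inner x ξ v • ξ)
  rw [smul_smul, sub_smul, ← hv, add_sub_cancel_left]

lemma inner_eq_zero_of_eigen (hab : a ≠ β) {v : TangentSpace (𝓡 n) x}
    (hv : casimirAt g τ x v = β • v) : g.inner x ξ v = 0 := by
  rw [h.casimirAt_apply, add_eq_left] at hv
  have hmul := (smul_eq_zero.mp hv).resolve_right h.isVertical.ne_zero
  exact (mul_eq_zero.mp hmul).resolve_left (sub_ne_zero.mpr hab)

lemma casimirAt_casimirAt (v : TangentSpace (𝓡 n) x) :
    casimirAt g τ x (casimirAt g τ x v) = (a + β) • casimirAt g τ x v - (a * β) • v := by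
  rw [h.casimirAt_apply v, map_add, map_smul, map_smul, h.casimir_self, h.casimirAt_apply v]
  module

lemma eigenspace_sup_eigenspace :
    Module.End.eigenspace (casimirAt g τ x) a ⊔ Module.End.eigenspace (casimirAt g τ x) β = ⊤ := by
  refine eq_top_iff.mpr fun v _ => ?_
  rw [← add_sub_cancel (g.inner x ξ v • ξ) v]
  refine Submodule.add_mem_sup (Module.End.mem_eigenspace_iff.mpr ?_)
    (Module.End.mem_eigenspace_iff.mpr (h.casimir_of_orthogonal _ (h.inner_sub_smul v)))
  rw [map_smul, h.casimir_self, smul_comm]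

lemma finrank_eigenspace_left (hab : a ≠ β) :
    Module.finrank ℝ (Module.End.eigenspace (casimirAt g τ x) a) = 1 := by
  have hspan : Module.End.eigenspace (casimirAt g τ x) a = Submodule.span ℝ {ξ} := by
    ext v
    rw [Module.End.mem_eigenspace_iff, Submodule.mem_span_singleton]
    refine ⟨fun hv => ⟨_, (h.eq_smul_of_eigen hab hv).symm⟩, ?_⟩
    rintro ⟨c, rfl⟩
    rw [map_smul, h.casimir_self, smul_comm]
  rw [hspan, finrank_span_singleton h.isVertical.ne_zero]

lemma finrank_eigenspace_right (hab : a ≠ β) :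
    Module.finrank ℝ (Module.End.eigenspace (casimirAt g τ x) β) = n - 1 := by
  have hsum := Submodule.finrank_sup_add_finrank_inf_eq
    (Module.End.eigenspace (casimirAt g τ x) a) (Module.End.eigenspace (casimirAt g τ x) β)
  rw [h.eigenspace_sup_eigenspace, finrank_top, h.finrank_eigenspace_left hab,
    finrank_tangentSpace, (Module.End.disjoint_genEigenspace _ hab 1 1).eq_bot, finrank_bot] at hsum
  omega

end Point

section Connected

variable [ConnectedSpace M]

lemma pow_add_eq_pow_add (hτ : IsParallelSkewTorsion g τ) {x y : M} {a' β' : ℝ}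
    {ξ : TangentSpace (𝓡 n) x} {ζ : TangentSpace (𝓡 n) y}
    (h : IsVerticalAt g hτ.threeForm x a β ξ) (h' : IsVerticalAt g hτ.threeForm y a' β' ζ)
    (k : ℕ) : a ^ k + (n - 1 : ℝ) * β ^ k = a' ^ k + (n - 1 : ℝ) * β' ^ k := by
  rw [← h.trace_pow, ← h'.trace_pow]
  exact (isLocallyConstant_trace_casimirAt_pow hτ k).apply_eq_of_isPreconnected
    isPreconnected_univ (Set.mem_univ x) (Set.mem_univ y)

lemma not_isVerticalAt_of_zero (hτ : IsParallelSkewTorsion g τ) {x y : M} {μ : ℝ} (hμ : 0 < μ)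
    {ξ : TangentSpace (𝓡 n) x} (h : IsVerticalAt g hτ.threeForm x 0 β ξ)
    (ζ : TangentSpace (𝓡 n) y) :
    ¬IsVerticalAt g hτ.threeForm y ((n - 1 : ℝ) * μ) (2 * μ) ζ := by
  intro h'
  have hlinear := h.pow_add_eq_pow_add hτ h' 1
  have hcubic := h.pow_add_eq_pow_add hτ h' 3
  rw [← Nat.cast_pred (zero_lt_one.trans h.one_lt)] at hlinear hcubic
  refine mul_pow_three_ne_of_mul_eq (Nat.sub_pos_of_lt h.one_lt) hμ (β := β) ?_ ?_
  · simpa only [pow_one, zero_add] using hlinear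
  · simpa only [zero_pow three_ne_zero, zero_add] using hcubic

end Connected

end IsVerticalAt

theorem exists_forall_isVerticalAt [ConnectedSpace M] (hτ : IsParallelSkewTorsion g τ)
    (hirr : ∀ x : M, IsAlmostIrreducible (fun v w => g.inner x v w) (stab g τ x)) :
    (∃ β : ℝ, 0 < β ∧ ∀ x, ∃ ξ : TangentSpace (𝓡 n) x, torsionAt g τ x ξ = 0 ∧
      IsVerticalAt g hτ.threeForm x 0 β ξ) ∨
    ∃ μ : ℝ, 0 < μ ∧ n ≠ 3 ∧ ∀ x, ∃ ξ : TangentSpace (𝓡 n) x,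
      (torsionSpace g hτ.threeForm x).IsContact ξ μ ∧
      IsVerticalAt g hτ.threeForm x ((n - 1 : ℝ) * μ) (2 * μ) ξ := by
  obtain ⟨x₀⟩ : Nonempty M := inferInstance
  rcases exists_isVerticalAt hτ x₀ (hirr x₀) with ⟨ξ, β, hβ, -, hξ⟩ | ⟨ξ, μ, hn, hcontact, hξ⟩
  all_goals have hdim : (n : ℝ) - 1 ≠ 0 := (sub_pos.mpr (by exact_mod_cast hξ.one_lt)).ne'
  · refine Or.inl ⟨β, hβ, fun x => ?_⟩
    rcases exists_isVerticalAt hτ x (hirr x) with ⟨ζ, β', -, hτζ, hζ⟩ | ⟨ζ, μ, -, hcontact, hζ⟩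
    · obtain rfl : β' = β :=
        mul_left_cancel₀ hdim (by linarith [hζ.pow_add_eq_pow_add hτ hξ 1])
      exact ⟨ζ, hτζ, hζ⟩
    · exact (hξ.not_isVerticalAt_of_zero hτ hcontact.pos ζ hζ).elim
  · refine Or.inr ⟨μ, hcontact.pos, hn, fun x => ?_⟩
    rcases exists_isVerticalAt hτ x (hirr x) with ⟨ζ, β, -, -, hζ⟩ | ⟨ζ, μ', -, hcontact', hζ⟩
    · exact (hζ.not_isVerticalAt_of_zero hτ hcontact.pos ξ hξ).elim
    · obtain rfl : μ' = μ :=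
        mul_left_cancel₀ hdim (by linarith [hζ.pow_add_eq_pow_add hτ hξ 1])
      exact ⟨ζ, hcontact', hζ⟩

/-! ## Eigenfields of the Casimir endomorphism -/

section Eigenfields

variable {a β : ℝ} (hτ : IsThreeForm τ) (hab : a ≠ β)
  (hquad : ∀ (x : M) (v : TangentSpace (𝓡 n) x),
    casimirAt g τ x (casimirAt g τ x v) = (a + β) • casimirAt g τ x v - (a * β) • v)

include hτ hab hquad

lemma exists_eigenfield (p : M) {v : TangentSpace (𝓡 n) p} (hv : casimirAt g τ p v = a • v) :
    ∃ Y : VField n M, SmoothOn Y (chartDomain n p) ∧ Y p = v ∧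
      ∀ x, casimirAt g τ x (Y x) = a • Y x := by
  let C := coordField p (coframe p p v)
  have hC : SmoothOn C (chartDomain n p) := smoothOn_coordField p _
  have hCp : C p = v := frame_coframe (mem_chartDomain n p) v
  -- `(a - β)⁻¹ • (S - β)` is the projection onto the eigenspace of `a`.
  have hproj : SmoothOn (fun x => (a - β)⁻¹ • (casimirAt g τ x (C x) - β • C x))
      (chartDomain n p) :=
    ContMDiffOn.const_smul_section (ContMDiffOn.sub_section
      (smoothOn_casimirAt hτ (isOpen_chartDomain n p) hC) (ContMDiffOn.const_smul_section hC))
  refine ⟨_, hproj, ?_, fun x => ?_⟩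
  · rw [hCp, hv, ← sub_smul, smul_smul, inv_mul_cancel₀ (sub_ne_zero.mpr hab), one_smul]
  · rw [map_smul, map_sub, map_smul, hquad]
    module

lemma isSmoothDistribution_eigenspace (k : ℕ)
    (hk : ∀ x : M, Module.finrank ℝ (Module.End.eigenspace (casimirAt g τ x) a) = k) :
    IsSmoothDistribution fun x : M => Module.End.eigenspace (casimirAt g τ x) a := by
  intro p
  let basis := Module.finBasisOfFinrankEq ℝ (Module.End.eigenspace (casimirAt g τ p) a) (hk p)
  choose Y hY hYp hYeigen using fun i => exists_eigenfield hτ hab hquad p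
    (Module.End.mem_eigenspace_iff.mp (basis i).2)
  let F : M → Fin k → Coord n := fun x i => coframe p x (Y i x)
  have hF : ContinuousOn F (chartDomain n p) := continuousOn_pi.mpr fun i =>
    ((smoothOn_iff (isOpen_chartDomain n p) subset_rfl (Y i)).mp (hY i)).continuousOn
  have hindep (x : M) (hx : x ∈ chartDomain n p) :
      LinearIndependent ℝ (F x) ↔ LinearIndependent ℝ fun i => Y i x :=
    (coframeEquiv hx).toLinearMap.linearIndependent_iff (LinearEquiv.ker _)
  refine ⟨chartDomain n p ∩ F ⁻¹' {f | LinearIndependent ℝ f},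
    hF.isOpen_inter_preimage (isOpen_chartDomain n p) isOpen_setOfPred_linearIndependent,
    ⟨mem_chartDomain n p, ?_⟩, k, Y, fun i => (hY i).mono Set.inter_subset_left, ?_⟩
  · change LinearIndependent ℝ (F p)
    rw [hindep p (mem_chartDomain n p)]
    simp_rw [hYp]
    exact basis.linearIndependent.map' (Submodule.subtype _) (Submodule.ker_subtype _)
  · rintro x ⟨hx, hxF⟩
    have hYindep := (hindep x hx).mp hxF
    refine ⟨hYindep, (Submodule.eq_of_le_of_finrank_eq ?_ ?_).symm⟩
    · rw [Submodule.span_le]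
      rintro _ ⟨i, rfl⟩
      exact Module.End.mem_eigenspace_iff.mpr (hYeigen i x)
    · rw [finrank_span_eq_card hYindep, hk x, Fintype.card_fin]

end Eigenfields

lemma isParallelDistribution_eigenspace (hτ : IsParallelSkewTorsion g τ) (a : ℝ) :
    IsParallelDistribution g τ fun x : M => Module.End.eigenspace (casimirAt g τ x) a :=
  fun _ _ hU hY hYmem _ hx v => Module.End.mem_eigenspace_iff.mpr
    (casimirAt_connection_of_eigen hτ hU hx hY
      (fun y hy => Module.End.mem_eigenspace_iff.mp (hYmem y hy)) v)

theorem hasLocalOneDimFactor (hτ : IsParallelSkewTorsion g τ) {β : ℝ} (hβ : 0 < β)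
    (h : ∀ x, ∃ ξ : TangentSpace (𝓡 n) x, torsionAt g τ x ξ = 0 ∧
      IsVerticalAt g hτ.threeForm x 0 β ξ) : HasLocalOneDimFactor g τ := by
  choose ξ hτξ hξ using h
  have hquad (x : M) := (hξ x).casimirAt_casimirAt
  have hquad' (x : M) (v : TangentSpace (𝓡 n) x) : casimirAt g τ x (casimirAt g τ x v)
      = (β + 0) • casimirAt g τ x v - (β * 0) • v := by
    rw [hquad, add_comm, mul_comm]
  have hrank (x : M) := (hξ x).finrank_eigenspace_left hβ.ne
  have hrank' (x : M) := (hξ x).finrank_eigenspace_right hβ.ne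
  refine ⟨fun x => Module.End.eigenspace (casimirAt g τ x) 0,
    fun x => Module.End.eigenspace (casimirAt g τ x) β, ?_, hrank⟩
  refine
    { smooth₁ := isSmoothDistribution_eigenspace hτ.threeForm hβ.ne hquad 1 hrank
      smooth₂ := isSmoothDistribution_eigenspace hτ.threeForm hβ.ne' hquad' (n - 1) hrank'
      nontrivial₁ := fun x => Submodule.one_le_finrank_iff.mp (hrank x).ge
      nontrivial₂ := fun x => Submodule.one_le_finrank_iff.mp
        ((hrank' x).symm ▸ Nat.le_sub_one_of_lt (hξ x).one_lt)
      sup_eq := fun x => (hξ x).eigenspace_sup_eigenspace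
      orthogonal := fun x v hv w hw => ?_
      parallel₁ := isParallelDistribution_eigenspace hτ 0
      parallel₂ := isParallelDistribution_eigenspace hτ β
      torsion := fun x v hv w _ z => ?_ }
  · rw [(hξ x).eq_smul_of_eigen hβ.ne (Module.End.mem_eigenspace_iff.mp hv), inner_smul_left,
      (hξ x).inner_eq_zero_of_eigen hβ.ne (Module.End.mem_eigenspace_iff.mp hw), mul_zero]
  · rw [← inner_torsionAt (g := g),
      (hξ x).eq_smul_of_eigen hβ.ne (Module.End.mem_eigenspace_iff.mp hv), map_smul, hτξ,
      smul_zero, LinearMap.zero_apply, map_zero]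
    rfl

end Alternative

section Rescaling

variable {n : ℕ} {M : Type*} [TopologicalSpace M] [ChartedSpace (EuclideanSpace ℝ (Fin n)) M]

/-! ## Rescaling -/

lemma dirDeriv_const_mul {f : M → ℝ} {x : M} (hf : MDifferentiableAt (𝓡 n) 𝓘(ℝ, ℝ) f x) (c : ℝ)
    (v : TangentSpace (𝓡 n) x) : dirDeriv (fun y => c * f y) x v = c * dirDeriv f x v := by
  have hmul := mvfderiv_mul (mdifferentiableAt_const (c := c)) hf
  rw [mvfderiv_const, smul_zero, add_zero] at hmul
  exact congrArg (fun L => L v) hmul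

lemma dirDeriv_eq_zero_of_eqOn_const {f : M → ℝ} {U : Set M} (hU : IsOpen U) {x : M} (hx : x ∈ U)
    {c : ℝ} (h : ∀ y ∈ U, f y = c) (v : TangentSpace (𝓡 n) x) : dirDeriv f x v = 0 := by
  have hf : f =ᶠ[𝓝 x] fun _ => c := Filter.eventually_of_mem (hU.mem_nhds hx) h
  change mfderiv (𝓡 n) 𝓘(ℝ, ℝ) f x v = 0
  rw [hf.mfderiv_eq, mfderiv_const]
  rfl

variable [IsManifold (𝓡 n) ∞ M] {g : Metric n M} {τ : TriForm n M} (c : ℝ) (hc : c ≠ 0)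

lemma rescale_inner (x : M) (v w : TangentSpace (𝓡 n) x) :
    (rescale g c hc).inner x v w = c ^ 2 * g.inner x v w := rfl

section

variable {U : Set M} (hU : IsOpen U) {x : M} (hx : x ∈ U) {X Y : VField n M}

include hU hx

lemma dirDeriv_inner_rescale (hX : SmoothOn X U) (hY : SmoothOn Y U) (v : TangentSpace (𝓡 n) x) :
    dirDeriv (fun y => (rescale g c hc).inner y (X y) (Y y)) x v
      = c ^ 2 * dirDeriv (fun y => g.inner y (X y) (Y y)) x v :=
  dirDeriv_const_mul (((contMDiffOn_inner g le_rfl hX hY).contMDiffAt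
    (hU.mem_nhds hx)).mdifferentiableAt (by simp)) _ v

lemma leviCivita_rescale (hY : SmoothOn Y U) (v : TangentSpace (𝓡 n) x) :
    leviCivita (rescale g c hc) Y x v = leviCivita g Y x v := by
  have hopen := hU.inter (isOpen_chartDomain n x)
  have hmem : x ∈ U ∩ chartDomain n x := ⟨hx, mem_chartDomain n x⟩
  have hY' := hY.mono (Set.inter_subset_left (t := chartDomain n x))
  have hext (w : TangentSpace (𝓡 n) x) := (smoothOn_ext w).mono (Set.inter_subset_right (s := U))
  have hkoszul (u : TangentSpace (𝓡 n) x) : koszul (rescale g c hc) (ext v) Y (ext u) x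
      = c ^ 2 * koszul g (ext v) Y (ext u) x := by
    rw [koszul, koszul, dirDeriv_inner_rescale c hc hopen hmem hY' (hext u),
      dirDeriv_inner_rescale c hc hopen hmem (hext v) (hext u),
      dirDeriv_inner_rescale c hc hopen hmem (hext v) hY']
    simp only [rescale_inner]
    ring
  rw [leviCivita, leviCivita, sharp, sharp]
  congr 1
  funext w
  refine propext (forall_congr' fun u => ?_)
  rw [rescale_inner, hkoszul, mul_div_assoc]
  exact mul_right_inj' (pow_ne_zero 2 hc)

end

lemma IsThreeForm.rescale (hτ : IsThreeForm τ) : IsThreeForm fun x => c ^ 2 • τ x where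
  alt_left x u w := by
    rw [LinearMap.smul_apply, LinearMap.smul_apply, LinearMap.smul_apply, hτ.alt_left, smul_zero]
  alt_right x u w := by
    rw [LinearMap.smul_apply, LinearMap.smul_apply, LinearMap.smul_apply, hτ.alt_right, smul_zero]
  smooth U X Y Z hU hX hY hZ := contMDiffOn_const.mul (hτ.smooth U X Y Z hU hX hY hZ)

lemma torsionAt_rescale (x : M) (u v : TangentSpace (𝓡 n) x) :
    torsionAt (rescale g c hc) (fun y => c ^ 2 • τ y) x u v = torsionAt g τ x u v :=
  sharp_inner _ fun w => by rw [rescale_inner, inner_torsionAt]; rfl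

lemma connection_rescale {U : Set M} (hU : IsOpen U) {x : M} (hx : x ∈ U) {Y : VField n M}
    (hY : SmoothOn Y U) (v : TangentSpace (𝓡 n) x) :
    connection (rescale g c hc) (fun y => c ^ 2 • τ y) Y x v = connection g τ Y x v := by
  rw [connection_eq, connection_eq, leviCivita_rescale c hc hU hx hY, torsionAt_rescale]

lemma IsParallelSkewTorsion.rescale (hτ : IsParallelSkewTorsion g τ) :
    IsParallelSkewTorsion (rescale g c hc) fun x => c ^ 2 • τ x where
  threeForm := hτ.threeForm.rescale c
  parallel U X Y Z hU hX hY hZ x hx v := by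
    have hparallel := hτ.parallel U X Y Z hU hX hY hZ x hx v
    have hdiff := ((hτ.threeForm.smooth U X Y Z hU hX hY hZ).contMDiffAt
      (hU.mem_nhds hx)).mdifferentiableAt (by simp)
    rw [connection_rescale c hc hU hx hX, connection_rescale c hc hU hx hY,
      connection_rescale c hc hU hx hZ]
    simp only [LinearMap.smul_apply, smul_eq_mul]
    rw [dirDeriv_const_mul hdiff]
    linear_combination c ^ 2 * hparallel

lemma isContact_rescale (hτ : IsThreeForm τ) {x : M} {ξ : TangentSpace (𝓡 n) x}
    (h : (torsionSpace g hτ x).IsContact ξ (c ^ 2)) :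
    (torsionSpace (rescale g c hc) (hτ.rescale c) x).IsContact (c⁻¹ • ξ) 1 where
  unit := by
    have hunit : g.inner x ξ ξ = 1 := h.unit
    change (rescale g c hc).inner x (c⁻¹ • ξ) (c⁻¹ • ξ) = 1
    rw [rescale_inner, inner_smul_left, inner_smul_right, hunit]
    field_simp
  pos := one_pos
  sq v := by
    have hsq : torsionAt g τ x ξ (torsionAt g τ x ξ v)
      = -c ^ 2 • v + (c ^ 2 * g.inner x ξ v) • ξ := h.sq v
    change torsionAt (rescale g c hc) _ x (c⁻¹ • ξ) (torsionAt (rescale g c hc) _ x (c⁻¹ • ξ) v)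
      = (-1 : ℝ) • v + (1 * (rescale g c hc).inner x (c⁻¹ • ξ) v) • c⁻¹ • ξ
    rw [torsionAt_rescale, torsionAt_rescale, rescale_inner, inner_smul_left]
    simp only [map_smul, LinearMap.smul_apply]
    rw [hsq]
    match_scalars <;> field_simp
  t_eq u v := by
    have ht : torsionAt g τ x u v = g.inner x ξ u • torsionAt g τ x ξ v
      - g.inner x ξ v • torsionAt g τ x ξ u + g.inner x (torsionAt g τ x ξ u) v • ξ := h.t_eq u v
    change torsionAt (rescale g c hc) _ x u v
      = (rescale g c hc).inner x (c⁻¹ • ξ) u • torsionAt (rescale g c hc) _ x (c⁻¹ • ξ) v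
        - (rescale g c hc).inner x (c⁻¹ • ξ) v • torsionAt (rescale g c hc) _ x (c⁻¹ • ξ) u
        + (rescale g c hc).inner x (torsionAt (rescale g c hc) _ x (c⁻¹ • ξ) u) v • c⁻¹ • ξ
    simp only [torsionAt_rescale, rescale_inner, map_smul (torsionAt g τ x), LinearMap.smul_apply,
      inner_smul_left]
    rw [ht]
    match_scalars <;> field_simp

end Rescaling

section Sasaki

variable {n : ℕ} {M : Type*} [TopologicalSpace M] [ChartedSpace (EuclideanSpace ℝ (Fin n)) M]
  [IsManifold (𝓡 n) ∞ M] {g : Metric n M} {τ : TriForm n M}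

/-! ## Sasaki structures -/

lemma TorsionSpace.IsContact.commutator {V : Type*} [AddCommGroup V] [Module ℝ V]
    {P : TorsionSpace V} {ξ : V} {μ : ℝ} (h : P.IsContact ξ μ) (u v : V) :
    P.t ξ (P.t u v) - P.t u (P.t ξ v) = -(μ • (P.b u v • ξ - P.b ξ v • u)) := by
  have hJJ : P.b (P.t ξ u) (P.t ξ v) = μ * P.b u v - μ * P.b ξ u * P.b ξ v := by
    rw [P.skew, h.sq, map_add, map_smul, map_smul, P.symm u ξ, smul_eq_mul, smul_eq_mul]
    ring
  rw [h.t_eq u v, h.t_eq u (P.t ξ v), P.b_t_left, hJJ, map_add, map_sub, map_smul, map_smul,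
    map_smul, P.alt, h.sq u]
  module

section Parallel

variable {U : Set M} (hU : IsOpen U) {x : M} (hx : x ∈ U) {ξ X Y : VField n M}
  (hξ : SmoothOn ξ U) (hpar : ∀ v, connection g τ ξ x v = 0)

include hU hx hξ hpar

lemma dirDeriv_inner_of_connection_eq_zero (hτ : IsThreeForm τ) (hX : SmoothOn X U)
    (hY : SmoothOn Y U) : dirDeriv (fun y => g.inner y (X y) (Y y)) x (ξ x)
      = g.inner x (VectorField.mlieBracket (𝓡 n) ξ X x) (Y x)
        + g.inner x (X x) (VectorField.mlieBracket (𝓡 n) ξ Y x) := by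
  have hconnX := connection_sub_connection (g := g) hU hx hτ hξ hX
  have hconnY := connection_sub_connection (g := g) hU hx hτ hξ hY
  have hskew : g.inner x (torsionAt g τ x (ξ x) (X x)) (Y x)
      = -g.inner x (X x) (torsionAt g τ x (ξ x) (Y x)) := (torsionSpace g hτ x).skew _ _ _
  rw [hpar, sub_zero] at hconnX hconnY
  rw [dirDeriv_inner_eq hU hx hτ hX hY, hconnX, hconnY, inner_add_left, inner_add_right,
    inner_smul_left, inner_smul_right, hskew]
  ring

lemma exteriorDeriv_of_connection_eq_zero (hτ : IsThreeForm τ) (hX : SmoothOn X U)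
    (hY : SmoothOn Y U) : dirDeriv (fun y => g.inner y (ξ y) (Y y)) x (X x)
      - dirDeriv (fun y => g.inner y (ξ y) (X y)) x (Y x)
      - g.inner x (ξ x) (VectorField.mlieBracket (𝓡 n) X Y x)
      = 2 * g.inner x (torsionAt g τ x (ξ x) (X x)) (Y x) := by
  have hconn := congrArg (g.inner x (ξ x)) (connection_sub_connection (g := g) hU hx hτ hX hY)
  have hcyclic : g.inner x (torsionAt g τ x (ξ x) (X x)) (Y x)
      = g.inner x (torsionAt g τ x (X x) (Y x)) (ξ x) := (torsionSpace g hτ x).b_t_cyclic _ _ _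
  rw [inner_sub_right, inner_add_right, inner_smul_right, g.symm x (ξ x) (torsionAt g τ x _ _),
    ← hcyclic] at hconn
  rw [dirDeriv_inner_eq hU hx hτ hξ hY, dirDeriv_inner_eq hU hx hτ hξ hX, hpar, hpar]
  simp only [map_zero, zero_apply]
  linear_combination hconn

lemma leviCivita_torsionAt_of_connection_eq_zero (hτ : IsParallelSkewTorsion g τ)
    (hY : SmoothOn Y U) (v : TangentSpace (𝓡 n) x) :
    leviCivita g (fun y => torsionAt g τ y (ξ y) (Y y)) x v
      - torsionAt g τ x (ξ x) (leviCivita g Y x v)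
      = torsionAt g τ x (ξ x) (torsionAt g τ x v (Y x))
        - torsionAt g τ x v (torsionAt g τ x (ξ x) (Y x)) := by
  have hconn := connection_torsionAt hU hx hτ hξ hY v
    (smoothOn_torsionAt hτ.threeForm hU hξ hY)
  rw [hpar, map_zero, LinearMap.zero_apply, zero_add, connection_eq, connection_eq,
    map_add] at hconn
  rw [sub_eq_sub_iff_add_eq_add, hconn, add_comm]

end Parallel

variable {U : Set M} {ξ : VField n M}

lemma isSasakiOn_torsionAt (hτ : IsParallelSkewTorsion g τ) (hξ : SmoothOn ξ U)
    (hpar : ∀ x ∈ U, ∀ v, connection g τ ξ x v = 0)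
    (hcontact : ∀ x ∈ U, (torsionSpace g hτ.threeForm x).IsContact (ξ x) 1) :
    IsSasakiOn g U ξ fun x => torsionAt g τ x (ξ x) where
  smooth_xi := hξ
  smooth_phi W Y hW hWU hY := smoothOn_torsionAt hτ.threeForm hW (hξ.mono hWU) hY
  unit x hx := (hcontact x hx).unit
  killing W X Y hW hWU hX hY x hx := by
    rw [dirDeriv_inner_of_connection_eq_zero hW hx (hξ.mono hWU) (hpar x (hWU hx)) hτ.threeForm
      hX hY]
    ring
  skew x _ v w := (torsionSpace g hτ.threeForm x).skew (ξ x) v w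
  d_xi W X Y hW hWU hX hY x hx :=
    exteriorDeriv_of_connection_eq_zero hW hx (hξ.mono hWU) (hpar x (hWU hx)) hτ.threeForm hX hY
  phi_sq x hx v := by
    have hsq := (hcontact x hx).sq v
    rw [neg_one_smul, one_mul] at hsq
    exact hsq
  nabla_phi W Y hW hWU hY x hx v := by
    have hcomm := (hcontact x (hWU hx)).commutator v (Y x)
    rw [one_smul] at hcomm
    exact (leviCivita_torsionAt_of_connection_eq_zero hW hx (hξ.mono hWU) (hpar x (hWU hx)) hτ hY
      v).trans hcomm

lemma eq_xiWedgePhi_torsionAt (hτ : IsThreeForm τ) {x : M} {μ : ℝ}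
    (hcontact : (torsionSpace g hτ x).IsContact (ξ x) μ) (u v w : TangentSpace (𝓡 n) x) :
    τ x u v w = xiWedgePhi g ξ (fun y => torsionAt g τ y (ξ y)) x u v w := by
  have ht : torsionAt g τ x u v = g.inner x (ξ x) u • torsionAt g τ x (ξ x) v
      - g.inner x (ξ x) v • torsionAt g τ x (ξ x) u
      + g.inner x (torsionAt g τ x (ξ x) u) v • ξ x := hcontact.t_eq u v
  rw [← inner_torsionAt (g := g), ht, inner_add_left, inner_sub_left, inner_smul_left,
    inner_smul_left, inner_smul_left, xiWedgePhi, inner_torsionAt x (ξ x) u w,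
    inner_torsionAt x (ξ x) w u, hτ.swap_right x (ξ x) w u]
  ring

theorem isSasakianOn_rescale (hτ : IsParallelSkewTorsion g τ) (hU : IsOpen U)
    (hξ : SmoothOn ξ U) (hpar : ∀ x ∈ U, ∀ v, connection g τ ξ x v = 0) {c : ℝ} (hc : c ≠ 0)
    (hcontact : ∀ x ∈ U, (torsionSpace g hτ.threeForm x).IsContact (ξ x) (c ^ 2)) :
    IsSasakianOn (rescale g c hc) (fun x => c ^ 2 • τ x) U := by
  have hξ' : SmoothOn (fun x => c⁻¹ • ξ x) U := ContMDiffOn.const_smul_section hξ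
  have hcontact' := fun x hx => isContact_rescale c hc hτ.threeForm (hcontact x hx)
  refine ⟨_, _, isSasakiOn_torsionAt (hτ.rescale c hc) hξ' (fun x hx v => ?_) hcontact',
    fun x hx => eq_xiWedgePhi_torsionAt (g := rescale g c hc) (τ := fun x => c ^ 2 • τ x)
      (ξ := fun x => c⁻¹ • ξ x) (hτ.threeForm.rescale c) (hcontact' x hx)⟩
  rw [connection_rescale c hc hU hx hξ', connection_const_smul hU hx hτ.threeForm hξ,
    hpar x hx, smul_zero]

end Sasaki

section VerticalFields

variable {n : ℕ} {M : Type*} [TopologicalSpace M] [ChartedSpace (EuclideanSpace ℝ (Fin n)) M]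
  [IsManifold (𝓡 n) ∞ M] {g : Metric n M} {τ : TriForm n M}

/-! ## Vertical fields -/

section Eigenvectors

variable {hτ : IsThreeForm τ} {a β : ℝ} {x : M} {ξ v w : TangentSpace (𝓡 n) x}

lemma IsVerticalAt.eigen_eq_smul (h : IsVerticalAt g hτ x a β ξ) (hab : a ≠ β)
    (hunit : g.inner x v v = 1) (hv : casimirAt g τ x v = a • v)
    (hw : casimirAt g τ x w = a • w) : w = g.inner x v w • v := by
  have hvξ := h.eq_smul_of_eigen hab hv
  have hwξ := h.eq_smul_of_eigen hab hw
  set s := g.inner x ξ v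
  set r := g.inner x ξ w
  rw [hvξ, inner_smul_left, inner_smul_right, h.unit, mul_one] at hunit
  rw [hvξ, hwξ, inner_smul_left, inner_smul_right, h.unit, smul_smul]
  congr 1
  linear_combination -r * hunit

lemma IsVerticalAt.eq_or_eq_neg (h : IsVerticalAt g hτ x a β ξ) (hab : a ≠ β)
    (hunit : g.inner x v v = 1) (hv : casimirAt g τ x v = a • v) : v = ξ ∨ v = -ξ := by
  have hvξ := h.eigen_eq_smul hab h.unit h.casimir_self hv
  set s := g.inner x ξ v
  rw [hvξ, inner_smul_left, inner_smul_right, h.unit, mul_one] at hunit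
  rcases mul_self_eq_one_iff.mp hunit with hs | hs
  · exact Or.inl (by rw [hvξ, hs, one_smul])
  · exact Or.inr (by rw [hvξ, hs, neg_smul, one_smul])

lemma IsVerticalAt.casimirAt_of_isCanonicalSplitting (h : IsVerticalAt g hτ x a β ξ)
    {Hor : Submodule ℝ (TangentSpace (𝓡 n) x)}
    (hsplit : IsCanonicalSplitting (fun v w => g.inner x v w) (stab g τ x) Hor
      (Submodule.span ℝ {v})) : casimirAt g τ x v = a • v := by
  have hv := TorsionSpace.apply_eq_zero_of_isInvariant_span (P := torsionSpace g hτ x)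
    (fun A hA => ((mem_stab_iff hτ x A).mp hA).1) hsplit.isInvariant_right
  rw [h.isVertical.eq_smul_of_annihilated hv, map_smul, h.casimir_self, smul_comm]

lemma TorsionSpace.IsContact.neg {V : Type*} [AddCommGroup V] [Module ℝ V] {P : TorsionSpace V}
    {ξ : V} {μ : ℝ} (h : P.IsContact ξ μ) : P.IsContact (-ξ) μ where
  unit := by simp [h.unit]
  pos := h.pos
  sq v := by simp [h.sq]
  t_eq u v := by simp [h.t_eq u v]

end Eigenvectors

/-- A smooth field of unit eigenvectors of the Casimir endomorphism, with constant eigenvalue `a`.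
When the eigenspaces are the vertical lines, this is a local choice of `ξ` up to sign. -/
structure IsUnitEigenfield (g : Metric n M) (τ : TriForm n M) (a : ℝ) (U : Set M)
    (ξ : VField n M) : Prop where
  smooth : SmoothOn ξ U
  unit : ∀ x ∈ U, g.inner x (ξ x) (ξ x) = 1
  eigen : ∀ x ∈ U, casimirAt g τ x (ξ x) = a • ξ x

variable (g) in
/-- The vector field `Z / |Z|`. It vanishes where `Z` does, since `0⁻¹ = 0`. -/
def normalize (Z : VField n M) : VField n M :=
  fun x => (√(g.inner x (Z x) (Z x)))⁻¹ • Z x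

lemma inner_normalize {Z : VField n M} {x : M} (hZ : 0 < g.inner x (Z x) (Z x)) :
    g.inner x (normalize g Z x) (normalize g Z x) = 1 := by
  rw [normalize, inner_smul_left, inner_smul_right, ← mul_assoc, ← mul_inv,
    Real.mul_self_sqrt hZ.le, inv_mul_cancel₀ hZ.ne']

lemma casimirAt_normalize {a : ℝ} {Z : VField n M} {x : M} (hZ : casimirAt g τ x (Z x) = a • Z x) :
    casimirAt g τ x (normalize g Z x) = a • normalize g Z x := by
  rw [normalize, map_smul, hZ, smul_comm]

lemma contMDiffOn_normalize {k : WithTop ℕ∞} (hk : k ≤ ∞) {U : Set M} {Z : VField n M}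
    (hZ : ContMDiffOn (𝓡 n) (𝓡 n).tangent k (fun x => (⟨x, Z x⟩ : TangentBundle (𝓡 n) M)) U)
    (hpos : ∀ x ∈ U, 0 < g.inner x (Z x) (Z x)) :
    ContMDiffOn (𝓡 n) (𝓡 n).tangent k
      (fun x => (⟨x, normalize g Z x⟩ : TangentBundle (𝓡 n) M)) U := by
  refine ContMDiffOn.smul_section (fun x hx => ?_) hZ
  have hsqrt : ContDiffAt ℝ k (fun r : ℝ => (√r)⁻¹) (g.inner x (Z x) (Z x)) :=
    (Real.contDiffAt_sqrt (hpos x hx).ne').inv (Real.sqrt_pos.mpr (hpos x hx)).ne'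
  exact hsqrt.contMDiffAt.comp_contMDiffWithinAt (f := fun x => g.inner x (Z x) (Z x)) x
    (contMDiffOn_inner g hk hZ hZ x hx)

lemma exists_isUnitEigenfield {hτ : IsThreeForm τ} {a β : ℝ} (hab : a ≠ β)
    (hvert : ∀ x : M, ∃ ζ, IsVerticalAt g hτ x a β ζ) (p : M) :
    ∃ (U : Set M) (ξ : VField n M), IsOpen U ∧ p ∈ U ∧ IsUnitEigenfield g τ a U ξ := by
  choose ζ hζ using hvert
  obtain ⟨Y, hY, hYp, hYeigen⟩ := exists_eigenfield hτ hab (fun x => (hζ x).casimirAt_casimirAt) p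
    (hζ p).casimir_self
  refine ⟨chartDomain n p ∩ (fun x => g.inner x (Y x) (Y x)) ⁻¹' Set.Ioi 0, normalize g Y,
    (contMDiffOn_inner g le_rfl hY hY).continuousOn.isOpen_inter_preimage (isOpen_chartDomain n p)
      isOpen_Ioi, ⟨mem_chartDomain n p, ?_⟩, ?_, fun x hx => inner_normalize hx.2,
    fun x _ => casimirAt_normalize (hYeigen x)⟩
  · change 0 < g.inner p (Y p) (Y p)
    rw [hYp, (hζ p).unit]
    exact one_pos
  · exact contMDiffOn_normalize le_rfl (hY.mono Set.inter_subset_left) fun x hx => hx.2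

/-- Such a field is `±ξ` for a local smooth unit eigenfield `ξ`, with locally constant sign. -/
lemma smoothOn_of_continuous_unit_eigen {hτ : IsThreeForm τ} {a β : ℝ} (hab : a ≠ β)
    (hvert : ∀ x : M, ∃ ζ, IsVerticalAt g hτ x a β ζ) {N : VField n M}
    (hN : ContMDiffOn (𝓡 n) (𝓡 n).tangent 0
      (fun x => (⟨x, N x⟩ : TangentBundle (𝓡 n) M)) Set.univ)
    (hunit : ∀ x, g.inner x (N x) (N x) = 1) (heigen : ∀ x, casimirAt g τ x (N x) = a • N x) :
    SmoothOn N Set.univ := by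
  intro p _
  obtain ⟨U, ξ, hU, hp, hξ⟩ := exists_isUnitEigenfield hab hvert p
  let f : M → ℝ := fun x => g.inner x (ξ x) (N x)
  have hf : ContinuousOn f U :=
    (contMDiffOn_inner g zero_le (hξ.smooth.of_le zero_le) (hN.mono U.subset_univ)).continuousOn
  have hNf (x : M) (hx : x ∈ U) : N x = f x • ξ x := by
    obtain ⟨ζ, hζ⟩ := hvert x
    exact hζ.eigen_eq_smul hab (hξ.unit x hx) (hξ.eigen x hx) (heigen x)
  have hfsq (x : M) (hx : x ∈ U) : f x * f x = 1 := by
    have hN1 := hunit x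
    rwa [hNf x hx, inner_smul_left, inner_smul_right, hξ.unit x hx, mul_one] at hN1
  let W : Set M := U ∩ (fun x => f x * f p) ⁻¹' Set.Ioi 0
  have hW : IsOpen W := (hf.mul continuousOn_const).isOpen_inter_preimage hU isOpen_Ioi
  have hpW : p ∈ W := ⟨hp, by simp only [Set.mem_preimage, hfsq p hp, Set.mem_Ioi, one_pos]⟩
  have hconst (x : M) (hx : x ∈ W) : f x = f p := by
    have hpos : 0 < f x * f p := hx.2
    rcases mul_self_eq_mul_self_iff.mp ((hfsq x hx.1).trans (hfsq p hp).symm) with h | h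
    · exact h
    · nlinarith [hfsq p hp]
  have hsmooth : SmoothOn (fun x => f p • ξ x) W :=
    ContMDiffOn.const_smul_section (hξ.smooth.mono Set.inter_subset_left)
  have hNsmooth : SmoothOn N W := hsmooth.congr fun x hx => by rw [hNf x hx.1, hconst x hx]
  exact (hNsmooth.contMDiffAt (hW.mem_nhds hpW)).contMDiffWithinAt

lemma isUnitEigenfield_normalize {hτ : IsThreeForm τ} {a β : ℝ} (hab : a ≠ β)
    (hvert : ∀ x : M, ∃ ζ, IsVerticalAt g hτ x a β ζ) {Z : VField n M}
    (hZ : Continuous fun x => (⟨x, Z x⟩ : TangentBundle (𝓡 n) M)) (hne : ∀ x, Z x ≠ 0)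
    (heigen : ∀ x, casimirAt g τ x (Z x) = a • Z x) :
    IsUnitEigenfield g τ a Set.univ (normalize g Z) := by
  have hunit (x : M) := inner_normalize (g.pos x (Z x) (hne x))
  have hcont := contMDiffOn_normalize zero_le (contMDiffOn_zero_iff.mpr hZ.continuousOn)
    fun x (_ : x ∈ Set.univ) => g.pos x (Z x) (hne x)
  exact ⟨smoothOn_of_continuous_unit_eigen hab hvert hcont hunit
    fun x => casimirAt_normalize (heigen x), fun x _ => hunit x,
    fun x _ => casimirAt_normalize (heigen x)⟩

namespace IsUnitEigenfield

variable {a β : ℝ} (hτ : IsParallelSkewTorsion g τ) {U : Set M} {ξ : VField n M}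
  (hξ : IsUnitEigenfield g τ a U ξ) (hU : IsOpen U) (hab : a ≠ β)

include hξ hU hab

lemma connection_eq_zero (hvert : ∀ x : M, ∃ ζ, IsVerticalAt g hτ.threeForm x a β ζ) {x : M}
    (hx : x ∈ U) (v : TangentSpace (𝓡 n) x) : connection g τ ξ x v = 0 := by
  obtain ⟨ζ, hζ⟩ := hvert x
  have hsmul := hζ.eigen_eq_smul hab (hξ.unit x hx) (hξ.eigen x hx)
    (casimirAt_connection_of_eigen hτ hU hx hξ.smooth hξ.eigen v)
  have hderiv := dirDeriv_inner_eq hU hx (g := g) hτ.threeForm hξ.smooth hξ.smooth v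
  rw [dirDeriv_eq_zero_of_eqOn_const hU hx hξ.unit, g.symm x (connection g τ ξ x v)] at hderiv
  rw [hsmul, show g.inner x (ξ x) (connection g τ ξ x v) = 0 by linarith, zero_smul]

theorem isSasakianOn {c : ℝ} (hc : c ≠ 0)
    (hvert : ∀ x : M, ∃ ζ, (torsionSpace g hτ.threeForm x).IsContact ζ (c ^ 2) ∧
      IsVerticalAt g hτ.threeForm x a β ζ) :
    IsSasakianOn (rescale g c hc) (fun x => c ^ 2 • τ x) U := by
  refine isSasakianOn_rescale hτ hU hξ.smooth (fun x hx => hξ.connection_eq_zero hτ hU hab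
    (fun y => (hvert y).imp fun _ => And.right) hx) hc fun x hx => ?_
  obtain ⟨ζ, hcontact, hζ⟩ := hvert x
  rcases hζ.eq_or_eq_neg hab (hξ.unit x hx) (hξ.eigen x hx) with h | h
  · rwa [h]
  · rw [h]
    exact hcontact.neg

end IsUnitEigenfield

end VerticalFields

end SkewTorsion

end

open SkewTorsion in
theorem mainTheorem6 {n : ℕ} {M : Type*} [TopologicalSpace M]
    [ChartedSpace (EuclideanSpace ℝ (Fin n)) M] [IsManifold (𝓡 n) ∞ M]
    [T2Space M] [SecondCountableTopology M] [ConnectedSpace M]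
    (g : SkewTorsion.Metric n M) (τ : SkewTorsion.TriForm n M)
    (hτ : SkewTorsion.IsParallelSkewTorsion g τ)
    (hirr : ∀ x : M, SkewTorsion.IsAlmostIrreducible (fun v w => g.inner x v w)
      (SkewTorsion.stab g τ x))
    (hfactor : ¬ SkewTorsion.HasLocalOneDimFactor g τ) :
    ∃ (c : ℝ) (hc : 0 < c),
      (∀ p : M, ∃ U : Set M, IsOpen U ∧ p ∈ U ∧
        SkewTorsion.IsSasakianOn (SkewTorsion.rescale g c hc.ne') (fun x => c ^ 2 • τ x) U) ∧
      (SkewTorsion.VerticalIsTrivial g τ →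
        SkewTorsion.IsSasakianOn (SkewTorsion.rescale g c hc.ne') (fun x => c ^ 2 • τ x)
          Set.univ) := by
  rcases exists_forall_isVerticalAt hτ hirr with ⟨β, hβ, h⟩ | ⟨μ, hμ, hn, h⟩
  · exact (hfactor (hasLocalOneDimFactor hτ hβ h)).elim
  obtain ⟨c, hc, rfl⟩ : ∃ c : ℝ, 0 < c ∧ c ^ 2 = μ :=
    ⟨√μ, Real.sqrt_pos.mpr hμ, Real.sq_sqrt hμ.le⟩
  have hab : (n - 1 : ℝ) * c ^ 2 ≠ 2 * c ^ 2 := by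
    rw [Ne, mul_left_inj' hμ.ne', sub_eq_iff_eq_add]
    norm_num
    exact_mod_cast hn
  have hvert (x : M) := (h x).imp fun _ => And.right
  refine ⟨c, hc, fun p => ?_, ?_⟩
  · obtain ⟨U, ξ, hU, hp, hξ⟩ := exists_isUnitEigenfield hab hvert p
    exact ⟨U, hU, hp, hξ.isSasakianOn hτ hU hab hc.ne' h⟩
  · rintro ⟨Z, hZ, hsplit⟩
    have heigen (x : M) : casimirAt g τ x (Z x) = ((n - 1 : ℝ) * c ^ 2) • Z x := by
      obtain ⟨-, Hor, hHor⟩ := hsplit x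
      obtain ⟨ζ, hζ⟩ := hvert x
      exact hζ.casimirAt_of_isCanonicalSplitting hHor
    exact (isUnitEigenfield_normalize hab hvert hZ (fun x => (hsplit x).1) heigen).isSasakianOn
      hτ isOpen_univ hab hc.ne' h
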